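/- Let $a = 5^{-1/2}(\delta_0+\delta_1-\delta_2)\in\ell_1(\mathbb Z)$ (complex scalars, convolution product). Then $\|a\|_1 = 3/\sqrt5>1$, $a$ is power bounded, i.e. $\sup_n\|a^n\|_1<\infty$, and $\|a^n\|_\infty\to0$ as $n\to\infty$. Call an infinite set $J\subseteq\mathbb Z$ *additively sparse* if for all $t\in\mathbb Z$ and integers $r,s\ge 0$ there is $n\in\mathbb N$ such that whenever $j_1+\dots+j_r=l_1+\dots+l_s+t$ with $j_i,l_i\in J$, $n<|j_1|<\dots<|j_r|$ and $n<|l_1|<\dots<|l_s|$, then $t=0$, $r=s$ and $j_i=l_i$ for all $i$. Such sets exist: $\{2^n:n\ge0\}$ is additively sparse. Let $J$ be any additively sparse set. Let $\mathcal T=\mathbb Z\times\mathbb Z^+$ (with $\mathbb Z^+=\{0,1,2,\dots\}$ and coordinatewise addition), topologised by declaring $U\subseteq\mathcal T$ open if for every $\gamma\in U$ there is $n\in\mathbb N$ with $\mathcal V_{\gamma,n}\subseteq U$, where $\mathcal V_{\gamma,n}$ is the set of $\beta\in\mathcal T$ with $\beta_1\le\gamma_1$ and $\beta_0=\gamma_0+j_1+\dots+j_{\gamma_1-\beta_1}$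 for some $j_r\in J$ with $n<|j_1|<\dots<|j_{\gamma_1-\beta_1}|$. Let $\mathcal S=\mathcal T\cup\{\infty\}$ be the one-point compactification, with $\infty+\gamma=\gamma+\infty=\infty$ for all $\gamma\in\mathcal S$. Identify $n\in\mathbb Z$ with $(n,0)\in\mathcal S$, and $\ell_1(\mathbb Z)$ with the elements of $\ell_1(\mathcal S)$ supported on $\mathbb Z$. Put $e=(0,1)$. Then: 1. $\mathcal S$ is a compact Hausdorff semigroup with separately continuous addition in which $\mathbb Z$ is dense, and there is exactly one bounded linear projection $\Theta:\ell_1(\mathcal S)\to\ell_1(\mathbb Z)$ that is a homomorphism for convolution and satisfies $\Theta(\delta_e)=a$. 2. $\ker\Theta$ is weak*-closed in $\ell_1(\mathcal S)$ with respect to $C(\mathcal S)$. Let $E\subseteq\ell_\infty(\mathbb Z)$ be the set of restrictions to $\mathbb Z$ of those $f\in C(\mathcal S)$ with $\sum_{s\in\mathcal S}\mu(s)f(s)=0$ for all $\mu\in\ker\Theta$. Then $E$ is a shift-invariant predual of $\ell_1(\mathbb Z)$: it is a closed subspace of $\ell_\infty(\mathbb Z)$, invariant under the bilateral shift and its inverse,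 and the canonical map $\iota_E:\ell_1(\mathbb Z)\to E^*$, $\langle\iota_E(b),x\rangle=\sum_n b(n)x(n)$, is an isomorphism of Banach spaces. Moreover $\langle\iota_E(\delta_n),x\rangle\to\langle\iota_E(a),x\rangle$ for every $x\in E$ as $|n|\to\infty$ through $J$. 3. The isomorphism $\iota_E$ is not an isometry. -/

import Mathlib

open Filter Topology
open scoped ENNReal lp

noncomputable section

namespace ShiftPredual

/-! ### The Banach algebra `ℓ¹(S)` of an additive commutative monoid -/

section Convolution

variable {S : Type*} [AddCommMonoid S]

/-- The convolution of two elements of `ℓ¹(S)` is again summable. -/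
theorem memℓp_addConvolution (f g : ℓ¹(S, ℂ)) :
    Memℓp (DiscreteConvolution.addConvolution (LinearMap.mul ℂ ℂ) (⇑f) (⇑g)) 1 := by
  have hf : Summable fun s => ‖f s‖ := by
    simpa using (lp.memℓp f).summable (by simp)
  have hg : Summable fun s => ‖g s‖ := by
    simpa using (lp.memℓp g).summable (by simp)
  have hfg : Summable fun p : S × S => ‖f p.1 * g p.2‖ := by
    simpa using hf.mul_of_nonneg hg (fun _ => norm_nonneg _) (fun _ => norm_nonneg _)
  let u : (Σ x : S, DiscreteConvolution.addFiber x) → S × S := fun q => q.2.1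
  have hu : Function.Injective u := by
    rintro ⟨x, p, hp⟩ ⟨y, q, hq⟩ h
    have h' : p = q := h
    subst h'
    rw [DiscreteConvolution.mem_addFiber] at hp hq
    subst hp
    subst hq
    rfl
  have hs := hfg.comp_injective hu
  apply memℓp_gen
  have hs2 := hs.sigma
  refine Summable.of_nonneg_of_le (fun _ => by positivity) (fun x => ?_) hs2
  simp only [ENNReal.toReal_one, Real.rpow_one]
  exact norm_tsum_le_tsum_norm (hs.sigma_factor x)

/-- Convolution on `ℓ¹(S)`: `(f * g)(γ) = ∑_{α + β = γ} f(α) g(β)`. -/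
def conv (f g : ℓ¹(S, ℂ)) : ℓ¹(S, ℂ) :=
  ⟨DiscreteConvolution.addConvolution (LinearMap.mul ℂ ℂ) (⇑f) (⇑g), memℓp_addConvolution f g⟩

/-- The point mass `δ_s`. -/
def pointMass {S : Type*} (s : S) : ℓ¹(S, ℂ) := by
  classical exact lp.single 1 s (1 : ℂ)

/-- Convolution powers, with `a⁰ = δ_0`. -/
def convPow (a : ℓ¹(S, ℂ)) : ℕ → ℓ¹(S, ℂ)
  | 0 => pointMass 0
  | n + 1 => conv (convPow a n) a

/-- `a` is power bounded for the `ℓ¹`-norm. -/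
def IsPowerBounded (a : ℓ¹(S, ℂ)) : Prop := ∃ C : ℝ, ∀ n : ℕ, ‖convPow a n‖ ≤ C

end Convolution

/-- The supremum norm of an element of `ℓ¹(S)`. -/
def supNorm {S : Type*} (f : ℓ¹(S, ℂ)) : ℝ := ⨆ s, ‖f s‖

/-! ### Concrete and shift-invariant preduals of `ℓ¹(ℤ)` -/

/-- The bilinear pairing `⟨a, x⟩ = ∑ n, a(n) x(n)` of `ℓ¹(ℤ)` with `ℓ^∞(ℤ)`. -/
def dualityPairing : ℓ¹(ℤ, ℂ) →L[ℂ] ℓ^∞(ℤ, ℂ) →L[ℂ] ℂ :=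
  lp.dualPairing 1 ∞ (fun _ => ContinuousLinearMap.mul ℂ ℂ) (K := 1)
    (fun _ => by simp)

theorem dualityPairing_apply (a : ℓ¹(ℤ, ℂ)) (x : ℓ^∞(ℤ, ℂ)) :
    dualityPairing a x = ∑' n, a n * x n := rfl

/-- The canonical map `ι_E : ℓ¹(ℤ) → E*`, `⟨ι_E(a), x⟩ = ⟨a, x⟩`; here `E*` carries the dual norm of
the norm that `E` inherits from `ℓ^∞(ℤ)`. -/
def iota (E : Submodule ℂ (ℓ^∞(ℤ, ℂ))) : ℓ¹(ℤ, ℂ) →L[ℂ] (E →L[ℂ] ℂ) :=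
  (ContinuousLinearMap.precomp ℂ E.subtypeL).comp dualityPairing

theorem iota_apply (E : Submodule ℂ (ℓ^∞(ℤ, ℂ))) (a : ℓ¹(ℤ, ℂ)) (x : E) :
    iota E a x = ∑' n, a n * (x : ℓ^∞(ℤ, ℂ)) n := rfl

/-- A closed subspace `E` of `ℓ^∞(ℤ)` for which `ι_E` is an isomorphism (not necessarily isometric)
of Banach spaces. -/
structure IsConcretePredual (E : Submodule ℂ (ℓ^∞(ℤ, ℂ))) : Prop where
  isClosed : IsClosed (E : Set (ℓ^∞(ℤ, ℂ)))
  iota_isInvertible : (iota E).IsInvertible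

/-- The translate `n ↦ x(n + k)` of a bounded sequence; `k = ± 1` gives the bilateral shift and its
inverse. -/
def translate (k : ℤ) (x : ℓ^∞(ℤ, ℂ)) : ℓ^∞(ℤ, ℂ) :=
  ⟨fun n => x (n + k), by
    obtain ⟨C, hC⟩ := (lp.memℓp x).bddAbove
    refine memℓp_infty ⟨C, ?_⟩
    rintro _ ⟨n, rfl⟩
    exact hC ⟨n + k, rfl⟩⟩

structure IsShiftInvariantPredual (E : Submodule ℂ (ℓ^∞(ℤ, ℂ))) : Prop
    extends IsConcretePredual E where
  translate_mem : ∀ k : ℤ, ∀ x ∈ E, translate k x ∈ E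

/-! ### Preduals induced by semigroup compactifications of `ℤ` -/

section Compactification

/-- `Θ : ℓ¹(S) → ℓ¹(ℤ)` is an algebra homomorphism and a projection, where `ℓ¹(ℤ)` is identified
with the elements of `ℓ¹(S)` that are supported on `φ(ℤ)`. -/
structure IsHomProjection {S : Type*} [AddCommMonoid S] (φ : ℤ →+ S)
    (Θ : ℓ¹(S, ℂ) →L[ℂ] ℓ¹(ℤ, ℂ)) : Prop where
  map_conv : ∀ μ ν : ℓ¹(S, ℂ), Θ (conv μ ν) = conv (Θ μ) (Θ ν)
  proj : ∀ μ : ℓ¹(S, ℂ), (∀ s, s ∉ Set.range φ → μ s = 0) → ∀ n : ℤ, Θ μ n = μ (φ n)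


/-- `S` is a semitopological semigroup compactification of `ℤ` through the embedding `φ`. -/
structure IsSemitopologicalCompactification {S : Type*} [AddCommMonoid S] [TopologicalSpace S]
    (φ : ℤ →+ S) : Prop where
  compactSpace : CompactSpace S
  t2Space : T2Space S
  continuous_add_left : ∀ s : S, Continuous fun t : S => s + t
  continuous_add_right : ∀ s : S, Continuous fun t : S => t + s
  injective : Function.Injective φ
  denseRange : DenseRange φ

/-- The weak*-topology on `ℓ¹(S)` with respect to `C(S)`: the coarsest topology for which
`μ ↦ ∑ s, μ(s) f(s)` is continuous for every `f ∈ C(S)`. -/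
@[reducible] def weakStarTopology (S : Type*) [TopologicalSpace S] : TopologicalSpace (ℓ¹(S, ℂ)) :=
  TopologicalSpace.induced (fun (μ : ℓ¹(S, ℂ)) (f : C(S, ℂ)) => ∑' s, μ s * f s)
    Pi.topologicalSpace

variable {S : Type*} [TopologicalSpace S] [CompactSpace S]

/-- Every `μ ∈ ℓ¹(S)` can be integrated against every `f ∈ C(S)`. -/
theorem summable_mul_continuousMap (μ : ℓ¹(S, ℂ)) (f : C(S, ℂ)) :
    Summable fun s => μ s * f s := by
  have hμ : Summable fun s => ‖μ s‖ := by
    simpa using (lp.memℓp μ).summable (by simp)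
  refine Summable.of_norm_bounded (hμ.mul_right ‖f‖) (fun s => ?_)
  rw [norm_mul]
  exact mul_le_mul_of_nonneg_left (f.norm_coe_le_norm s) (norm_nonneg _)

/-- The preannihilator of `ker Θ` in `C(S)`. -/
def preannihilator (Θ : ℓ¹(S, ℂ) →L[ℂ] ℓ¹(ℤ, ℂ)) : Submodule ℂ C(S, ℂ) where
  carrier := {f | ∀ μ : ℓ¹(S, ℂ), Θ μ = 0 → ∑' s, μ s * f s = 0}
  add_mem' {f g} hf hg μ hμ := by
    have h := (summable_mul_continuousMap μ f).tsum_add (summable_mul_continuousMap μ g)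
    rw [hf μ hμ, hg μ hμ] at h
    simpa [mul_add] using h
  zero_mem' μ _ := by simp
  smul_mem' c f hf μ hμ := by
    have h := (summable_mul_continuousMap μ f).tsum_mul_left c
    rw [hf μ hμ] at h
    simpa [mul_left_comm] using h

/-- Restriction of functions on `S` to functions on `ℤ`. -/
def restrictInt [AddCommMonoid S] (φ : ℤ →+ S) : C(S, ℂ) →ₗ[ℂ] ℓ^∞(ℤ, ℂ) where
  toFun f := ⟨fun n => f (φ n), memℓp_infty ⟨‖f‖, by
    rintro _ ⟨n, rfl⟩
    exact f.norm_coe_le_norm _⟩⟩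
  map_add' _ _ := rfl
  map_smul' _ _ := rfl

/-- The subspace of `ℓ^∞(ℤ)` to which the preannihilator of `ker Θ` restricts. -/
def inducedPredual [AddCommMonoid S] (φ : ℤ →+ S) (Θ : ℓ¹(S, ℂ) →L[ℂ] ℓ¹(ℤ, ℂ)) :
    Submodule ℂ (ℓ^∞(ℤ, ℂ)) :=
  (preannihilator Θ).map (restrictInt φ)

end Compactification

/-! ### The semigroup `(ℤ × ℤ⁺) ∪ {∞}` attached to an additively sparse set -/

/-- An infinite set `J ⊆ ℤ` is additively sparse if for all `t ∈ ℤ` and `r, s ≥ 0` there is `n` such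
that `j₁ + ⋯ + j_r = l₁ + ⋯ + l_s + t` with all `j_i, l_i ∈ J`, `n < |j₁| < ⋯ < |j_r|` and
`n < |l₁| < ⋯ < |l_s|` forces `t = 0`, `r = s` and `j_i = l_i` for all `i`. -/
def IsAdditivelySparse (J : Set ℤ) : Prop :=
  J.Infinite ∧ ∀ (t : ℤ) (r s : ℕ), ∃ n : ℕ, ∀ (j : Fin r → ℤ) (l : Fin s → ℤ),
    (∀ i, j i ∈ J ∧ (n : ℤ) < |j i|) → StrictMono (fun i => |j i|) →
    (∀ i, l i ∈ J ∧ (n : ℤ) < |l i|) → StrictMono (fun i => |l i|) →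
    ∑ i, j i = ∑ i, l i + t →
    t = 0 ∧ r = s ∧ ∀ (i : Fin r) (i' : Fin s), (i : ℕ) = (i' : ℕ) → j i = l i'

/-- The additive semigroup `ℤ × ℤ⁺`. The set `J` only enters through the topology below. -/
def TSpace (_J : Set ℤ) : Type := ℤ × ℕ

variable (J : Set ℤ)

instance : AddCommMonoid (TSpace J) := inferInstanceAs (AddCommMonoid (ℤ × ℕ))

/-- The basic neighbourhood `V_{γ,n}`: all `β` with `β₁ ≤ γ₁` and `β₀ = γ₀ + j₁ + ⋯ + j_m`, where
`m = γ₁ - β₁`, `j_r ∈ J` and `n < |j₁| < ⋯ < |j_m|`. -/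
def basicNhd (γ : TSpace J) (n : ℕ) : Set (TSpace J) :=
  {β | β.2 ≤ γ.2 ∧ ∃ j : Fin (γ.2 - β.2) → ℤ, (∀ r, j r ∈ J ∧ (n : ℤ) < |j r|) ∧
    StrictMono (fun r => |j r|) ∧ β.1 = γ.1 + ∑ r, j r}

theorem basicNhd_anti (γ : TSpace J) {n m : ℕ} (h : n ≤ m) : basicNhd J γ m ⊆ basicNhd J γ n := by
  rintro β ⟨hβ, j, hj, hmono, hsum⟩
  exact ⟨hβ, j, fun r => ⟨(hj r).1, lt_of_le_of_lt (by exact_mod_cast h) (hj r).2⟩, hmono, hsum⟩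

/-- `U` is open when it contains a basic neighbourhood of each of its points. -/
instance : TopologicalSpace (TSpace J) where
  IsOpen U := ∀ γ ∈ U, ∃ n, basicNhd J γ n ⊆ U
  isOpen_univ _ _ := ⟨0, Set.subset_univ _⟩
  isOpen_inter U V hU hV γ hγ := by
    obtain ⟨n, hn⟩ := hU γ hγ.1
    obtain ⟨m, hm⟩ := hV γ hγ.2
    exact ⟨max n m, Set.subset_inter ((basicNhd_anti J γ (le_max_left n m)).trans hn)
      ((basicNhd_anti J γ (le_max_right n m)).trans hm)⟩
  isOpen_sUnion s hs γ hγ := by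
    obtain ⟨U, hU, hγU⟩ := hγ
    obtain ⟨n, hn⟩ := hs U hU γ hγU
    exact ⟨n, hn.trans (Set.subset_sUnion_of_mem hU)⟩

/-- The one-point compactification of `TSpace J`; the point at infinity is a semigroup zero. -/
abbrev SSpace : Type := OnePoint (TSpace J)

instance : AddCommMonoid (SSpace J) := inferInstanceAs (AddCommMonoid (WithTop (TSpace J)))

theorem SSpace.coe_add_coe (x y : TSpace J) :
    (x : SSpace J) + (y : SSpace J) = ((x + y : TSpace J) : SSpace J) :=
  rfl

theorem SSpace.infty_add (x : SSpace J) : (OnePoint.infty : SSpace J) + x = OnePoint.infty := rfl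

/-- The embedding `n ↦ (n, 0)` of `ℤ`. -/
def ofInt : ℤ →+ SSpace J where
  toFun n := OnePoint.some ((n, 0) : ℤ × ℕ)
  map_zero' := rfl
  map_add' _ _ := rfl

/-- The semigroup generator `e = (0, 1)`. -/
def gen : SSpace J := OnePoint.some ((0, 1) : ℤ × ℕ)

/-- The element `5^{-1/2} (δ_0 + δ_1 - δ_2)` of `ℓ¹(ℤ)`. -/
def newmanElement : ℓ¹(ℤ, ℂ) :=
  ((√5 : ℝ) : ℂ)⁻¹ • (pointMass 0 + pointMass 1 - pointMass 2)

end ShiftPredual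

end

open ShiftPredual

/-!
# A shift-invariant predual of `ℓ¹(ℤ)` that is not isometric

The proof has four ingredients.

* *Power boundedness* (`isPowerBounded_newmanElement`). On the unit circle the Fourier transform `φ`
  of `a = 5^{-1/2} (δ_0 + δ_1 - δ_2)` satisfies `|φ|² = 1 - x` with `0 ≤ x ≤ 1` vanishing to second
  order at its zeros. Integrating `|φ|^{2n}` and `|(φⁿ e^{-inθ})'|²` gives
  `∑ |aⁿ(k)|² ≲ n^{-1/2}` and `∑ (k - n)² |aⁿ(k)|² ≲ n^{1/2}`. The Cauchy–Schwarz inequality turns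
  the two estimates into a bound for `‖aⁿ‖₁`, and the first one shows `‖aⁿ‖_∞ → 0`.
* *The compactification and the projection.* The basic neighbourhoods `V_{γ,n}` are compact and
  open; additive sparseness separates them for distinct centres when `n` is large
  (`eventually_sumSet_separated`). The projection must be `δ_{(n,k)} ↦ δ_n * a^k`, `δ_∞ ↦ 0`.
* *The kernel of `Θ` is weak*-closed.* Let `𝒮` be the compactification. As it is countable and
  compact, the dual of `C(𝒮)` is `ℓ¹(𝒮)` (`dualEquiv`). By the Krein–Šmulian theorem, proved here in
  the form `exists_annihilating_of_isClosed_inter_ball`, it suffices that a weak*-limit `μ` of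
  bounded `ν ∈ ker Θ` along an ultrafilter lies in `ker Θ`. Choose a finite set `G` of centres that
  carries, up to `ε`, the masses in `ℤ × ℤ⁺` of `μ` and of the weak*-limit of the `|ν|`. A *folding
  operator* `Φ` on `ℓ¹(ℤ)` (`foldOp`, `exists_folding`) cuts out windows around the sums `p` of `m`
  large elements of `J` and maps `δ_{p+w}` to `δ_w * a^m`. It is bounded by the power bound of `a`,
  it satisfies `Φ Θ δ_β = Θ δ_γ` for all `β` in the neighbourhood of `γ ∈ G`, and `Φ Θ δ_β` is small
  for `β` outside a compact set because `‖a^k‖_∞ → 0`; on the rest of the compact set the limit of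
  the `|ν|` has mass at most `ε`. Hence `0 = Φ Θ ν` is eventually, up to a multiple of `ε`, the sum
  over `γ ∈ G` of `ν(V_γ) Θ δ_γ`, which converges to `Θ μ` up to a multiple of `ε`
  (`norm_apply_le_of_tendsto`).
* *The predual.* By the Krein–Šmulian theorem the preannihilator of `ker Θ` separates points of
  `ℓ¹(ℤ)`, so `ι_E` is injective; it is surjective by the Hahn–Banach theorem and `dualEquiv`, and
  `E` is closed since `‖f‖ ≤ ‖Θ‖ ‖f|_ℤ‖` on the preannihilator. In `𝒮` one has `j → e` as `|j| → ∞`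
  through `J`, so `δ_j → Θ δ_e = a` in the weak*-topology. Therefore `‖ι_E(a)‖ ≤ 1 < ‖a‖`, and `ι_E`
  is not an isometry.
-/

noncomputable section

namespace ShiftPredual

/-! ### Operators on `ℓ¹(I)` determined by point masses -/

section SummableSequences

variable {I : Type*} {E : Type*} [NormedAddCommGroup E] [NormedSpace ℂ E]

theorem summable_norm_coe (μ : ℓ¹(I, ℂ)) : Summable fun i => ‖μ i‖ := by
  simpa using (lp.memℓp μ).summable (by simp)

theorem norm_eq_tsum_norm (μ : ℓ¹(I, ℂ)) : ‖μ‖ = ∑' i, ‖μ i‖ := by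
  simpa using lp.norm_eq_tsum_rpow (by simp) μ

theorem pointMass_apply [DecidableEq I] (s t : I) :
    (pointMass s : ℓ¹(I, ℂ)) t = if t = s then 1 else 0 := by
  unfold pointMass
  by_cases h : t = s
  · subst h
    simp
  · simp [h]

theorem norm_pointMass (s : I) : ‖(pointMass s : ℓ¹(I, ℂ))‖ = 1 := by
  classical
  simp [norm_eq_tsum_norm, pointMass_apply, apply_ite (norm : ℂ → ℝ)]

theorem hasSum_smul_pointMass (μ : ℓ¹(I, ℂ)) : HasSum (fun i => μ i • pointMass i) μ := by
  classical
  have h := lp.hasSum_single (E := fun _ : I => ℂ) (p := 1) (by simp) μ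
  refine h.congr_fun ?_
  intro i
  ext j
  by_cases hj : j = i
  · subst hj
    simp [pointMass_apply]
  · simp [pointMass_apply, hj]

theorem summable_norm_smul_of_le (μ : ℓ¹(I, ℂ)) {T : I → E} {C : ℝ} (hT : ∀ i, ‖T i‖ ≤ C) :
    Summable fun i => ‖μ i • T i‖ := by
  refine Summable.of_nonneg_of_le (fun _ => norm_nonneg _) (fun i => ?_)
    ((summable_norm_coe μ).mul_right C)
  rw [norm_smul]
  exact mul_le_mul_of_nonneg_left (hT i) (norm_nonneg _)

theorem tsum_norm_smul_le {T : I → E} {C : ℝ} (hT : ∀ i, ‖T i‖ ≤ C) (μ : ℓ¹(I, ℂ)) :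
    ∑' i, ‖μ i • T i‖ ≤ (∑' i, ‖μ i‖) * C := by
  rw [← tsum_mul_right (f := fun i => ‖μ i‖)]
  refine (summable_norm_smul_of_le μ hT).tsum_le_tsum (fun i => ?_)
    ((summable_norm_coe μ).mul_right C)
  rw [norm_smul]
  exact mul_le_mul_of_nonneg_left (hT i) (norm_nonneg _)

theorem norm_tsum_smul_le {T : I → E} {C : ℝ} (hT : ∀ i, ‖T i‖ ≤ C) (μ : ℓ¹(I, ℂ)) :
    ‖∑' i, μ i • T i‖ ≤ C * ‖μ‖ := by
  rw [norm_eq_tsum_norm μ, mul_comm]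
  have h : ‖∑' i, μ i • T i‖ ≤ ∑' i, ‖μ i • T i‖ :=
    norm_tsum_le_tsum_norm (summable_norm_smul_of_le μ hT)
  exact h.trans (tsum_norm_smul_le hT μ)

theorem hasSum_clm_apply (L : ℓ¹(I, ℂ) →L[ℂ] E) (μ : ℓ¹(I, ℂ)) :
    HasSum (fun i => μ i • L (pointMass i)) (L μ) := by
  simpa using (hasSum_smul_pointMass μ).mapL L

theorem clm_ext_pointMass {L L' : ℓ¹(I, ℂ) →L[ℂ] E}
    (h : ∀ i, L (pointMass i) = L' (pointMass i)) : L = L' := by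
  ext1 μ
  refine (hasSum_clm_apply L μ).unique ?_
  simpa only [h] using hasSum_clm_apply L' μ

theorem norm_clm_pointMass_le (L : ℓ¹(I, ℂ) →L[ℂ] E) (i : I) : ‖L (pointMass i)‖ ≤ ‖L‖ := by
  simpa [norm_pointMass] using L.le_opNorm (pointMass i)

theorem norm_clm_apply_le_tsum (L : ℓ¹(I, ℂ) →L[ℂ] E) (μ : ℓ¹(I, ℂ)) {g : I → ℝ}
    (hg : ∀ i, ‖L (pointMass i)‖ ≤ g i) (hs : Summable fun i => ‖μ i‖ * g i) :
    ‖L μ‖ ≤ ∑' i, ‖μ i‖ * g i := by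
  rw [← (hasSum_clm_apply L μ).tsum_eq]
  refine tsum_of_norm_bounded hs.hasSum fun i => ?_
  rw [norm_smul]
  exact mul_le_mul_of_nonneg_left (hg i) (norm_nonneg _)

theorem norm_clm_apply_le (L : ℓ¹(I, ℂ) →L[ℂ] E) (μ : ℓ¹(I, ℂ)) {C : ℝ}
    (hC : ∀ i, ‖L (pointMass i)‖ ≤ C) : ‖L μ‖ ≤ C * ‖μ‖ := by
  refine (norm_clm_apply_le_tsum L μ hC ((summable_norm_coe μ).mul_right C)).trans_eq ?_
  rw [norm_eq_tsum_norm μ, mul_comm]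
  exact tsum_mul_right

variable [CompleteSpace E]

theorem summable_smul_of_le (μ : ℓ¹(I, ℂ)) {T : I → E} {C : ℝ} (hT : ∀ i, ‖T i‖ ≤ C) :
    Summable fun i => μ i • T i :=
  (summable_norm_smul_of_le μ hT).of_norm

theorem tsum_add_smul_of_le {T : I → E} {C : ℝ} (hT : ∀ i, ‖T i‖ ≤ C) (μ ν : ℓ¹(I, ℂ)) :
    ∑' i, (μ + ν) i • T i = ∑' i, μ i • T i + ∑' i, ν i • T i := by
  rw [← (summable_smul_of_le μ hT).tsum_add (summable_smul_of_le ν hT)]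
  refine tsum_congr fun i => ?_
  rw [lp.coeFn_add, Pi.add_apply, add_smul]

theorem tsum_smul_smul_of_le {T : I → E} {C : ℝ} (hT : ∀ i, ‖T i‖ ≤ C) (c : ℂ) (μ : ℓ¹(I, ℂ)) :
    ∑' i, (c • μ) i • T i = c • ∑' i, μ i • T i := by
  rw [← (summable_smul_of_le μ hT).tsum_const_smul c]
  refine tsum_congr fun i => ?_
  rw [lp.coeFn_smul, Pi.smul_apply, smul_assoc]

/-- The bounded operator on `ℓ¹(I)` that sends each point mass `δ_i` to `T i`, for a bounded
family `T`. -/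
def ofFamily (T : I → E) (C : ℝ) (hT : ∀ i, ‖T i‖ ≤ C) : ℓ¹(I, ℂ) →L[ℂ] E :=
  LinearMap.mkContinuous
    { toFun := fun μ => ∑' i, μ i • T i
      map_add' := tsum_add_smul_of_le hT
      map_smul' := tsum_smul_smul_of_le hT }
    C (norm_tsum_smul_le hT)

theorem ofFamily_apply (T : I → E) (C : ℝ) (hT : ∀ i, ‖T i‖ ≤ C) (μ : ℓ¹(I, ℂ)) :
    ofFamily T C hT μ = ∑' i, μ i • T i := rfl

@[simp]
theorem ofFamily_pointMass (T : I → E) (C : ℝ) (hT : ∀ i, ‖T i‖ ≤ C) (i : I) :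
    ofFamily T C hT (pointMass i) = T i := by
  classical
  rw [ofFamily_apply, tsum_eq_single i]
  · simp [pointMass_apply]
  · intro j hj
    simp [pointMass_apply, hj]

theorem norm_ofFamily_le (T : I → E) {C : ℝ} (hT : ∀ i, ‖T i‖ ≤ C) (hC : 0 ≤ C) :
    ‖ofFamily T C hT‖ ≤ C :=
  LinearMap.mkContinuous_norm_le _ hC _

end SummableSequences

/-! ### The convolution algebra -/

section ConvolutionAlgebra

variable {S : Type*} [AddCommMonoid S]

/-- Convolution as a bounded bilinear map, defined by `δ_s * δ_t = δ_{s + t}`. -/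
def convL : ℓ¹(S, ℂ) →L[ℂ] ℓ¹(S, ℂ) →L[ℂ] ℓ¹(S, ℂ) :=
  ofFamily (fun s => ofFamily (fun t => pointMass (s + t)) 1 fun _ => (norm_pointMass _).le) 1
    fun _ => norm_ofFamily_le _ _ zero_le_one

theorem convL_apply (f g : ℓ¹(S, ℂ)) : convL f g = conv f g := by
  classical
  ext x
  have hsum : Summable fun p : S × S => f p.1 * g p.2 :=
    summable_mul_of_summable_norm (summable_norm_coe f) (summable_norm_coe g)
  have hconv : conv f g x = ∑' p : S × S, if p.1 + p.2 = x then f p.1 * g p.2 else 0 := by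
    change ∑' p : DiscreteConvolution.addFiber x, f p.1.1 * g p.1.2 = _
    rw [tsum_subtype (DiscreteConvolution.addFiber x) fun p : S × S => f p.1 * g p.2]
    refine tsum_congr fun p => ?_
    simp [Set.indicator_apply, DiscreteConvolution.mem_addFiber]
  have hsum' : Summable fun p : S × S => if p.1 + p.2 = x then f p.1 * g p.2 else 0 := by
    refine Summable.of_norm_bounded hsum.norm fun p => ?_
    split_ifs
    · exact le_rfl
    · rw [norm_zero]
      exact norm_nonneg _
  rw [hconv, hsum'.tsum_prod]
  let ev : ℓ¹(S, ℂ) →L[ℂ] ℂ := lp.evalCLM ℂ (fun _ : S => ℂ) 1 x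
  have h1 : ∀ s, HasSum (fun t => if s + t = x then f s * g t else 0)
      (f s • ev (convL (pointMass s) g)) := by
    intro s
    have := (hasSum_clm_apply (ev.comp (convL (pointMass s))) g).const_smul (f s)
    refine this.congr_fun ?_
    intro t
    change _ = f s • g t • (convL (pointMass s) (pointMass t) : ℓ¹(S, ℂ)) x
    simp [convL, pointMass_apply, eq_comm]
  rw [tsum_congr fun s => (h1 s).tsum_eq]
  exact (hasSum_clm_apply (ev.comp (convL.flip g)) f).tsum_eq.symm

theorem conv_pointMass (s t : S) :
    conv (pointMass s) (pointMass t : ℓ¹(S, ℂ)) = pointMass (s + t) := by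
  simp [← convL_apply, convL]

theorem conv_comm (f g : ℓ¹(S, ℂ)) : conv f g = conv g f := by
  have h : (convL : ℓ¹(S, ℂ) →L[ℂ] ℓ¹(S, ℂ) →L[ℂ] ℓ¹(S, ℂ)) = convL.flip := by
    refine clm_ext_pointMass fun s => clm_ext_pointMass fun t => ?_
    simp [convL_apply, conv_pointMass, add_comm]
  rw [← convL_apply f g, h, ContinuousLinearMap.flip_apply, convL_apply]

theorem conv_assoc (f g h : ℓ¹(S, ℂ)) : conv (conv f g) h = conv f (conv g h) := by
  let c : ℓ¹(S, ℂ) →L[ℂ] ℓ¹(S, ℂ) →L[ℂ] ℓ¹(S, ℂ) := convL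
  have h3 : ∀ s t, (c (pointMass (s + t))) = (c (pointMass s)).comp (c (pointMass t)) := by
    intro s t
    refine clm_ext_pointMass fun u => ?_
    simp [c, convL_apply, conv_pointMass, add_assoc]
  have h2 : ∀ s, (c.comp (c (pointMass s))) =
      (ContinuousLinearMap.compL ℂ ℓ¹(S, ℂ) ℓ¹(S, ℂ) ℓ¹(S, ℂ) (c (pointMass s))).comp c := by
    intro s
    refine clm_ext_pointMass fun t => ?_
    simp [c, convL_apply, conv_pointMass, ← h3 s t]
  have h1 : (c.flip h).comp (c.flip g) = c.flip (c g h) := by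
    refine clm_ext_pointMass fun s => ?_
    have := congrArg (fun L => L g h) (h2 s)
    simpa using this
  have := congrArg (fun L => L f) h1
  simpa [c, convL_apply] using this

theorem conv_pointMass_zero (f : ℓ¹(S, ℂ)) : conv f (pointMass 0) = f := by
  have h : (convL : ℓ¹(S, ℂ) →L[ℂ] ℓ¹(S, ℂ) →L[ℂ] ℓ¹(S, ℂ)).flip (pointMass 0) =
      ContinuousLinearMap.id ℂ _ := by
    refine clm_ext_pointMass fun s => ?_
    simp [convL_apply, conv_pointMass]
  have := congrArg (fun L => L f) h
  simpa [convL_apply] using this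

theorem pointMass_zero_conv (f : ℓ¹(S, ℂ)) : conv (pointMass 0) f = f := by
  rw [conv_comm, conv_pointMass_zero]

theorem convPow_add (a : ℓ¹(S, ℂ)) (m n : ℕ) :
    convPow a (m + n) = conv (convPow a m) (convPow a n) := by
  induction n with
  | zero => simp [convPow, conv_pointMass_zero]
  | succ n ih => rw [← add_assoc, convPow, convPow, ih, conv_assoc]

/-- A bounded operator into a convolution algebra that is multiplicative on point masses is
multiplicative. -/
theorem map_conv_of_pointMass {R : Type*} [AddCommMonoid R] (L : ℓ¹(S, ℂ) →L[ℂ] ℓ¹(R, ℂ))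
    (hL : ∀ s t, L (pointMass (s + t)) = conv (L (pointMass s)) (L (pointMass t)))
    (f g : ℓ¹(S, ℂ)) : L (conv f g) = conv (L f) (L g) := by
  have h2 : ∀ s, L.comp (convL (pointMass s)) = (convL (L (pointMass s))).comp L := by
    intro s
    refine clm_ext_pointMass fun t => ?_
    simp [convL_apply, conv_pointMass, hL]
  have h1 : L.comp (convL.flip g) = (convL.flip (L g)).comp L := by
    refine clm_ext_pointMass fun s => ?_
    simpa using congrArg (fun L => L g) (h2 s)
  simpa [convL_apply] using congrArg (fun L => L f) h1

end ConvolutionAlgebra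

section Translation

theorem conv_pointMass_apply (k : ℤ) (f : ℓ¹(ℤ, ℂ)) (n : ℤ) :
    conv (pointMass k) f n = f (n - k) := by
  classical
  let ev : ℤ → ℓ¹(ℤ, ℂ) →L[ℂ] ℂ := fun x => lp.evalCLM ℂ (fun _ : ℤ => ℂ) 1 x
  have h : (ev n).comp (convL (pointMass k)) = ev (n - k) := by
    refine clm_ext_pointMass fun t => ?_
    change (convL (pointMass k) (pointMass t) : ℓ¹(ℤ, ℂ)) n = (pointMass t : ℓ¹(ℤ, ℂ)) (n - k)
    rw [convL_apply, conv_pointMass, pointMass_apply, pointMass_apply]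
    congr 1
    simp [sub_eq_iff_eq_add, add_comm]
  have h' := congrArg (fun L => L f) h
  rw [← convL_apply]
  exact h'

theorem norm_conv_pointMass (k : ℤ) (f : ℓ¹(ℤ, ℂ)) : ‖conv (pointMass k) f‖ = ‖f‖ := by
  rw [norm_eq_tsum_norm, norm_eq_tsum_norm]
  simp only [conv_pointMass_apply]
  exact (Equiv.subRight k).tsum_eq fun n => ‖f n‖

end Translation

/-! ### The dual of `C(K)` for a countable compact space `K` -/

section CountableCompact

variable {K : Type*} [TopologicalSpace K] [CompactSpace K]

/-- The pairing of `ℓ¹(K)` with `C(K)`, as a map into the dual of `C(K)`. -/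
def toDual : ℓ¹(K, ℂ) →L[ℂ] (C(K, ℂ) →L[ℂ] ℂ) :=
  ofFamily (E := C(K, ℂ) →L[ℂ] ℂ) (fun s => ContinuousMap.evalCLM ℂ s) 1 fun s =>
    ContinuousLinearMap.opNorm_le_bound _ zero_le_one fun f : C(K, ℂ) => by
      simpa using f.norm_coe_le_norm s

theorem toDual_apply (μ : ℓ¹(K, ℂ)) (f : C(K, ℂ)) : toDual μ f = ∑' s, μ s * f s := by
  have h := hasSum_clm_apply ((ContinuousLinearMap.apply ℂ ℂ f).comp toDual) μ
  have h2 := h.tsum_eq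
  simp only [ContinuousLinearMap.comp_apply, ContinuousLinearMap.apply_apply] at h2
  rw [← h2]
  simp [toDual]

theorem toDual_pointMass (s : K) (f : C(K, ℂ)) : toDual (pointMass s) f = f s := by
  rw [toDual, ofFamily_pointMass]
  rfl

/-- If a function of norm at most `1` vanishes on a finite set except at `s`, its pairing with `μ`
is the contribution of `s` up to the mass of `μ` outside the finite set. -/
theorem norm_toDual_apply_sub_le (μ : ℓ¹(K, ℂ)) {g : C(K, ℂ)} (hg1 : ‖g‖ ≤ 1) (s : K) (F : Finset K)
    (hg : ∀ t ∈ F, t ≠ s → g t = 0) :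
    ‖toDual μ g - μ s * g s‖ ≤ ∑' t : {t // t ∉ F}, ‖μ t‖ := by
  classical
  have hle : ∀ t, ‖if t = s then 0 else μ t * g t‖ ≤
      ({t | t ∉ F} : Set K).indicator (fun t => ‖μ t‖) t := by
    intro t
    by_cases hts : t = s
    · simpa [hts] using Set.indicator_nonneg (fun _ _ => norm_nonneg _) _
    by_cases htF : t ∈ F
    · simp [hts, htF, hg t htF hts]
    · simp only [hts, if_false, norm_mul, Set.indicator, Set.mem_ofPred_eq, htF,
        not_false_eq_true, if_true]
      exact mul_le_of_le_one_right (norm_nonneg _) ((g.norm_coe_le_norm t).trans hg1)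
  have hind : Summable (({t | t ∉ F} : Set K).indicator fun t => ‖μ t‖) :=
    (summable_norm_coe μ).indicator _
  rw [toDual_apply, (summable_mul_continuousMap μ g).tsum_eq_add_tsum_ite s, add_sub_cancel_left]
  refine (tsum_of_norm_bounded hind.hasSum hle).trans_eq ?_
  exact (tsum_subtype ({t | t ∉ F} : Set K) fun t => ‖μ t‖).symm

/-- The radial retraction of `ℂ` that moves every point by at most `δ` and kills the disc of
radius `δ`. -/
def shrink (δ : ℝ) (z : ℂ) : ℂ := z - ((δ / max ‖z‖ δ : ℝ) : ℂ) * z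

theorem continuous_shrink {δ : ℝ} (hδ : 0 < δ) : Continuous (shrink δ) := by
  unfold shrink
  refine continuous_id.sub (Continuous.mul (Complex.continuous_ofReal.comp ?_) continuous_id)
  exact continuous_const.div (continuous_norm.max continuous_const)
    fun z => (lt_max_of_lt_right hδ).ne'

theorem shrink_of_norm_le {δ : ℝ} (hδ : 0 < δ) {z : ℂ} (hz : ‖z‖ ≤ δ) : shrink δ z = 0 := by
  simp [shrink, max_eq_right hz, hδ.ne']

theorem norm_sub_shrink_le {δ : ℝ} (hδ : 0 < δ) (z : ℂ) : ‖z - shrink δ z‖ ≤ δ := by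
  have hm : 0 < max ‖z‖ δ := lt_max_of_lt_right hδ
  have h : z - shrink δ z = ((δ / max ‖z‖ δ : ℝ) : ℂ) * z := by
    simp [shrink]
  rw [h, norm_mul, Complex.norm_real, Real.norm_of_nonneg (by positivity), div_mul_eq_mul_div,
    div_le_iff₀ hm]
  exact mul_le_mul_of_nonneg_left (le_max_left _ _) hδ.le

theorem norm_shrink_le {δ : ℝ} (hδ : 0 < δ) (z : ℂ) : ‖shrink δ z‖ ≤ ‖z‖ := by
  have hm : 0 < max ‖z‖ δ := lt_max_of_lt_right hδ
  have h1 : δ / max ‖z‖ δ ≤ 1 := (div_le_one hm).2 (le_max_right _ _)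
  have h0 : 0 ≤ δ / max ‖z‖ δ := by positivity
  have h : shrink δ z = ((1 - δ / max ‖z‖ δ : ℝ) : ℂ) * z := by
    simp [shrink, sub_mul]
  rw [h, norm_mul, Complex.norm_real, Real.norm_of_nonneg (by linarith)]
  exact mul_le_of_le_one_left (norm_nonneg _) (by linarith)

theorem exists_phase (z : ℂ) : ∃ c : ℂ, ‖c‖ = 1 ∧ c * z = (‖z‖ : ℂ) := by
  by_cases hz : z = 0
  · exact ⟨1, by simp, by simp [hz]⟩
  · have hz' : (‖z‖ : ℂ) ≠ 0 := by simpa using hz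
    refine ⟨(‖z‖ : ℂ) / z, ?_, div_mul_cancel₀ _ hz⟩
    simp [hz]

/-- A bounded functional is small on functions that live near a point and vanish in a
neighbourhood of it: otherwise infinitely many such functions with disjoint supports would add up
to a bounded function with arbitrarily large image. -/
theorem exists_isOpen_norm_le_of_eventuallyEq_zero (Λ : C(K, ℂ) →L[ℂ] ℂ) (s : K) {ε : ℝ}
    (hε : 0 < ε) : ∃ U : Set K, IsOpen U ∧ s ∈ U ∧ ∀ g : C(K, ℂ), (∀ x, x ∉ U → g x = 0) →
      (∀ᶠ x in 𝓝 s, g x = 0) → ‖g‖ ≤ 1 → ‖Λ g‖ ≤ ε := by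
  by_contra! hcon
  have key : ∀ N : ℕ, ∃ U : Set K, IsOpen U ∧ s ∈ U ∧ ∃ g : C(K, ℂ), ‖g‖ ≤ 1 ∧
      (∀ x ∈ U, g x = 0) ∧ N * ε ≤ (Λ g).re := by
    intro N
    induction N with
    | zero => exact ⟨Set.univ, isOpen_univ, trivial, 0, by simp, by simp, by simp⟩
    | succ N ih =>
      obtain ⟨U, hU, hsU, g, hg1, hgU, hgN⟩ := ih
      obtain ⟨g', hg'U, hg's, hg'1, hg'ε⟩ := hcon U hU hsU
      obtain ⟨V, hV, hVo, hsV⟩ := eventually_nhds_iff.1 hg's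
      obtain ⟨c, hc1, hc⟩ := exists_phase (Λ g')
      refine ⟨U ∩ V, hU.inter hVo, ⟨hsU, hsV⟩, g + c • g', ?_, ?_, ?_⟩
      · refine (ContinuousMap.norm_le _ zero_le_one).2 fun x => ?_
        by_cases hx : x ∈ U
        · simpa [hgU x hx, hc1] using (g'.norm_coe_le_norm x).trans hg'1
        · simpa [hg'U x hx] using (g.norm_coe_le_norm x).trans hg1
      · rintro x ⟨hxU, hxV⟩
        simp [hgU x hxU, hV x hxV]
      · rw [map_add, map_smul, smul_eq_mul, hc, Complex.add_re, Complex.ofReal_re]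
        push_cast
        linarith
  obtain ⟨N, hN⟩ := exists_nat_gt (‖Λ‖ / ε)
  obtain ⟨U, -, -, g, hg1, -, hgN⟩ := key N
  rw [div_lt_iff₀ hε] at hN
  have h1 : (Λ g).re ≤ ‖Λ‖ := (Complex.re_le_norm _).trans
    ((Λ.le_opNorm g).trans (mul_le_of_le_one_right (norm_nonneg _) hg1))
  linarith

theorem exists_isOpen_norm_le_of_apply_eq_zero (Λ : C(K, ℂ) →L[ℂ] ℂ) (s : K) {ε : ℝ}
    (hε : 0 < ε) : ∃ U : Set K, IsOpen U ∧ s ∈ U ∧ ∀ g : C(K, ℂ), (∀ x, x ∉ U → g x = 0) →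
      g s = 0 → ‖g‖ ≤ 1 → ‖Λ g‖ ≤ ε := by
  obtain ⟨U, hU, hsU, h⟩ := exists_isOpen_norm_le_of_eventuallyEq_zero Λ s (half_pos hε)
  refine ⟨U, hU, hsU, fun g hgU hgs hg1 => ?_⟩
  obtain ⟨δ, hδ, hδε⟩ : ∃ δ : ℝ, 0 < δ ∧ ‖Λ‖ * δ ≤ ε / 2 := by
    refine ⟨ε / 2 / (‖Λ‖ + 1), by positivity, ?_⟩
    rw [mul_div_assoc', div_le_iff₀ (by positivity)]
    nlinarith [norm_nonneg Λ]
  let g' : C(K, ℂ) := ⟨fun x => shrink δ (g x), (continuous_shrink hδ).comp g.continuous⟩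
  have hg' : ‖Λ g'‖ ≤ ε / 2 := by
    refine h g' (fun x hx => ?_) ?_ ((ContinuousMap.norm_le _ zero_le_one).2 fun x => ?_)
    · simp [g', hgU x hx, shrink]
    · have hlt : ∀ᶠ x in 𝓝 s, ‖g x‖ < δ :=
        g.continuous.norm.continuousAt.eventually_lt continuousAt_const (by simpa [hgs])
      filter_upwards [hlt] with x hx using shrink_of_norm_le hδ hx.le
    · exact (norm_shrink_le hδ _).trans ((g.norm_coe_le_norm x).trans hg1)
  have hsub : ‖g - g'‖ ≤ δ :=
    (ContinuousMap.norm_le _ hδ.le).2 fun x => norm_sub_shrink_le hδ (g x)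
  have h2 : ‖Λ (g - g')‖ ≤ ε / 2 :=
    (Λ.le_opNorm _).trans ((mul_le_mul_of_nonneg_left hsub (norm_nonneg _)).trans hδε)
  calc ‖Λ g‖ = ‖Λ (g - g') + Λ g'‖ := by rw [← map_add, sub_add_cancel]
    _ ≤ ‖Λ (g - g')‖ + ‖Λ g'‖ := norm_add_le _ _
    _ ≤ ε := by linarith

variable [T2Space K]

theorem exists_bump (s : K) {U : Set K} (hU : IsOpen U) (hs : s ∈ U) :
    ∃ h : C(K, ℂ), (∀ x, x ∉ U → h x = 0) ∧ h s = 1 ∧ ‖h‖ ≤ 1 := by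
  obtain ⟨f, hf0, hf1, hf⟩ := exists_continuous_zero_one_of_isClosed hU.isClosed_compl
    (isClosed_singleton (x := s)) (by simpa using hs)
  refine ⟨⟨fun x => (f x : ℂ), by fun_prop⟩, fun x hx => ?_, ?_, ?_⟩
  · simpa using hf0 hx
  · simpa using hf1 rfl
  · refine (ContinuousMap.norm_le _ zero_le_one).2 fun x => ?_
    simpa [abs_of_nonneg (hf x).1] using (hf x).2

/-- Every point carries a well defined mass of a bounded functional. -/
theorem exists_mass (Λ : C(K, ℂ) →L[ℂ] ℂ) (s : K) : ∃ m : ℂ, ∀ ε > 0, ∃ U : Set K, IsOpen U ∧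
    s ∈ U ∧ ∀ g : C(K, ℂ), (∀ x, x ∉ U → g x = 0) → ‖g‖ ≤ 1 → ‖Λ g - m * g s‖ ≤ ε := by
  have hpos : ∀ n : ℕ, (0 : ℝ) < 1 / ((n : ℝ) + 1) := fun n => Nat.one_div_pos_of_nat
  choose U hU hsU hsmall using fun n : ℕ =>
    exists_isOpen_norm_le_of_apply_eq_zero Λ s (hpos n)
  choose h hh0 hh1 hhn using fun n : ℕ => exists_bump s (hU n) (hsU n)
  have hdiff : ∀ n, ∀ g : C(K, ℂ), (∀ x, x ∉ U n → g x = 0) → ‖g‖ ≤ 1 →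
      ‖Λ g - g s * Λ (h n)‖ ≤ 2 * (1 / ((n : ℝ) + 1)) := by
    intro n g hg hg1
    have hb : ‖(1 / 2 : ℂ) • (g - g s • h n)‖ ≤ 1 := by
      rw [norm_smul]
      have h1 : ‖g s • h n‖ ≤ 1 := by
        rw [norm_smul]
        exact mul_le_one₀ ((g.norm_coe_le_norm s).trans hg1) (norm_nonneg _) (hhn n)
      have h2 := norm_sub_le g (g s • h n)
      norm_num
      linarith
    have h3 := hsmall n ((1 / 2 : ℂ) • (g - g s • h n))
      (fun x hx => by simp [hg x hx, hh0 n x hx]) (by simp [hh1]) hb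
    rw [map_smul, norm_smul, map_sub, map_smul, smul_eq_mul] at h3
    norm_num at h3 ⊢
    linarith
  have hlim : Tendsto (fun n : ℕ => 1 / ((n : ℝ) + 1)) atTop (𝓝 0) :=
    tendsto_one_div_add_atTop_nhds_zero_nat
  have hcauchy : CauchySeq fun n => Λ (h n) := by
    refine cauchySeq_of_le_tendsto_0' (fun n => 4 * (1 / ((n : ℝ) + 1))) (fun n m hnm => ?_)
      (by simpa using hlim.const_mul 4)
    have hp : ‖h n * h m‖ ≤ 1 :=
      (norm_mul_le _ _).trans (mul_le_one₀ (hhn n) (norm_nonneg _) (hhn m))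
    have h1 := hdiff n (h n * h m) (fun x hx => by simp [hh0 n x hx]) hp
    have h2 := hdiff m (h n * h m) (fun x hx => by simp [hh0 m x hx]) hp
    have h3 : 1 / ((m : ℝ) + 1) ≤ 1 / ((n : ℝ) + 1) := Nat.one_div_le_one_div hnm
    simp only [ContinuousMap.coe_mul, Pi.mul_apply, hh1, mul_one, one_mul] at h1 h2
    rw [dist_eq_norm]
    have h4 := norm_sub_le (Λ (h n * h m) - Λ (h m)) (Λ (h n * h m) - Λ (h n))
    rw [sub_sub_sub_cancel_left] at h4
    linarith
  obtain ⟨m, hm⟩ := cauchySeq_tendsto_of_complete hcauchy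
  have hmn : Tendsto (fun n => ‖Λ (h n) - m‖) atTop (𝓝 0) := by
    simpa using (hm.sub_const m).norm
  refine ⟨m, fun ε hε => ?_⟩
  have hev : ∀ᶠ n : ℕ in atTop, 2 * (1 / ((n : ℝ) + 1)) + ‖Λ (h n) - m‖ < ε := by
    have := (hlim.const_mul 2).add hmn
    rw [mul_zero, add_zero] at this
    exact this.eventually_lt_const hε
  obtain ⟨n, hn⟩ := hev.exists
  refine ⟨U n, hU n, hsU n, fun g hg hg1 => ?_⟩
  have h1 := hdiff n g hg hg1
  have h2 : ‖g s * (Λ (h n) - m)‖ ≤ ‖Λ (h n) - m‖ := by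
    rw [norm_mul]
    exact mul_le_of_le_one_left (norm_nonneg _) ((g.norm_coe_le_norm s).trans hg1)
  have h3 : Λ g - m * g s = (Λ g - g s * Λ (h n)) + g s * (Λ (h n) - m) := by ring
  rw [h3]
  exact (norm_add_le _ _).trans (by linarith)

/-- A functional without local mass vanishes if the space is countable: a partition of unity
subordinate to neighbourhoods with geometrically decreasing bounds shows it. -/
theorem eq_zero_of_locally_small [Countable K] (Λ : C(K, ℂ) →L[ℂ] ℂ)
    (h : ∀ s, ∀ ε > 0, ∃ U : Set K, IsOpen U ∧ s ∈ U ∧ ∀ g : C(K, ℂ), (∀ x, x ∉ U → g x = 0) →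
      ‖g‖ ≤ 1 → ‖Λ g‖ ≤ ε) : Λ = 0 := by
  have hball : ∀ g : C(K, ℂ), ‖g‖ ≤ 1 → Λ g = 0 := by
    intro g hg
    rw [← norm_le_zero_iff]
    refine le_of_forall_pos_le_add fun ε hε => ?_
    rw [zero_add]
    have := Encodable.ofCountable K
    obtain ⟨ε', hε', c, hc, hcε⟩ := posSumOfEncodable hε K
    choose U hU hsU hsmall using fun s => h s (ε' s) (hε' s)
    obtain ⟨t, ht⟩ := isCompact_univ.elim_finite_subcover U hU
      (fun s _ => Set.mem_iUnion.2 ⟨s, hsU s⟩)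
    obtain ⟨ρ, hρ⟩ := PartitionOfUnity.exists_isSubordinate (isClosed_univ (X := K))
      (fun i : t => U i) (fun i => hU i)
      (fun x hx => by simpa [Set.mem_iUnion] using ht hx)
    let G : t → C(K, ℂ) := fun i => ⟨fun x => (ρ i x : ℂ) * g x, by fun_prop⟩
    have hG : g = ∑ i, G i := by
      ext x
      have h1 : ∑ i, ρ i x = 1 := by
        rw [← finsum_eq_sum_of_fintype]
        exact ρ.sum_eq_one (Set.mem_univ x)
      rw [ContinuousMap.sum_apply]
      simp only [G, ContinuousMap.coe_mk]
      rw [← Finset.sum_mul, ← Complex.ofReal_sum, h1]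
      simp
    have hGi : ∀ i : t, ‖Λ (G i)‖ ≤ ε' i := by
      intro i
      refine hsmall i (G i) (fun x hx => ?_) ((ContinuousMap.norm_le _ zero_le_one).2 fun x => ?_)
      · have : ρ i x = 0 := by
          by_contra hne
          exact hx (hρ i (subset_tsupport _ hne))
        simp [G, this]
      · simp only [G, ContinuousMap.coe_mk, norm_mul, Complex.norm_real,
          Real.norm_of_nonneg (ρ.nonneg i x)]
        exact mul_le_one₀ (ρ.le_one i x) (norm_nonneg _) ((g.norm_coe_le_norm x).trans hg)
    calc ‖Λ g‖ = ‖∑ i, Λ (G i)‖ := by rw [← map_sum, ← hG]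
      _ ≤ ∑ i : t, ε' i := norm_sum_le_of_le _ fun i _ => hGi i
      _ = ∑ i ∈ t, ε' i := Finset.sum_coe_sort t ε'
      _ ≤ c := sum_le_hasSum t (fun i _ => (hε' i).le) hc
      _ ≤ ε := hcε
  ext1 g
  by_cases hg : g = 0
  · simp [hg]
  have hg' : (‖g‖ : ℂ) ≠ 0 := by simpa using hg
  have := hball ((‖g‖ : ℂ)⁻¹ • g) (by rw [norm_smul]; simp [hg])
  rw [map_smul, smul_eq_mul, mul_eq_zero] at this
  simpa [hg] using this

theorem sum_norm_mass_le (Λ : C(K, ℂ) →L[ℂ] ℂ) {m : K → ℂ} (hm : ∀ s, ∀ ε > 0, ∃ U : Set K,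
    IsOpen U ∧ s ∈ U ∧ ∀ g : C(K, ℂ), (∀ x, x ∉ U → g x = 0) → ‖g‖ ≤ 1 →
      ‖Λ g - m s * g s‖ ≤ ε) (F : Finset K) : ∑ s ∈ F, ‖m s‖ ≤ ‖Λ‖ := by
  refine le_of_forall_pos_le_add fun ε hε => ?_
  have hδ : 0 < ε / (F.card + 1) := by positivity
  choose U hU hsU hsmall using fun s => hm s _ hδ
  obtain ⟨V, hV, hdisj⟩ := F.finite_toSet.t2_separation
  choose h hh0 hh1 hhn using fun s => exists_bump s ((hU s).inter (hV s).2) ⟨hsU s, (hV s).1⟩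
  choose c hc1 hc using fun s => exists_phase (m s)
  have hnorm : ‖∑ s ∈ F, c s • h s‖ ≤ 1 := by
    refine (ContinuousMap.norm_le _ zero_le_one).2 fun x => ?_
    rw [ContinuousMap.sum_apply]
    by_cases hx : ∃ s ∈ F, x ∈ V s
    · obtain ⟨s, hs, hxs⟩ := hx
      rw [Finset.sum_eq_single_of_mem s hs]
      · simpa [hc1] using ((h s).norm_coe_le_norm x).trans (hhn s)
      · intro t ht hts
        have hxt : x ∉ V t := fun hxt => Set.disjoint_left.1 (hdisj ht hs hts) hxt hxs
        simp [hh0 t x fun hx => hxt hx.2]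
    · rw [Finset.sum_eq_zero]
      · simp
      · intro s hs
        simp [hh0 s x fun hx' => hx ⟨s, hs, hx'.2⟩]
  have hterm : ∀ s, ‖m s‖ - ε / (F.card + 1) ≤ (Λ (c s • h s)).re := by
    intro s
    have h1 := hsmall s (c s • h s)
      (fun x hx => by simp [hh0 s x fun hx' => hx hx'.1])
      (by rw [norm_smul, hc1, one_mul]; exact hhn s)
    have h2 : m s * (c s • h s) s = (‖m s‖ : ℂ) := by
      simp [hh1, ← hc s, mul_comm]
    rw [h2] at h1
    have h3 := (Complex.abs_re_le_norm _).trans h1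
    rw [Complex.sub_re, Complex.ofReal_re] at h3
    linarith [(abs_le.1 h3).1]
  have h4 : (Λ (∑ s ∈ F, c s • h s)).re ≤ ‖Λ‖ := (Complex.re_le_norm _).trans
    ((Λ.le_opNorm _).trans (mul_le_of_le_one_right (norm_nonneg _) hnorm))
  rw [map_sum, Complex.re_sum] at h4
  have h5 := Finset.sum_le_sum fun s (_ : s ∈ F) => hterm s
  rw [Finset.sum_sub_distrib, Finset.sum_const, nsmul_eq_mul] at h5
  have h6 : (F.card : ℝ) * (ε / (F.card + 1)) ≤ ε := by
    rw [mul_div_assoc', div_le_iff₀ (by positivity)]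
    nlinarith
  linarith

/-- On a countable compact Hausdorff space every bounded functional on `C(K)` is a summable
combination of point evaluations. -/
theorem toDual_surjective [Countable K] :
    Function.Surjective (toDual : ℓ¹(K, ℂ) →L[ℂ] (C(K, ℂ) →L[ℂ] ℂ)) := by
  classical
  intro Λ
  choose m hm using exists_mass Λ
  have hsum : Summable fun s => ‖m s‖ :=
    summable_of_sum_le (fun _ => norm_nonneg _) (sum_norm_mass_le Λ hm)
  let μ : ℓ¹(K, ℂ) := ⟨m, memℓp_gen (by simpa using hsum)⟩
  refine ⟨μ, ?_⟩
  rw [← sub_eq_zero, ← neg_eq_zero, neg_sub]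
  refine eq_zero_of_locally_small _ fun s ε hε => ?_
  obtain ⟨U, hU, hsU, hUm⟩ := hm s (ε / 2) (half_pos hε)
  obtain ⟨F, hF⟩ : ∃ F : Finset K, ∑' t : {t // t ∉ F}, ‖m t‖ < ε / 2 :=
    ((tendsto_tsum_compl_atTop_zero fun t => ‖m t‖).eventually_lt_const (half_pos hε)).exists
  refine ⟨U ∩ (↑(F.erase s) : Set K)ᶜ, hU.inter (F.erase s).finite_toSet.isClosed.isOpen_compl,
    ⟨hsU, by simp⟩, fun g hg hg1 => ?_⟩
  have h1 := hUm g (fun x hx => hg x fun hx' => hx hx'.1) hg1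
  have h2 : ‖toDual μ g - m s * g s‖ ≤ ∑' t : {t // t ∉ F}, ‖m t‖ :=
    norm_toDual_apply_sub_le μ hg1 s F fun t ht hts =>
      hg t fun hx' => hx'.2 (by simp [hts, ht])
  have h3 : (Λ - toDual μ) g = (Λ g - m s * g s) - (toDual μ g - m s * g s) := by
    rw [_root_.sub_apply]
    ring
  rw [h3]
  exact (norm_sub_le _ _).trans (by linarith)

theorem toDual_injective :
    Function.Injective (toDual : ℓ¹(K, ℂ) →L[ℂ] (C(K, ℂ) →L[ℂ] ℂ)) := by
  classical
  refine (injective_iff_map_eq_zero _).2 fun μ hμ => ?_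
  ext s
  change μ s = 0
  by_contra hne
  obtain ⟨F, hF⟩ : ∃ F : Finset K, ∑' t : {t // t ∉ F}, ‖μ t‖ < ‖μ s‖ :=
    ((tendsto_tsum_compl_atTop_zero fun t => ‖μ t‖).eventually_lt_const
      (norm_pos_iff.2 hne)).exists
  obtain ⟨g, hg, hgs, hg1⟩ := exists_bump s
    (F.erase s).finite_toSet.isClosed.isOpen_compl (by simp)
  have h := norm_toDual_apply_sub_le μ hg1 s F fun t ht hts => hg t (by simp [hts, ht])
  rw [hμ, hgs, mul_one, _root_.zero_apply, zero_sub, norm_neg] at h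
  exact absurd hF h.not_gt

/-- For a countable compact Hausdorff space `K`, the dual of `C(K)` is `ℓ¹(K)`. -/
def dualEquiv [Countable K] : ℓ¹(K, ℂ) ≃L[ℂ] (C(K, ℂ) →L[ℂ] ℂ) :=
  ContinuousLinearEquiv.ofBijective (E := ℓ¹(K, ℂ)) (F := C(K, ℂ) →L[ℂ] ℂ) toDual
    (LinearMap.ker_eq_bot.2 toDual_injective) (LinearMap.range_eq_top.2 toDual_surjective)

theorem dualEquiv_apply [Countable K] (μ : ℓ¹(K, ℂ)) : dualEquiv μ = toDual μ := rfl

end CountableCompact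

/-! ### The Krein–Šmulian theorem for subspaces -/

section KreinSmulian

/-- A point outside a closed subspace is separated from it by a bounded functional. -/
theorem exists_clm_vanishing_of_notMem_closure {Y : Type*} [NormedAddCommGroup Y]
    [NormedSpace ℂ Y] (N : Submodule ℂ Y) {y : Y} (hy : y ∉ N.topologicalClosure) :
    ∃ φ : Y →L[ℂ] ℂ, (∀ z ∈ N, φ z = 0) ∧ φ y ≠ 0 := by
  have hcl : IsClosed (N.topologicalClosure : Set Y) := N.isClosed_topologicalClosure
  have hy' : N.topologicalClosure.mkQ y ≠ 0 := by
    simpa using hy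
  obtain ⟨g, -, hg⟩ := exists_dual_vector ℂ (N.topologicalClosure.mkQ y) (by simpa using hy')
  refine ⟨g.comp N.topologicalClosure.mkQL, fun z hz => ?_, ?_⟩
  · have : N.topologicalClosure.mkQ z = 0 := by
      simpa using N.le_topologicalClosure hz
    change g (N.topologicalClosure.mkQ z) = 0
    rw [this, map_zero]
  · change g (N.topologicalClosure.mkQ y) ≠ 0
    rw [hg]
    simpa using hy'

variable {X : Type*} [NormedAddCommGroup X] [NormedSpace ℂ X]

/-- The functionals whose distance to `Λ₀`, tested on the vectors of `F`, is at most `1`. -/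
def testNhd (Λ₀ : WeakDual ℂ X) (F : Finset X) : Set (WeakDual ℂ X) :=
  {Λ | ∀ x ∈ F, ‖Λ x - Λ₀ x‖ ≤ 1}

theorem isClosed_testNhd (Λ₀ : WeakDual ℂ X) (F : Finset X) : IsClosed (testNhd Λ₀ F) := by
  have : testNhd Λ₀ F = ⋂ x ∈ F, {Λ : WeakDual ℂ X | ‖Λ x - Λ₀ x‖ ≤ 1} := by
    ext Λ
    simp [testNhd]
  rw [this]
  refine isClosed_biInter fun x _ => isClosed_le ?_ continuous_const
  exact ((WeakDual.eval_continuous x).sub continuous_const).norm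

/-- Finitely many small vectors suffice to exclude all functionals of `D` whose distance to `Λ₀`
is more than `r`; this is compactness of `D`. -/
theorem exists_finset_testNhd (Λ₀ : WeakDual ℂ X) {r : ℝ} (hr : 0 < r) {D : Set (WeakDual ℂ X)}
    (hD : IsCompact D)
    (hfar : ∀ Λ ∈ D, ¬ ‖WeakDual.toStrongDual Λ - WeakDual.toStrongDual Λ₀‖ ≤ r) :
    ∃ F : Finset X, (∀ x ∈ F, ‖x‖ ≤ 1 / r) ∧ D ∩ testNhd Λ₀ F = ∅ := by
  classical
  obtain ⟨t, ht⟩ := hD.elim_finite_subfamily_closed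
    (fun x : {x : X // ‖x‖ ≤ 1 / r} => testNhd Λ₀ {x.1}) (fun x => isClosed_testNhd _ _) (by
      rw [Set.eq_empty_iff_forall_notMem]
      rintro Λ ⟨hΛD, hΛ⟩
      refine hfar Λ hΛD (ContinuousLinearMap.opNorm_le_bound _ hr.le fun x => ?_)
      by_cases hx : x = 0
      · simp [hx]
      have hx' : 0 < ‖x‖ := norm_pos_iff.2 hx
      have hc : ‖((1 / (r * ‖x‖) : ℝ) : ℂ)‖ = 1 / (r * ‖x‖) := by
        rw [Complex.norm_real, Real.norm_of_nonneg (by positivity)]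
      have hmem := Set.mem_iInter.1 hΛ ⟨((1 / (r * ‖x‖) : ℝ) : ℂ) • x, by
        rw [norm_smul, hc]
        field_simp
        exact le_rfl⟩
      have h1 := hmem _ (Finset.mem_singleton_self _)
      rw [map_smul, map_smul, ← smul_sub, norm_smul, hc, div_mul_eq_mul_div,
        div_le_one (by positivity), one_mul] at h1
      exact h1)
  refine ⟨t.image Subtype.val, fun x hx => ?_, ?_⟩
  · obtain ⟨y, -, rfl⟩ := Finset.mem_image.1 hx
    exact y.2
  · rw [← Set.subset_empty_iff, ← ht]
    rintro Λ ⟨hΛD, hΛ⟩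
    refine ⟨hΛD, Set.mem_iInter₂.2 fun y hy x hx => ?_⟩
    rw [Finset.mem_singleton.1 hx]
    exact hΛ _ (Finset.mem_image_of_mem _ hy)

/-- If no element of `M` comes within distance `1` of `Λ₀`, and `M` meets each ball around `Λ₀` in
a weak*-compact set, then a null family of vectors detects that `Λ₀ ∉ M`. -/
theorem exists_null_family (M : Set (WeakDual ℂ X)) (Λ₀ : WeakDual ℂ X)
    (hcomp : ∀ n : ℕ, IsCompact
      {Λ ∈ M | ‖WeakDual.toStrongDual Λ - WeakDual.toStrongDual Λ₀‖ ≤ n + 1})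
    (hfar : ∀ Λ ∈ M, 1 < ‖WeakDual.toStrongDual Λ - WeakDual.toStrongDual Λ₀‖) :
    ∃ F : ℕ → Finset X, (∀ n, ∀ x ∈ F n, ‖x‖ ≤ 1 / ((n : ℝ) + 1)) ∧
      ∀ Λ ∈ M, ∃ n, ∃ x ∈ F n, 1 < ‖Λ x - Λ₀ x‖ := by
  let D : ℕ → Set (WeakDual ℂ X) := fun n =>
    {Λ ∈ M | ‖WeakDual.toStrongDual Λ - WeakDual.toStrongDual Λ₀‖ ≤ n + 1}
  have step : ∀ (n : ℕ) (A : Set (WeakDual ℂ X)), IsClosed A → D n ∩ A = ∅ →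
      ∃ F : Finset X, (∀ x ∈ F, ‖x‖ ≤ 1 / ((n : ℝ) + 1)) ∧
        D (n + 1) ∩ (A ∩ testNhd Λ₀ F) = ∅ := by
    intro n A hA hDA
    obtain ⟨F, hF, hF'⟩ := exists_finset_testNhd Λ₀ (r := n + 1) (by positivity)
      ((hcomp (n + 1)).inter_right hA) (fun Λ hΛ hle => by
        have : Λ ∈ D n ∩ A := ⟨⟨hΛ.1.1, hle⟩, hΛ.2⟩
        rw [hDA] at this
        exact this)
    exact ⟨F, hF, by rw [← Set.inter_assoc]; exact hF'⟩
  choose! F hF hF' using step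
  let A : ℕ → Set (WeakDual ℂ X) := fun n =>
    Nat.rec Set.univ (fun n A => A ∩ testNhd Λ₀ (F n A)) n
  have hA : ∀ n, IsClosed (A n) ∧ D n ∩ A n = ∅ := by
    intro n
    induction n with
    | zero =>
      refine ⟨isClosed_univ, Set.eq_empty_of_forall_notMem ?_⟩
      rintro Λ ⟨⟨hΛM, hΛ⟩, -⟩
      have := hfar Λ hΛM
      norm_num at hΛ
      linarith
    | succ n ih => exact ⟨ih.1.inter (isClosed_testNhd _ _), hF' n _ ih.1 ih.2⟩
  refine ⟨fun n => F n (A n), fun n => hF n _ (hA n).1 (hA n).2, fun Λ hΛ => ?_⟩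
  by_contra! hcon
  have hmem : ∀ n, Λ ∈ A n := by
    intro n
    induction n with
    | zero => trivial
    | succ n ih => exact ⟨ih, hcon n⟩
  obtain ⟨n, hn⟩ := exists_nat_ge ‖WeakDual.toStrongDual Λ - WeakDual.toStrongDual Λ₀‖
  have : Λ ∈ D n ∩ A n := ⟨⟨hΛ, by linarith⟩, hmem n⟩
  rw [(hA n).2] at this
  exact this

variable [CompleteSpace X]

/-- A null family of vectors that keeps `Λ₀` at distance `1` from a subspace `M` of the dual
can be combined into one vector that annihilates `M` but not `Λ₀`. -/
theorem exists_annihilating_of_null_family (M : Submodule ℂ (X →L[ℂ] ℂ)) (Λ₀ : X →L[ℂ] ℂ)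
    (F : ℕ → Finset X) (hF : ∀ n, ∀ x ∈ F n, ‖x‖ ≤ 1 / ((n : ℝ) + 1))
    (hM : ∀ Λ ∈ M, ∃ n, ∃ x ∈ F n, 1 < ‖Λ x - Λ₀ x‖) :
    ∃ x : X, (∀ Λ ∈ M, Λ x = 0) ∧ Λ₀ x ≠ 0 := by
  let I := Σ n, {x // x ∈ F n}
  let _ : TopologicalSpace I := ⊥
  have : DiscreteTopology I := ⟨rfl⟩
  have hlim : Tendsto (fun i : I => (i.2 : X)) cofinite (𝓝 0) := by
    rw [Metric.tendsto_nhds]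
    intro ε hε
    obtain ⟨N, hN⟩ := exists_nat_one_div_lt hε
    have hfin : Set.Finite {i : I | i.1 < N} := by
      refine ((Finset.range N).sigma fun n => (F n).attach).finite_toSet.subset ?_
      rintro ⟨n, x⟩ hn
      have hn' : n < N := hn
      simpa using hn'
    refine hfin.subset fun i hi => ?_
    by_contra hlt
    refine hi ?_
    have h1 : N ≤ i.1 := not_lt.1 hlt
    have h2 : 1 / ((i.1 : ℝ) + 1) ≤ 1 / ((N : ℝ) + 1) := Nat.one_div_le_one_div h1
    change dist _ _ < ε
    rw [dist_zero_right]
    exact ((hF _ _ i.2.2).trans h2).trans_lt hN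
  let v : C(OnePoint I, X) := OnePoint.continuousMapMkDiscrete (fun i : I => (i.2 : X)) 0 hlim
  have hvi : ∀ i : I, v (i : OnePoint I) = i.2 := fun i => rfl
  let T : (X →L[ℂ] ℂ) →ₗ[ℂ] C(OnePoint I, ℂ) :=
    { toFun := fun Λ => ⟨fun k => Λ (v k), Λ.continuous.comp v.continuous⟩
      map_add' := fun _ _ => rfl
      map_smul' := fun _ _ => rfl }
  have hfar : T Λ₀ ∉ (M.map T).topologicalClosure := by
    intro hmem
    obtain ⟨_, ⟨Λ, hΛ, rfl⟩, hdist⟩ := Metric.mem_closure_iff.1 hmem 1 one_pos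
    obtain ⟨n, x, hx, hgt⟩ := hM Λ hΛ
    have h1 := (T Λ - T Λ₀).norm_coe_le_norm ((⟨n, ⟨x, hx⟩⟩ : I) : OnePoint I)
    rw [dist_eq_norm, norm_sub_rev] at hdist
    have h2 : (T Λ - T Λ₀) ((⟨n, ⟨x, hx⟩⟩ : I) : OnePoint I) = Λ x - Λ₀ x := rfl
    rw [h2] at h1
    linarith
  obtain ⟨φ, hφM, hφ0⟩ := exists_clm_vanishing_of_notMem_closure _ hfar
  have : Countable (OnePoint I) := inferInstanceAs (Countable (Option I))
  obtain ⟨α, rfl⟩ := toDual_surjective φ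
  let L : ℓ¹(OnePoint I, ℂ) →L[ℂ] X := ofFamily (fun k => v k) ‖v‖ v.norm_coe_le_norm
  have key : ∀ Λ : X →L[ℂ] ℂ, Λ (L α) = toDual α (T Λ) := by
    intro Λ
    rw [toDual_apply]
    refine (hasSum_clm_apply (Λ.comp L) α).tsum_eq.symm.trans (tsum_congr fun k => ?_)
    simp [L, T]
  exact ⟨L α, fun Λ hΛ => by rw [key]; exact hφM _ ⟨Λ, hΛ, rfl⟩, by rwa [key]⟩

/-- A form of the **Krein–Šmulian theorem**: if a subspace `M` of the dual of a Banach space meets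
every ball in a weak*-closed set, then each functional outside `M` is separated from `M` by a
vector. -/
theorem exists_annihilating_of_isClosed_inter_ball (M : Submodule ℂ (X →L[ℂ] ℂ))
    (hM : ∀ r : ℝ, IsClosed {Λ : WeakDual ℂ X | WeakDual.toStrongDual Λ ∈ M ∧
      ‖WeakDual.toStrongDual Λ‖ ≤ r}) {Λ₀ : X →L[ℂ] ℂ} (h₀ : Λ₀ ∉ M) :
    ∃ x : X, (∀ Λ ∈ M, Λ x = 0) ∧ Λ₀ x ≠ 0 := by
  have hMclosed : IsClosed (M : Set (X →L[ℂ] ℂ)) := by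
    refine isClosed_of_closure_subset fun Λ hΛ => ?_
    have hcl : Λ ∈ closure {Λ' : X →L[ℂ] ℂ | Λ' ∈ M ∧ ‖Λ'‖ ≤ ‖Λ‖ + 1} := by
      rw [Metric.mem_closure_iff] at hΛ ⊢
      intro ε hε
      obtain ⟨Λ', hΛ', hd⟩ := hΛ (min ε 1) (lt_min hε one_pos)
      refine ⟨Λ', ⟨hΛ', ?_⟩, hd.trans_le (min_le_left _ _)⟩
      have h1 := hd.trans_le (min_le_right _ _)
      rw [dist_eq_norm, norm_sub_rev] at h1
      have h2 := norm_le_norm_add_norm_sub' Λ' Λ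
      linarith
    have hc := (hM (‖Λ‖ + 1)).preimage (NormedSpace.Dual.toWeakDual_continuous (𝕜 := ℂ) (E := X))
    exact (hc.closure_subset_iff.2 (fun _ h => h) hcl).1
  obtain ⟨d, hd, hdist⟩ : ∃ d > 0, ∀ Λ ∈ M, d ≤ ‖Λ - Λ₀‖ := by
    have hopen : (M : Set (X →L[ℂ] ℂ))ᶜ ∈ 𝓝 Λ₀ := hMclosed.isOpen_compl.mem_nhds h₀
    obtain ⟨d, hd, hsub⟩ := Metric.mem_nhds_iff.1 hopen
    refine ⟨d, hd, fun Λ hΛ => ?_⟩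
    by_contra! hlt
    exact hsub (show Λ ∈ Metric.ball Λ₀ d by rwa [Metric.mem_ball, dist_eq_norm]) hΛ
  -- After scaling, the distance from `Λ₁` to `M` exceeds `1`.
  have hd' : ((2 / d : ℝ) : ℂ) ≠ 0 := by
    simp [hd.ne']
  let Λ₁ : X →L[ℂ] ℂ := ((2 / d : ℝ) : ℂ) • Λ₀
  have hfar : ∀ Λ ∈ M, 1 < ‖Λ - Λ₁‖ := by
    intro Λ hΛ
    have h1 := hdist (((2 / d : ℝ) : ℂ)⁻¹ • Λ) (M.smul_mem _ hΛ)
    have h2 : Λ - Λ₁ = ((2 / d : ℝ) : ℂ) • (((2 / d : ℝ) : ℂ)⁻¹ • Λ - Λ₀) := by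
      rw [smul_sub, smul_inv_smul₀ hd']
    rw [h2, norm_smul, Complex.norm_real, Real.norm_of_nonneg (by positivity)]
    have h3 := mul_le_mul_of_nonneg_left h1 (show 0 ≤ 2 / d by positivity)
    rw [div_mul_cancel₀ _ hd.ne'] at h3
    linarith
  obtain ⟨F, hF, hFM⟩ := exists_null_family
    {Λ : WeakDual ℂ X | WeakDual.toStrongDual Λ ∈ M} (StrongDual.toWeakDual Λ₁) (fun n => by
      have h1 := (WeakDual.isCompact_closedBall (𝕜 := ℂ) Λ₁ (n + 1)).inter_right
        (hM (‖Λ₁‖ + (n + 1)))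
      convert h1 using 1
      ext Λ
      simp only [Set.mem_inter_iff, Set.mem_preimage, Metric.mem_closedBall, dist_eq_norm,
        Set.mem_ofPred_eq]
      constructor
      · rintro ⟨hΛ, hn⟩
        refine ⟨hn, hΛ, ?_⟩
        exact (norm_le_norm_add_norm_sub' _ Λ₁).trans (add_le_add_right hn _)
      · rintro ⟨hn, hΛ, -⟩
        exact ⟨hΛ, hn⟩) (fun Λ hΛ => hfar _ hΛ)
  obtain ⟨x, hx, hx0⟩ := exists_annihilating_of_null_family M Λ₁ F hF (fun Λ hΛ =>
    hFM (StrongDual.toWeakDual Λ) hΛ)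
  refine ⟨x, hx, fun h => hx0 ?_⟩
  simp [Λ₁, h]

end KreinSmulian

/-! ### The topology of `(ℤ × ℤ⁺) ∪ {∞}` -/

section Topology

variable {J : Set ℤ}

/-- The set of all sums `j₁ + ⋯ + j_m` with `j_i ∈ J` and `n < |j₁| < ⋯ < |j_m|`. -/
def sumSet (J : Set ℤ) (m n : ℕ) : Set ℤ :=
  {p | ∃ j : Fin m → ℤ, (∀ r, j r ∈ J ∧ (n : ℤ) < |j r|) ∧ StrictMono (fun r => |j r|) ∧
    p = ∑ r, j r}

theorem mem_sumSet_zero {n : ℕ} {p : ℤ} : p ∈ sumSet J 0 n ↔ p = 0 := by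
  constructor
  · rintro ⟨j, -, -, rfl⟩
    simp
  · rintro rfl
    exact ⟨Fin.elim0, fun r => r.elim0, fun r => r.elim0, by simp⟩

/-- Splitting off the summand of smallest modulus. -/
theorem mem_sumSet_succ {m n : ℕ} {p : ℤ} : p ∈ sumSet J (m + 1) n ↔
    ∃ j ∈ J, n < j.natAbs ∧ p - j ∈ sumSet J m j.natAbs := by
  constructor
  · rintro ⟨j, hj, hmono, rfl⟩
    have hj0 := (hj 0).2
    rw [Int.abs_eq_natAbs] at hj0
    refine ⟨j 0, (hj 0).1, by omega, fun r => j r.succ, fun r => ?_, ?_, ?_⟩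
    · refine ⟨(hj _).1, ?_⟩
      have := hmono (Fin.succ_pos r)
      simpa using this
    · exact fun r r' h => hmono (Fin.succ_lt_succ_iff.2 h)
    · rw [Fin.sum_univ_succ]
      ring
  · rintro ⟨j, hjJ, hjn, l, hl, hmono, hsum⟩
    refine ⟨Fin.cons j l, fun r => ?_, ?_, ?_⟩
    · refine Fin.cases ?_ (fun r => ?_) r
      · exact ⟨hjJ, by simp only [Fin.cons_zero, Int.abs_eq_natAbs]; omega⟩
      · exact ⟨(hl r).1, by have := (hl r).2; simp only [Fin.cons_succ]; omega⟩
    · intro r r' h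
      induction r using Fin.cases with
      | zero =>
        induction r' using Fin.cases with
        | zero => exact absurd h (lt_irrefl _)
        | succ r' => simpa using (hl r').2
      | succ r =>
        induction r' using Fin.cases with
        | zero => exact absurd h (Fin.not_lt_zero _)
        | succ r' => simpa using hmono (Fin.succ_lt_succ_iff.1 h)
    · rw [Fin.sum_univ_succ]
      simp only [Fin.cons_zero, Fin.cons_succ]
      omega

theorem sumSet_anti (m : ℕ) {n n' : ℕ} (h : n ≤ n') : sumSet J m n' ⊆ sumSet J m n := by
  rintro p ⟨j, hj, hmono, hsum⟩
  exact ⟨j, fun r => ⟨(hj r).1, lt_of_le_of_lt (by exact_mod_cast h) (hj r).2⟩, hmono, hsum⟩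

/-- Summands that are larger than those of `p` can be appended to `p`. -/
theorem exists_forall_add_mem_sumSet {m n : ℕ} {p : ℤ} (hp : p ∈ sumSet J m n) :
    ∃ N, ∀ m', ∀ q ∈ sumSet J m' N, p + q ∈ sumSet J (m + m') n := by
  induction m generalizing n p with
  | zero =>
    rw [mem_sumSet_zero.1 hp]
    exact ⟨n, fun m' q hq => by simpa using hq⟩
  | succ m ih =>
    obtain ⟨j, hjJ, hjn, hj⟩ := mem_sumSet_succ.1 hp
    obtain ⟨N, hN⟩ := ih hj
    refine ⟨N, fun m' q hq => ?_⟩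
    rw [add_right_comm, mem_sumSet_succ]
    refine ⟨j, hjJ, hjn, ?_⟩
    have := hN m' q hq
    rwa [add_sub_right_comm]

theorem exists_mem_natAbs_gt (hJ : J.Infinite) (n : ℕ) : ∃ j ∈ J, n < j.natAbs := by
  by_contra! h
  refine hJ ((Set.finite_Icc (-(n : ℤ)) n).subset fun j hj => ?_)
  have := h j hj
  exact ⟨by omega, by omega⟩

theorem sumSet_nonempty (hJ : J.Infinite) (m n : ℕ) : (sumSet J m n).Nonempty := by
  induction m generalizing n with
  | zero => exact ⟨0, mem_sumSet_zero.2 rfl⟩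
  | succ m ih =>
    obtain ⟨j, hj, hjn⟩ := exists_mem_natAbs_gt hJ n
    obtain ⟨q, hq⟩ := ih j.natAbs
    exact ⟨q + j, mem_sumSet_succ.2 ⟨j, hj, hjn, by simpa using hq⟩⟩

/-- Sums of a bounded number of large elements of an additively sparse set are far apart. -/
theorem eventually_sumSet_separated (hJ : IsAdditivelySparse J) (M R : ℕ) :
    ∀ᶠ n in atTop, ∀ r ≤ R, ∀ s ≤ R, ∀ p ∈ sumSet J r n, ∀ q ∈ sumSet J s n,
      |p - q| ≤ M → p = q ∧ r = s := by
  have h1 : ∀ t : ℤ, ∀ r s : ℕ, ∀ᶠ n in atTop, ∀ p ∈ sumSet J r n, ∀ q ∈ sumSet J s n,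
      p = q + t → p = q ∧ r = s := by
    intro t r s
    obtain ⟨n, hn⟩ := hJ.2 t r s
    filter_upwards [eventually_ge_atTop n] with k hk p hp q hq hpq
    obtain ⟨j, hj, hjm, hjp⟩ := sumSet_anti r hk hp
    obtain ⟨l, hl, hlm, hlq⟩ := sumSet_anti s hk hq
    have := hn j l hj hjm hl hlm (by rw [← hjp, ← hlq, hpq])
    exact ⟨by rw [hpq, this.1, add_zero], this.2.1⟩
  have h2 : ∀ᶠ n in atTop, ∀ t ∈ Set.Icc (-(M : ℤ)) M, ∀ r ∈ Set.Iic R, ∀ s ∈ Set.Iic R,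
      ∀ p ∈ sumSet J r n, ∀ q ∈ sumSet J s n, p = q + t → p = q ∧ r = s := by
    refine (Set.finite_Icc _ _).eventually_all.2 fun t _ => ?_
    refine (Set.finite_Iic R).eventually_all.2 fun r _ => ?_
    exact (Set.finite_Iic R).eventually_all.2 fun s _ => h1 t r s
  filter_upwards [h2] with n hn r hr s hs p hp q hq hpq
  exact hn (p - q) (abs_le.1 hpq) r hr s hs p hp q hq (by ring)

/-- The point `(n, k)` of `ℤ × ℤ⁺`. -/
def pt (J : Set ℤ) (n : ℤ) (k : ℕ) : TSpace J := (n, k)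

@[simp] theorem pt_fst (n : ℤ) (k : ℕ) : (pt J n k).1 = n := rfl

@[simp] theorem pt_snd (n : ℤ) (k : ℕ) : (pt J n k).2 = k := rfl

@[simp] theorem pt_add_pt (n n' : ℤ) (k k' : ℕ) :
    pt J n k + pt J n' k' = pt J (n + n') (k + k') := rfl

@[simp] theorem add_fst (x y : TSpace J) : (x + y).1 = x.1 + y.1 := rfl

@[simp] theorem add_snd (x y : TSpace J) : (x + y).2 = x.2 + y.2 := rfl

theorem mem_basicNhd {γ β : TSpace J} {n : ℕ} :
    β ∈ basicNhd J γ n ↔ β.2 ≤ γ.2 ∧ β.1 - γ.1 ∈ sumSet J (γ.2 - β.2) n := by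
  refine and_congr_right fun _ => exists_congr fun j => ?_
  rw [sub_eq_iff_eq_add']

theorem mem_basicNhd_self (γ : TSpace J) (n : ℕ) : γ ∈ basicNhd J γ n := by
  rw [mem_basicNhd, sub_self, Nat.sub_self, mem_sumSet_zero]
  exact ⟨le_rfl, rfl⟩

theorem isOpen_iff_basicNhd {U : Set (TSpace J)} :
    IsOpen U ↔ ∀ γ ∈ U, ∃ n, basicNhd J γ n ⊆ U := Iff.rfl

theorem isOpen_basicNhd (γ : TSpace J) (n : ℕ) : IsOpen (basicNhd J γ n) := by
  rw [isOpen_iff_basicNhd]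
  intro β hβ
  rw [mem_basicNhd] at hβ
  obtain ⟨N, hN⟩ := exists_forall_add_mem_sumSet hβ.2
  refine ⟨N, fun δ hδ => ?_⟩
  rw [mem_basicNhd] at hδ ⊢
  have := hN _ _ hδ.2
  refine ⟨hδ.1.trans hβ.1, ?_⟩
  convert this using 2
  · omega
  · ring

theorem hasBasis_nhds (γ : TSpace J) : (𝓝 γ).HasBasis (fun _ : ℕ => True) (basicNhd J γ) := by
  refine ⟨fun s => ?_⟩
  rw [mem_nhds_iff]
  constructor
  · rintro ⟨U, hUs, hU, hγ⟩
    obtain ⟨n, hn⟩ := isOpen_iff_basicNhd.1 hU γ hγ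
    exact ⟨n, trivial, hn.trans hUs⟩
  · rintro ⟨n, -, hn⟩
    exact ⟨_, hn, isOpen_basicNhd γ n, mem_basicNhd_self γ n⟩

/-- A basic neighbourhood is a smaller one together with finitely many basic neighbourhoods of
points one level below. -/
theorem isCompact_basicNhd (γ : TSpace J) (n : ℕ) : IsCompact (basicNhd J γ n) := by
  obtain ⟨a, k⟩ := γ
  change IsCompact (basicNhd J (pt J a k) n)
  induction k generalizing a n with
  | zero =>
    have h : basicNhd J (pt J a 0) n = {pt J a 0} := by
      refine Set.Subset.antisymm (fun β hβ => ?_)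
        (Set.singleton_subset_iff.2 (mem_basicNhd_self _ _))
      rw [mem_basicNhd, pt_snd, Nat.zero_sub, mem_sumSet_zero] at hβ
      exact Prod.ext (sub_eq_zero.1 hβ.2) (Nat.le_zero.1 hβ.1)
    rw [h]
    exact isCompact_singleton
  | succ k ih =>
    rw [isCompact_iff_ultrafilter_le_nhds']
    intro f hf
    by_cases hγ : (f : Filter (TSpace J)) ≤ 𝓝 (pt J a (k + 1))
    · exact ⟨_, mem_basicNhd_self _ _, hγ⟩
    rw [(hasBasis_nhds _).ge_iff] at hγ
    push Not at hγ
    obtain ⟨N, -, hN⟩ := hγ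
    let A : Set ℤ := {j ∈ J | n < j.natAbs ∧ j.natAbs ≤ N}
    have hA : A.Finite := (Set.finite_Icc (-(N : ℤ)) N).subset fun j hj =>
      ⟨by have := hj.2.2; omega, by have := hj.2.2; omega⟩
    let C : Set (TSpace J) := ⋃ j ∈ A, basicNhd J (pt J (a + j) k) j.natAbs
    have hC : IsCompact C := hA.isCompact_biUnion fun j _ => ih _ _
    have hCsub : C ⊆ basicNhd J (pt J a (k + 1)) n := by
      refine Set.iUnion₂_subset fun j hj β hβ => ?_
      rw [mem_basicNhd, pt_snd, pt_fst] at hβ ⊢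
      refine ⟨by omega, ?_⟩
      rw [Nat.succ_sub hβ.1]
      exact mem_sumSet_succ.2 ⟨j, hj.1, hj.2.1, by rw [sub_sub]; exact hβ.2⟩
    have hcover : basicNhd J (pt J a (k + 1)) n ⊆ basicNhd J (pt J a (k + 1)) N ∪ C := by
      intro β hβ
      by_cases hβk : β.2 = k + 1
      · left
        rw [mem_basicNhd, pt_snd, pt_fst, hβk, Nat.sub_self, mem_sumSet_zero] at hβ ⊢
        exact hβ
      rw [mem_basicNhd, pt_snd, pt_fst] at hβ
      have hle : β.2 ≤ k := by omega
      rw [Nat.succ_sub hle] at hβ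
      obtain ⟨j, hjJ, hjn, hj⟩ := mem_sumSet_succ.1 hβ.2
      by_cases hjN : j.natAbs ≤ N
      · right
        refine Set.mem_biUnion (show j ∈ A from ⟨hjJ, hjn, hjN⟩) ?_
        rw [mem_basicNhd, pt_snd, pt_fst, ← sub_sub]
        exact ⟨hle, hj⟩
      · left
        rw [mem_basicNhd, pt_snd, pt_fst, Nat.succ_sub hle]
        exact ⟨hβ.1, mem_sumSet_succ.2 ⟨j, hjJ, not_le.1 hjN, hj⟩⟩
    have hCf : C ∈ f := by
      have h1 := f.mem_of_superset hf hcover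
      exact (Ultrafilter.union_mem_iff.1 h1).resolve_left hN
    obtain ⟨x, hx, hfx⟩ := isCompact_iff_ultrafilter_le_nhds'.1 hC f hCf
    exact ⟨x, hCsub hx, hfx⟩

instance : WeaklyLocallyCompactSpace (TSpace J) :=
  ⟨fun γ => ⟨_, isCompact_basicNhd γ 0, (hasBasis_nhds γ).mem_of_mem trivial⟩⟩

instance : Countable (TSpace J) := inferInstanceAs (Countable (ℤ × ℕ))

instance : Countable (SSpace J) := inferInstanceAs (Countable (Option (TSpace J)))

theorem t2Space_tSpace (hJ : IsAdditivelySparse J) : T2Space (TSpace J) := by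
  refine ⟨fun γ γ' hne => ?_⟩
  obtain ⟨n, hn⟩ := (eventually_sumSet_separated hJ (γ.1 - γ'.1).natAbs (max γ.2 γ'.2)).exists
  refine ⟨_, _, isOpen_basicNhd γ n, isOpen_basicNhd γ' n, mem_basicNhd_self _ _,
    mem_basicNhd_self _ _, Set.disjoint_left.2 fun δ hδ hδ' => hne ?_⟩
  rw [mem_basicNhd] at hδ hδ'
  have h := hn _ (by omega) _ (by omega) _ hδ.2 _ hδ'.2 (by rw [Int.abs_eq_natAbs]; omega)
  exact Prod.ext (by have := h.1; omega) (by have := h.2; have := hδ.1; have := hδ'.1; omega)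

theorem isOpen_setOf_snd_le (k : ℕ) : IsOpen {β : TSpace J | β.2 ≤ k} := by
  rw [isOpen_iff_basicNhd]
  intro γ hγ
  exact ⟨0, fun β hβ => hβ.1.trans hγ⟩

/-- Compact subsets of `ℤ × ℤ⁺` have bounded level. -/
theorem exists_snd_le_of_isCompact {C : Set (TSpace J)} (hC : IsCompact C) :
    ∃ k, ∀ β ∈ C, β.2 ≤ k := by
  obtain ⟨k, hk⟩ := hC.elim_directed_cover (fun k : ℕ => {β : TSpace J | β.2 ≤ k})
    isOpen_setOf_snd_le (fun β _ => Set.mem_iUnion.2 ⟨β.2, le_refl β.2⟩)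
    (directed_of_isDirected_le fun k l hkl β hβ => le_trans (b := k) hβ hkl)
  exact ⟨k, hk⟩

instance : NoncompactSpace (TSpace J) := by
  refine ⟨fun h => ?_⟩
  obtain ⟨k, hk⟩ := exists_snd_le_of_isCompact h
  have := hk (pt J 0 (k + 1)) trivial
  rw [pt_snd] at this
  omega

theorem continuous_add_left_tSpace (s : TSpace J) : Continuous fun t : TSpace J => s + t := by
  rw [continuous_iff_continuousAt]
  intro γ
  rw [ContinuousAt, (hasBasis_nhds γ).tendsto_iff (hasBasis_nhds _)]
  refine fun n _ => ⟨n, trivial, fun β hβ => ?_⟩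
  rw [mem_basicNhd] at hβ ⊢
  simp only [add_fst, add_snd, add_sub_add_left_eq_sub, Nat.add_sub_add_left]
  exact ⟨by have := hβ.1; omega, hβ.2⟩

theorem tendsto_add_left_coclosedCompact (hJ : IsAdditivelySparse J) (s : TSpace J) :
    Tendsto (fun t : TSpace J => s + t) (coclosedCompact (TSpace J))
      (coclosedCompact (TSpace J)) := by
  have := t2Space_tSpace hJ
  rw [coclosedCompact_eq_cocompact, (hasBasis_cocompact).tendsto_iff hasBasis_cocompact]
  intro C hC
  refine ⟨(fun t => s + t) ⁻¹' C, ?_, fun t ht => ht⟩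
  obtain ⟨F, -, hF⟩ := hC.elim_nhds_subcover (fun γ => basicNhd J γ 0)
    fun γ _ => (hasBasis_nhds γ).mem_of_mem trivial
  -- If `γ.2 < s.2`, no translate by `s` lies in the neighbourhood of `γ`, so that the truncated
  -- difference does no harm.
  have hK : IsCompact (⋃ γ ∈ F, basicNhd J (pt J (γ.1 - s.1) (γ.2 - s.2)) 0) :=
    F.isCompact_biUnion fun γ _ => isCompact_basicNhd _ _
  refine hK.of_isClosed_subset (hC.isClosed.preimage (continuous_add_left_tSpace s)) fun β hβ => ?_
  obtain ⟨γ, hγ, hβγ⟩ := Set.mem_iUnion₂.1 (hF hβ)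
  refine Set.mem_iUnion₂.2 ⟨γ, hγ, ?_⟩
  rw [mem_basicNhd] at hβγ ⊢
  simp only [add_fst, add_snd, pt_fst, pt_snd] at hβγ ⊢
  refine ⟨by omega, ?_⟩
  have h1 : β.1 - (γ.1 - s.1) = s.1 + β.1 - γ.1 := by ring
  have h2 : γ.2 - s.2 - β.2 = γ.2 - (s.2 + β.2) := by omega
  rw [h1, h2]
  exact hβγ.2

theorem continuous_add_left_sSpace (hJ : IsAdditivelySparse J) (s : SSpace J) :
    Continuous fun t : SSpace J => s + t := by
  induction s using OnePoint.rec with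
  | infty =>
    have h : (fun t : SSpace J => (OnePoint.infty : SSpace J) + t) = fun _ => OnePoint.infty :=
      funext fun t => SSpace.infty_add J t
    rw [h]
    exact continuous_const
  | coe s =>
    have h : (fun t : SSpace J => (s : SSpace J) + t) = OnePoint.map fun t : TSpace J => s + t := by
      funext t
      induction t using OnePoint.rec <;> rfl
    rw [h]
    exact OnePoint.continuous_map (continuous_add_left_tSpace s)
      (tendsto_add_left_coclosedCompact hJ s)

theorem denseRange_ofInt (hJ : J.Infinite) : DenseRange (ofInt J) := by
  have h : DenseRange fun n : ℤ => pt J n 0 := by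
    intro γ
    rw [mem_closure_iff_nhds_basis (hasBasis_nhds γ)]
    intro n _
    obtain ⟨p, hp⟩ := sumSet_nonempty hJ γ.2 n
    refine ⟨pt J (γ.1 + p) 0, ⟨_, rfl⟩, ?_⟩
    rw [mem_basicNhd]
    simpa using hp
  exact OnePoint.denseRange_coe.comp h OnePoint.continuous_coe

theorem isSemitopologicalCompactification_ofInt (hJ : IsAdditivelySparse J) :
    IsSemitopologicalCompactification (ofInt J) := by
  have := t2Space_tSpace hJ
  refine ⟨inferInstance, inferInstance, continuous_add_left_sSpace hJ, fun s => ?_,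
    fun m n h => ?_, denseRange_ofInt hJ.1⟩
  · simpa only [add_comm] using continuous_add_left_sSpace hJ s
  · exact congrArg Prod.fst (OnePoint.coe_injective h)

end Topology

/-! ### Fourier analysis of the powers of `5^{-1/2} (δ_0 + δ_1 - δ_2)` -/

section Newman

open MeasureTheory AddCircle

/-- The scalar `5^{-1/2}`. -/
def invSqrtFive : ℂ := ((√5 : ℝ) : ℂ)⁻¹

theorem invSqrtFive_sq : invSqrtFive ^ 2 = 1 / 5 := by
  rw [invSqrtFive, inv_pow, ← Complex.ofReal_pow, Real.sq_sqrt (by norm_num)]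
  norm_num

theorem norm_invSqrtFive_sq : ‖invSqrtFive‖ ^ 2 = 1 / 5 := by
  rw [← norm_pow, invSqrtFive_sq]
  norm_num

theorem conv_newmanElement_apply (f : ℓ¹(ℤ, ℂ)) (k : ℤ) :
    conv f newmanElement k = invSqrtFive * (f k + f (k - 1) - f (k - 2)) := by
  have h : conv f newmanElement = invSqrtFive •
      (conv (pointMass 0) f + conv (pointMass 1) f - conv (pointMass 2) f) := by
    rw [conv_comm]
    simp only [← convL_apply]
    simp [newmanElement, invSqrtFive]
  rw [h]
  simp only [lp.coeFn_smul, lp.coeFn_sub, lp.coeFn_add, Pi.smul_apply, Pi.sub_apply, Pi.add_apply,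
    conv_pointMass_apply, smul_eq_mul, sub_zero]

theorem convPow_newmanElement_succ (n : ℕ) (k : ℤ) :
    convPow newmanElement (n + 1) k = invSqrtFive * (convPow newmanElement n k +
      convPow newmanElement n (k - 1) - convPow newmanElement n (k - 2)) :=
  conv_newmanElement_apply _ _

/-- The coefficients of the derivative of a power of `5^{-1/2} (1 + z - z²)`, after the coefficients
have been centred. -/
theorem sub_mul_convPow_newmanElement_succ (n : ℕ) (k : ℤ) :
    ((k : ℂ) - (n + 1)) * convPow newmanElement (n + 1) k =
      -((n + 1) * invSqrtFive) *
        (convPow newmanElement n k + convPow newmanElement n (k - 2)) := by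
  induction n generalizing k with
  | zero =>
    rw [convPow_newmanElement_succ]
    simp only [convPow, pointMass_apply]
    by_cases h0 : k = 0
    · subst h0; norm_num
    by_cases h1 : k = 1
    · subst h1; norm_num
    by_cases h2 : k = 2
    · subst h2; norm_num
    have h1' : k - 1 ≠ 0 := by omega
    have h2' : k - 2 ≠ 0 := by omega
    simp [h0, h1', h2']
  | succ n ih =>
    have e0 := ih k
    have e1 := ih (k - 1)
    have e2 := ih (k - 2)
    have r0 := convPow_newmanElement_succ n k
    have r2 := convPow_newmanElement_succ n (k - 2)
    rw [convPow_newmanElement_succ (n + 1)]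
    rw [show k - 1 - 2 = k - 3 by ring] at e1
    rw [show k - 2 - 2 = k - 4 by ring] at e2
    rw [show k - 2 - 1 = k - 3 by ring, show k - 2 - 2 = k - 4 by ring] at r2
    push_cast at e0 e1 e2 ⊢
    linear_combination invSqrtFive * (e0 + e1 - e2) +
      (n + 1) * invSqrtFive * (r0 + r2)

theorem fourierCoeff_mul_fourier (g : C(UnitAddCircle, ℂ)) (j k : ℤ) :
    fourierCoeff (g * fourier j : C(UnitAddCircle, ℂ)) k = fourierCoeff g (k - j) := by
  unfold fourierCoeff
  congr 1
  ext t
  rw [neg_sub, sub_eq_add_neg, fourier_add, ContinuousMap.mul_apply]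
  simp only [smul_eq_mul]
  ring

theorem hasSum_sq_norm_fourierCoeff (g : C(UnitAddCircle, ℂ)) :
    HasSum (fun k => ‖fourierCoeff g k‖ ^ 2) (∫ t, ‖g t‖ ^ 2 ∂haarAddCircle) := by
  have h := hasSum_sq_fourierCoeff (g.toLp (E := ℂ) 2 haarAddCircle ℂ)
  simp only [fourierCoeff_toLp] at h
  convert h using 1
  refine integral_congr_ae ?_
  filter_upwards [ContinuousMap.coeFn_toLp (E := ℂ) (p := 2) (𝕜 := ℂ) haarAddCircle g] with t ht
  rw [ht]

theorem integrable_continuousMap {E : Type*} [NormedAddCommGroup E] (g : C(UnitAddCircle, E)) :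
    Integrable g haarAddCircle :=
  g.continuous.integrable_of_hasCompactSupport (HasCompactSupport.of_compactSpace _)

/-- The symbol `5^{-1/2} (1 + z - z²)` on the unit circle. -/
def newmanSymbol : C(UnitAddCircle, ℂ) := invSqrtFive • (fourier 0 + fourier 1 - fourier 2)

theorem fourierCoeff_mul_newmanSymbol (g : C(UnitAddCircle, ℂ)) (k : ℤ) :
    fourierCoeff (g * newmanSymbol : C(UnitAddCircle, ℂ)) k =
      invSqrtFive * (fourierCoeff g k + fourierCoeff g (k - 1) - fourierCoeff g (k - 2)) := by
  have h : ((g * newmanSymbol : C(UnitAddCircle, ℂ)) : UnitAddCircle → ℂ) =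
      fun t => invSqrtFive * ((g * fourier 0 : C(UnitAddCircle, ℂ)) t +
        ((g * fourier 1 : C(UnitAddCircle, ℂ)) t +
          (-1 : ℂ) * (g * fourier 2 : C(UnitAddCircle, ℂ)) t)) := by
    ext t
    simp only [newmanSymbol, ContinuousMap.mul_apply, ContinuousMap.smul_apply,
      ContinuousMap.add_apply, ContinuousMap.sub_apply, smul_eq_mul]
    ring
  have hneg : fourierCoeff (fun t => (-1 : ℂ) * (g * fourier 2 : C(UnitAddCircle, ℂ)) t) k =
      -fourierCoeff g (k - 2) := by
    rw [fourierCoeff.const_mul, fourierCoeff_mul_fourier]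
    ring
  have h1 := fourierCoeff.add (f := (g * fourier 1 : C(UnitAddCircle, ℂ)))
    (g := fun t => (-1 : ℂ) * (g * fourier 2 : C(UnitAddCircle, ℂ)) t)
    (integrable_continuousMap _) ((integrable_continuousMap _).const_mul _)
  have h0 := fourierCoeff.add (f := (g * fourier 0 : C(UnitAddCircle, ℂ)))
    (g := (g * fourier 1 : C(UnitAddCircle, ℂ)) +
      fun t => (-1 : ℂ) * (g * fourier 2 : C(UnitAddCircle, ℂ)) t)
    (integrable_continuousMap _)
    ((integrable_continuousMap _).add ((integrable_continuousMap _).const_mul _))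
  rw [h, fourierCoeff.const_mul]
  have h2 := congrFun h0 k
  rw [h1, Pi.add_apply, Pi.add_apply, hneg, fourierCoeff_mul_fourier, fourierCoeff_mul_fourier,
    sub_zero] at h2
  refine congrArg (invSqrtFive * ·) ?_
  refine Eq.trans ?_ (h2.trans ?_)
  · rfl
  · ring

theorem fourierCoeff_newmanSymbol_pow (n : ℕ) (k : ℤ) :
    fourierCoeff (newmanSymbol ^ n : C(UnitAddCircle, ℂ)) k = convPow newmanElement n k := by
  induction n generalizing k with
  | zero =>
    have h := fourierCoeff_fourier (T := 1) 0
    have h1 : (newmanSymbol ^ 0 : C(UnitAddCircle, ℂ)) = fourier 0 := by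
      ext t
      simp
    rw [h1, h]
    simp [convPow, pointMass_apply, Pi.single_apply]
  | succ n ih =>
    rw [pow_succ, fourierCoeff_mul_newmanSymbol, ih, ih, ih, convPow_newmanElement_succ]

/-- The defect `1 - |φ|²` of the symbol `φ`. -/
def symbolDefect (t : UnitAddCircle) : ℝ := ‖1 + (fourier 2 t : ℂ)‖ ^ 2 / 5

theorem norm_sq_newmanSymbol (t : UnitAddCircle) : ‖newmanSymbol t‖ ^ 2 = 1 - symbolDefect t := by
  have hz : ‖(fourier 1 t : ℂ)‖ = 1 := by
    rw [fourier_apply]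
    exact Circle.norm_coe _
  have h2 : (fourier 2 t : ℂ) = fourier 1 t * fourier 1 t := by
    rw [← fourier_add]
    norm_num
  have h1 : newmanSymbol t = invSqrtFive * (1 + fourier 1 t - fourier 1 t * fourier 1 t) := by
    simp [newmanSymbol, h2]
  rw [h1, symbolDefect, h2, norm_mul, mul_pow, norm_invSqrtFive_sq]
  generalize (fourier 1 t : ℂ) = z at *
  have hz2 : z.re * z.re + z.im * z.im = 1 := by
    rw [← Complex.normSq_apply, Complex.normSq_eq_norm_sq, hz, one_pow]
  rw [← Complex.normSq_eq_norm_sq, ← Complex.normSq_eq_norm_sq, Complex.normSq_apply,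
    Complex.normSq_apply]
  simp only [Complex.add_re, Complex.sub_re, Complex.add_im, Complex.sub_im, Complex.mul_re,
    Complex.mul_im, Complex.one_re, Complex.one_im]
  generalize z.re = x at *
  generalize z.im = y at *
  linear_combination (2 * (x * x + y * y) + 3 - 2 * x) / 5 * hz2

theorem symbolDefect_nonneg (t : UnitAddCircle) : 0 ≤ symbolDefect t := by
  unfold symbolDefect
  positivity

theorem symbolDefect_le_one (t : UnitAddCircle) : symbolDefect t ≤ 1 := by
  have := norm_sq_newmanSymbol t
  nlinarith [sq_nonneg ‖newmanSymbol t‖]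

theorem continuous_symbolDefect : Continuous symbolDefect := by
  unfold symbolDefect
  fun_prop

theorem symbolDefect_coe (x : ℝ) :
    symbolDefect (x : UnitAddCircle) = 4 / 5 * Real.cos (2 * Real.pi * x) ^ 2 := by
  have h : (fourier 2 (x : UnitAddCircle) : ℂ) =
      Complex.exp ((4 * Real.pi * x : ℝ) * Complex.I) := by
    rw [fourier_coe_apply]
    congr 1
    push_cast
    ring
  rw [symbolDefect, h, ← Complex.normSq_eq_norm_sq, Complex.normSq_apply]
  simp only [Complex.add_re, Complex.add_im, Complex.one_re, Complex.one_im,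
    Complex.exp_ofReal_mul_I_re, Complex.exp_ofReal_mul_I_im]
  have h4 : 4 * Real.pi * x = 2 * (2 * Real.pi * x) := by ring
  rw [h4, Real.cos_two_mul, Real.sin_two_mul]
  have := Real.sin_sq_add_cos_sq (2 * Real.pi * x)
  generalize Real.cos (2 * Real.pi * x) = c at *
  generalize Real.sin (2 * Real.pi * x) = s at *
  linear_combination 4 / 5 * c ^ 2 * this

/-- The integrals `∫ |φ|^{2n}`, that is, the squared `ℓ²`-norms of the powers. -/
def symbolMoment (n : ℕ) : ℝ := ∫ t, (1 - symbolDefect t) ^ n ∂haarAddCircle (T := 1)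

theorem symbolMoment_eq_intervalIntegral (n : ℕ) : symbolMoment n =
    ∫ x in (-(1 / 2) : ℝ)..(1 / 2), (1 - 4 / 5 * Real.cos (2 * Real.pi * x) ^ 2) ^ n := by
  have h := AddCircle.intervalIntegral_preimage 1 (-(1 / 2) : ℝ)
    fun t : UnitAddCircle => (1 - symbolDefect t) ^ n
  have h2 : (-(1 / 2) + 1 : ℝ) = 1 / 2 := by norm_num
  simp only [h2, symbolDefect_coe] at h
  rw [h, symbolMoment, integral_haarAddCircle]
  simp

/-- Domination of `|φ|^{2n}` by two Gaussians, centred at the two maxima of `|φ|`. -/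
theorem one_sub_cos_sq_pow_le (n : ℕ) {x : ℝ} (hx : x ∈ Set.Icc (-(1 / 2) : ℝ) (1 / 2)) :
    (1 - 4 / 5 * Real.cos (2 * Real.pi * x) ^ 2) ^ n ≤
      Real.exp (-(12 * n) * (x - 1 / 4) ^ 2) + Real.exp (-(12 * n) * (x + 1 / 4) ^ 2) := by
  have hexp : (1 - 4 / 5 * Real.cos (2 * Real.pi * x) ^ 2) ^ n ≤
      Real.exp (-(4 / 5 * Real.cos (2 * Real.pi * x) ^ 2) * n) := by
    rw [mul_comm _ (n : ℝ), Real.exp_nat_mul]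
    refine pow_le_pow_left₀ ?_ ?_ n
    · have := Real.cos_sq_le_one (2 * Real.pi * x)
      linarith
    · have := Real.add_one_le_exp (-(4 / 5 * Real.cos (2 * Real.pi * x) ^ 2))
      linarith
  -- `|sin u| ≥ 2 |u| / π` with `u = 2πy` gives `sin² u ≥ 16 y²`, and `12 < 16 · 4 / 5`.
  have hsin : ∀ y : ℝ, |y| ≤ 1 / 4 → 16 * y ^ 2 ≤ Real.sin (2 * Real.pi * y) ^ 2 := by
    intro y hy
    have hpi := Real.pi_pos
    have h1 : |2 * Real.pi * y| = 2 * Real.pi * |y| := by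
      rw [abs_mul, abs_of_pos (by positivity)]
    have h2 := Real.mul_abs_le_abs_sin (x := 2 * Real.pi * y) (by rw [h1]; nlinarith)
    rw [h1] at h2
    have h3 : 2 / Real.pi * (2 * Real.pi * |y|) = 4 * |y| := by
      field_simp
      ring
    rw [h3] at h2
    have h4 := pow_le_pow_left₀ (by positivity) h2 2
    rw [sq_abs, mul_pow, sq_abs] at h4
    linarith
  have hn : (0 : ℝ) ≤ n := Nat.cast_nonneg n
  rcases le_total 0 x with h0 | h0
  · have hcos : Real.cos (2 * Real.pi * x) ^ 2 = Real.sin (2 * Real.pi * (x - 1 / 4)) ^ 2 := by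
      have : 2 * Real.pi * (x - 1 / 4) = 2 * Real.pi * x - Real.pi / 2 := by ring
      rw [this, Real.sin_sub_pi_div_two, neg_sq]
    have h1 := hsin (x - 1 / 4) (abs_le.2 ⟨by linarith, by linarith [hx.2]⟩)
    rw [hcos] at hexp ⊢
    have h2 : Real.exp (-(4 / 5 * Real.sin (2 * Real.pi * (x - 1 / 4)) ^ 2) * n) ≤
        Real.exp (-(12 * n) * (x - 1 / 4) ^ 2) := by
      refine Real.exp_le_exp.2 ?_
      nlinarith [mul_le_mul_of_nonneg_right h1 hn, mul_nonneg hn (sq_nonneg (x - 1 / 4))]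
    have h3 := Real.exp_pos (-(12 * n) * (x + 1 / 4) ^ 2)
    linarith
  · have hcos : Real.cos (2 * Real.pi * x) ^ 2 = Real.sin (2 * Real.pi * (x + 1 / 4)) ^ 2 := by
      have : 2 * Real.pi * (x + 1 / 4) = 2 * Real.pi * x + Real.pi / 2 := by ring
      rw [this, Real.sin_add_pi_div_two]
    have h1 := hsin (x + 1 / 4) (abs_le.2 ⟨by linarith [hx.1], by linarith⟩)
    rw [hcos] at hexp ⊢
    have h2 : Real.exp (-(4 / 5 * Real.sin (2 * Real.pi * (x + 1 / 4)) ^ 2) * n) ≤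
        Real.exp (-(12 * n) * (x + 1 / 4) ^ 2) := by
      refine Real.exp_le_exp.2 ?_
      nlinarith [mul_le_mul_of_nonneg_right h1 hn, mul_nonneg hn (sq_nonneg (x + 1 / 4))]
    have h3 := Real.exp_pos (-(12 * n) * (x - 1 / 4) ^ 2)
    linarith

theorem symbolMoment_le (n : ℕ) : symbolMoment n ≤ 2 / √(n + 1) := by
  rcases Nat.eq_zero_or_pos n with rfl | hn
  · simp [symbolMoment]
  have hn' : (0 : ℝ) < 12 * n := by positivity
  have hint : ∀ y : ℝ, Integrable fun x : ℝ => Real.exp (-(12 * n) * (x + y) ^ 2) :=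
    fun y => (integrable_exp_neg_mul_sq hn').comp_add_right y
  have hval : ∀ y : ℝ, ∫ x : ℝ, Real.exp (-(12 * n) * (x + y) ^ 2) = √(Real.pi / (12 * n)) := by
    intro y
    rw [integral_add_right_eq_self (fun x : ℝ => Real.exp (-(12 * n) * x ^ 2)) y,
      integral_gaussian]
  have hle : ∀ y : ℝ, ∫ x in (-(1 / 2) : ℝ)..(1 / 2), Real.exp (-(12 * n) * (x + y) ^ 2) ≤
      √(Real.pi / (12 * n)) := by
    intro y
    rw [← hval y, intervalIntegral.integral_of_le (by norm_num)]
    exact setIntegral_le_integral (hint y) (Eventually.of_forall fun x => (Real.exp_pos _).le)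
  have h1 : symbolMoment n ≤ √(Real.pi / (12 * n)) + √(Real.pi / (12 * n)) := by
    rw [symbolMoment_eq_intervalIntegral]
    have h2 := hle (-(1 / 4))
    have h3 := hle (1 / 4)
    simp only [← sub_eq_add_neg] at h2
    refine le_trans ?_ (add_le_add h2 h3)
    rw [← intervalIntegral.integral_add]
    · refine intervalIntegral.integral_mono_on (by norm_num) ?_ ?_
        fun x hx => one_sub_cos_sq_pow_le n hx
      all_goals exact Continuous.intervalIntegrable (by fun_prop) _ _
    all_goals exact Continuous.intervalIntegrable (by fun_prop) _ _
  have h4 : √(Real.pi / (12 * n)) ≤ 1 / √(n + 1) := by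
    rw [← Real.sqrt_one, ← Real.sqrt_div zero_le_one, Real.sqrt_one]
    refine Real.sqrt_le_sqrt ?_
    rw [div_le_div_iff₀ hn' (by positivity)]
    have h5 : (1 : ℝ) ≤ n := by exact_mod_cast hn
    nlinarith [Real.pi_lt_four]
  calc symbolMoment n ≤ 1 / √(n + 1) + 1 / √(n + 1) := by linarith
    _ = 2 / √(n + 1) := by ring

theorem continuous_one_sub_symbolDefect_pow (n : ℕ) :
    Continuous fun t => (1 - symbolDefect t) ^ n := by
  have := continuous_symbolDefect
  fun_prop

theorem integrable_of_continuous {f : UnitAddCircle → ℝ} (hf : Continuous f) :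
    Integrable f haarAddCircle :=
  integrable_continuousMap ⟨f, hf⟩

/-- Half of the factors absorb `x = 1 - |φ|²`, because `(j + 1) x (1 - x)^j ≤ 1`. -/
theorem integral_mul_symbolDefect_le (n : ℕ) :
    ∫ t, (1 - symbolDefect t) ^ n * symbolDefect t ∂haarAddCircle ≤
      6 / ((n + 1) * √(n + 1)) := by
  have hbern : ∀ (j : ℕ) (x : ℝ), 0 ≤ x → x ≤ 1 → (j + 1) * x * (1 - x) ^ j ≤ 1 := by
    intro j x h0 h1
    have h2 : (1 + j * x) ≤ (1 + x) ^ j := one_add_mul_le_pow (by linarith) j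
    have h3 : (1 + x) ^ j * (1 - x) ^ j ≤ 1 := by
      rw [← mul_pow]
      exact pow_le_one₀ (by nlinarith) (by nlinarith)
    have h4 : 0 ≤ (1 - x) ^ j := pow_nonneg (by linarith) j
    have h5 : (j + 1) * x ≤ (1 + x) ^ j := by linarith
    exact (mul_le_mul_of_nonneg_right h5 h4).trans h3
  obtain ⟨j, i, hij, hj, hi⟩ : ∃ j i : ℕ, n = j + i ∧ n + 1 ≤ 2 * (j + 1) ∧ n + 1 ≤ 2 * (i + 1) :=
    ⟨n / 2, n - n / 2, by omega, by omega, by omega⟩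
  have hpt : ∀ t, (1 - symbolDefect t) ^ n * symbolDefect t ≤
      2 / (n + 1) * (1 - symbolDefect t) ^ i := by
    intro t
    have h0 := symbolDefect_nonneg t
    have h1 := symbolDefect_le_one t
    have h2 := hbern j _ h0 h1
    have h3 : 0 ≤ (1 - symbolDefect t) ^ i := pow_nonneg (by linarith) i
    have h4 : 0 ≤ symbolDefect t * (1 - symbolDefect t) ^ j :=
      mul_nonneg h0 (pow_nonneg (by linarith) j)
    have hj' : ((n : ℝ) + 1) ≤ 2 * (j + 1) := by exact_mod_cast hj
    have h5 : symbolDefect t * (1 - symbolDefect t) ^ j ≤ 2 / (n + 1) := by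
      rw [le_div_iff₀ (by positivity)]
      nlinarith
    calc (1 - symbolDefect t) ^ n * symbolDefect t
        = symbolDefect t * (1 - symbolDefect t) ^ j * (1 - symbolDefect t) ^ i := by
          rw [hij, pow_add]; ring
      _ ≤ _ := mul_le_mul_of_nonneg_right h5 h3
  have h1 : ∫ t, (1 - symbolDefect t) ^ n * symbolDefect t ∂haarAddCircle ≤
      2 / (n + 1) * symbolMoment i := by
    rw [symbolMoment, ← integral_const_mul]
    refine integral_mono (integrable_of_continuous
      ((continuous_one_sub_symbolDefect_pow n).mul continuous_symbolDefect))
      (integrable_of_continuous (continuous_const.mul (continuous_one_sub_symbolDefect_pow i))) hpt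
  have h2 : symbolMoment i ≤ 3 / √(n + 1) := by
    refine (symbolMoment_le i).trans ?_
    rw [div_le_div_iff₀ (by positivity) (by positivity)]
    have hi' : ((n : ℝ) + 1) ≤ 2 * (i + 1) := by exact_mod_cast hi
    refine (pow_le_pow_iff_left₀ (by positivity) (by positivity) two_ne_zero).1 ?_
    rw [mul_pow, mul_pow, Real.sq_sqrt (by positivity), Real.sq_sqrt (by positivity)]
    nlinarith
  calc _ ≤ _ := h1
    _ ≤ 2 / (n + 1) * (3 / √(n + 1)) := mul_le_mul_of_nonneg_left h2 (by positivity)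
    _ = _ := by rw [div_mul_div_comm]; norm_num

theorem hasSum_sq_norm_convPow_newmanElement (n : ℕ) :
    HasSum (fun k => ‖convPow newmanElement n k‖ ^ 2) (symbolMoment n) := by
  have h := hasSum_sq_norm_fourierCoeff (newmanSymbol ^ n)
  simp only [fourierCoeff_newmanSymbol_pow] at h
  convert h using 1
  refine integral_congr_ae (Eventually.of_forall fun t => ?_)
  simp only [ContinuousMap.pow_apply, norm_pow]
  rw [← norm_sq_newmanSymbol, ← pow_mul, ← pow_mul, mul_comm]

theorem hasSum_sq_norm_convPow_newmanElement_add (n : ℕ) :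
    HasSum (fun k => ‖convPow newmanElement n k + convPow newmanElement n (k - 2)‖ ^ 2)
      (5 * ∫ t, (1 - symbolDefect t) ^ n * symbolDefect t ∂haarAddCircle) := by
  have h := hasSum_sq_norm_fourierCoeff
    (newmanSymbol ^ n * fourier 0 + newmanSymbol ^ n * fourier 2)
  have hk : ∀ k, fourierCoeff (newmanSymbol ^ n * fourier 0 + newmanSymbol ^ n * fourier 2 :
      C(UnitAddCircle, ℂ)) k = convPow newmanElement n k + convPow newmanElement n (k - 2) := by
    intro k
    have h1 := congrFun (fourierCoeff.add (integrable_continuousMap (newmanSymbol ^ n * fourier 0))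
      (integrable_continuousMap (newmanSymbol ^ n * fourier 2))) k
    rw [Pi.add_apply, fourierCoeff_mul_fourier, fourierCoeff_mul_fourier,
      fourierCoeff_newmanSymbol_pow, fourierCoeff_newmanSymbol_pow, sub_zero] at h1
    exact h1
  simp only [hk] at h
  convert h using 1
  rw [← integral_const_mul]
  refine integral_congr_ae (Eventually.of_forall fun t => ?_)
  simp only [ContinuousMap.add_apply, ContinuousMap.mul_apply, ContinuousMap.pow_apply, ← mul_add,
    norm_mul, norm_pow, mul_pow]
  rw [← norm_sq_newmanSymbol, ← pow_mul, ← pow_mul, mul_comm 2 n, symbolDefect, fourier_zero]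
  ring

theorem hasSum_sq_sub_mul_norm_convPow_newmanElement (n : ℕ) :
    HasSum (fun k : ℤ => ((k : ℝ) - (n + 1)) ^ 2 * ‖convPow newmanElement (n + 1) k‖ ^ 2)
      (((n : ℝ) + 1) ^ 2 * ∫ t, (1 - symbolDefect t) ^ n * symbolDefect t ∂haarAddCircle) := by
  have h := (hasSum_sq_norm_convPow_newmanElement_add n).mul_left (((n : ℝ) + 1) ^ 2 / 5)
  rw [← mul_assoc, div_mul_cancel₀ _ (by norm_num)] at h
  refine h.congr_fun fun k => ?_
  have h1 := congrArg (fun z : ℂ => ‖z‖ ^ 2) (sub_mul_convPow_newmanElement_succ n k)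
  simp only [norm_mul, norm_neg, mul_pow, norm_invSqrtFive_sq] at h1
  have h2 : ‖(k : ℂ) - (n + 1)‖ ^ 2 = ((k : ℝ) - (n + 1)) ^ 2 := by
    have : (k : ℂ) - (n + 1) = (((k : ℝ) - (n + 1) : ℝ) : ℂ) := by push_cast; ring
    rw [this, Complex.norm_real, Real.norm_eq_abs, sq_abs]
  have h3 : ‖(n : ℂ) + 1‖ ^ 2 = ((n : ℝ) + 1) ^ 2 := by
    have : (n : ℂ) + 1 = (((n : ℝ) + 1 : ℝ) : ℂ) := by push_cast; ring
    rw [this, Complex.norm_real, Real.norm_eq_abs, sq_abs]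
  rw [h2, h3] at h1
  linarith

/-- The kernel `r / (r² + k²)` has total mass at most `8`: it is dominated by four times the
increments of the bounded function `k ↦ k / (r + |k|)`. -/
theorem sum_div_sq_add_sq_le {r : ℝ} (hr : 1 ≤ r) (s : Finset ℤ) :
    ∑ k ∈ s, r / (r ^ 2 + (k : ℝ) ^ 2) ≤ 8 := by
  let G : ℤ → ℝ := fun k => k / (r + |(k : ℝ)|)
  have hG1 : ∀ k, |G k| ≤ 1 := by
    intro k
    have h0 := abs_nonneg (k : ℝ)
    rw [abs_div, abs_of_pos (show 0 < r + |(k : ℝ)| by linarith), div_le_one (by linarith)]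
    linarith
  have hinc : ∀ k : ℤ, r / (r ^ 2 + (k : ℝ) ^ 2) ≤ 4 * (G (k + 1) - G k) := by
    intro k
    simp only [G]
    push_cast
    rcases le_or_gt 0 k with hk | hk
    · have hk' : (0 : ℝ) ≤ k := by exact_mod_cast hk
      generalize (k : ℝ) = x at *
      rw [abs_of_nonneg hk', abs_of_nonneg (by linarith), div_sub_div _ _ (by linarith)
        (by linarith), mul_div_assoc', div_le_div_iff₀ (by nlinarith) (by nlinarith)]
      have h1 : (x + 1) * (r + x) - (r + (x + 1)) * x = r := by ring
      rw [h1]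
      have h2 : (r + (x + 1)) * (r + x) ≤ 4 * (r ^ 2 + x ^ 2) := by
        nlinarith [sq_nonneg (r - x)]
      nlinarith
    · have hk' : (k : ℝ) + 1 ≤ 0 := by exact_mod_cast hk
      generalize (k : ℝ) = x at *
      rw [abs_of_nonpos (by linarith : x ≤ 0), abs_of_nonpos hk', div_sub_div _ _ (by linarith)
        (by linarith), mul_div_assoc', div_le_div_iff₀ (by nlinarith) (by nlinarith)]
      have h1 : (x + 1) * (r + -x) - (r + -(x + 1)) * x = r := by ring
      rw [h1]
      have h2 : (r + -(x + 1)) * (r + -x) ≤ 4 * (r ^ 2 + x ^ 2) := by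
        nlinarith [sq_nonneg (r + x)]
      nlinarith
  obtain ⟨m, hm⟩ : ∃ m : ℕ, ∀ k ∈ s, k.natAbs < m :=
    ⟨s.sup Int.natAbs + 1, fun k hk => Nat.lt_succ_of_le (Finset.le_sup hk)⟩
  have hsub : s ⊆ (Finset.range (2 * m)).image fun i : ℕ => (i : ℤ) - m := by
    intro k hk
    have := hm k hk
    exact Finset.mem_image.2 ⟨(k + m).toNat, Finset.mem_range.2 (by omega), by omega⟩
  calc ∑ k ∈ s, r / (r ^ 2 + (k : ℝ) ^ 2)
      ≤ ∑ k ∈ (Finset.range (2 * m)).image fun i : ℕ => (i : ℤ) - m, r / (r ^ 2 + (k : ℝ) ^ 2) :=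
        Finset.sum_le_sum_of_subset_of_nonneg hsub fun k _ _ => by positivity
    _ = ∑ i ∈ Finset.range (2 * m), r / (r ^ 2 + (((i : ℤ) - m : ℤ) : ℝ) ^ 2) :=
        Finset.sum_image fun i _ j _ h => by simpa using h
    _ ≤ ∑ i ∈ Finset.range (2 * m), 4 * (G (((i + 1 : ℕ) : ℤ) - m) - G ((i : ℤ) - m)) :=
        Finset.sum_le_sum fun i _ => by
          have := hinc ((i : ℤ) - m)
          rwa [show (i : ℤ) - m + 1 = ((i + 1 : ℕ) : ℤ) - m by push_cast; ring] at this
    _ = 4 * (G (((2 * m : ℕ) : ℤ) - m) - G (((0 : ℕ) : ℤ) - m)) := by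
        rw [← Finset.mul_sum, Finset.sum_range_sub fun i : ℕ => G ((i : ℤ) - m)]
    _ ≤ 8 := by
        have h1 := (abs_le.1 (hG1 (((2 * m : ℕ) : ℤ) - m))).2
        have h2 := (abs_le.1 (hG1 (((0 : ℕ) : ℤ) - m))).1
        linarith

/-- The weighted `ℓ²`-norm with weight `r + (k - N)² / r`, `r = √N`, is bounded along the powers,
and the reciprocal weights have bounded sum. -/
theorem isPowerBounded_newmanElement : IsPowerBounded newmanElement := by
  refine ⟨8, fun N => ?_⟩
  rcases N with _ | n
  · rw [convPow, norm_pointMass]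
    norm_num
  set r : ℝ := √(n + 1) with hr
  have hr2 : r ^ 2 = n + 1 := Real.sq_sqrt (by positivity)
  have hr1 : 1 ≤ r := Real.one_le_sqrt.2 (by linarith [Nat.cast_nonneg (α := ℝ) n])
  have hr0 : 0 < r := by linarith
  refine lp.norm_le_of_forall_sum_le (by simp) (by norm_num) fun s => ?_
  simp only [ENNReal.toReal_one, Real.rpow_one]
  have h1 : ∑ k ∈ s, ‖convPow newmanElement (n + 1) k‖ ^ 2 ≤ 2 / r := by
    have := sum_le_hasSum s (fun k _ => by positivity)
      (hasSum_sq_norm_convPow_newmanElement (n + 1))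
    refine this.trans ((symbolMoment_le (n + 1)).trans ?_)
    refine div_le_div_of_nonneg_left (by norm_num) hr0 (Real.sqrt_le_sqrt ?_)
    push_cast
    linarith
  have h2 : ∑ k ∈ s, ((k : ℝ) - (n + 1)) ^ 2 * ‖convPow newmanElement (n + 1) k‖ ^ 2 ≤ 6 * r := by
    have := sum_le_hasSum s (fun k _ => by positivity)
      (hasSum_sq_sub_mul_norm_convPow_newmanElement n)
    refine this.trans ((mul_le_mul_of_nonneg_left (integral_mul_symbolDefect_le n)
      (by positivity)).trans_eq ?_)
    rw [← hr, ← hr2]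
    field_simp
  have h3 : ∑ k ∈ s, r / (r ^ 2 + ((k : ℝ) - (n + 1)) ^ 2) ≤ 8 := by
    have := sum_div_sq_add_sq_le hr1 (s.image fun k => k - ((n : ℤ) + 1))
    rw [Finset.sum_image fun i _ j _ h => by simpa using h] at this
    push_cast at this
    exact this
  have hpt : ∀ k : ℤ, ‖convPow newmanElement (n + 1) k‖ ≤
      (r * ‖convPow newmanElement (n + 1) k‖ ^ 2 +
        1 / r * (((k : ℝ) - (n + 1)) ^ 2 * ‖convPow newmanElement (n + 1) k‖ ^ 2) +
        r / (r ^ 2 + ((k : ℝ) - (n + 1)) ^ 2)) / 2 := by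
    intro k
    generalize ‖convPow newmanElement (n + 1) k‖ = c
    generalize ((k : ℝ) - (n + 1)) = x
    have hw : 0 < (r ^ 2 + x ^ 2) / r := by positivity
    have h4 : r * c ^ 2 + 1 / r * (x ^ 2 * c ^ 2) = c ^ 2 * ((r ^ 2 + x ^ 2) / r) := by
      field_simp
    have h5 : r / (r ^ 2 + x ^ 2) = 1 / ((r ^ 2 + x ^ 2) / r) := by
      rw [one_div_div]
    rw [h4, h5]
    generalize (r ^ 2 + x ^ 2) / r = w at *
    have h6 : c ^ 2 * w + 1 / w - 2 * c = (c * w - 1) ^ 2 / w := by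
      field_simp
      ring
    have h7 : 0 ≤ (c * w - 1) ^ 2 / w := by positivity
    linarith
  refine (Finset.sum_le_sum fun k _ => hpt k).trans ?_
  rw [← Finset.sum_div, Finset.sum_add_distrib, Finset.sum_add_distrib, ← Finset.mul_sum,
    ← Finset.mul_sum]
  have h8 : r * ∑ k ∈ s, ‖convPow newmanElement (n + 1) k‖ ^ 2 ≤ 2 :=
    (mul_le_mul_of_nonneg_left h1 hr0.le).trans_eq (by field_simp)
  have h9 : 1 / r * ∑ k ∈ s, ((k : ℝ) - (n + 1)) ^ 2 * ‖convPow newmanElement (n + 1) k‖ ^ 2 ≤ 6 :=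
    (mul_le_mul_of_nonneg_left h2 (by positivity)).trans_eq (by field_simp)
  linarith

theorem tendsto_supNorm_convPow_newmanElement :
    Tendsto (fun n : ℕ => supNorm (convPow newmanElement n)) atTop (𝓝 0) := by
  have hlim : Tendsto (fun n : ℕ => √(2 / √((n : ℝ) + 1))) atTop (𝓝 0) := by
    have h1 : Tendsto (fun n : ℕ => √((n : ℝ) + 1)) atTop atTop :=
      Real.tendsto_sqrt_atTop.comp (tendsto_natCast_atTop_atTop.atTop_add tendsto_const_nhds)
    have h2 := (Real.continuous_sqrt.tendsto 0).comp (h1.const_div_atTop 2)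
    rwa [Real.sqrt_zero] at h2
  refine squeeze_zero (fun n => Real.iSup_nonneg fun k => norm_nonneg _) (fun n => ?_) hlim
  refine ciSup_le fun k => Real.le_sqrt_of_sq_le ?_
  exact (le_hasSum (hasSum_sq_norm_convPow_newmanElement n) k fun _ _ => by positivity).trans
    (symbolMoment_le n)

theorem norm_newmanElement : ‖newmanElement‖ = 3 / √5 := by
  have h5 : 0 < √(5 : ℝ) := by positivity
  have hc : ‖(((√5 : ℝ) : ℂ))⁻¹‖ = 1 / √5 := by
    rw [norm_inv, Complex.norm_real, Real.norm_of_nonneg h5.le, one_div]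
  have hsum : HasSum (fun k => ‖(pointMass 0 + pointMass 1 - pointMass 2 : ℓ¹(ℤ, ℂ)) k‖)
      (∑ k ∈ ({0, 1, 2} : Finset ℤ),
        ‖(pointMass 0 + pointMass 1 - pointMass 2 : ℓ¹(ℤ, ℂ)) k‖) := by
    refine hasSum_sum_of_ne_finset_zero fun k hk => ?_
    simp only [Finset.mem_insert, Finset.mem_singleton, not_or] at hk
    simp [pointMass_apply, hk.1, hk.2.1, hk.2.2]
  rw [newmanElement, norm_smul, hc, norm_eq_tsum_norm, hsum.tsum_eq]
  simp only [lp.coeFn_sub, lp.coeFn_add, Pi.sub_apply, Pi.add_apply, pointMass_apply]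
  norm_num
  ring

end Newman

/-! ### The powers of two are additively sparse -/

section PowersOfTwo

theorem sum_two_pow_injective {r s : ℕ} {a : Fin r → ℕ} {b : Fin s → ℕ} (ha : StrictMono a)
    (hb : StrictMono b) (h : ∑ i, 2 ^ a i = ∑ i, 2 ^ b i) :
    r = s ∧ ∀ (i : Fin r) (i' : Fin s), (i : ℕ) = (i' : ℕ) → a i = b i' := by
  have himage : Finset.univ.image a = Finset.univ.image b := by
    refine Finset.geomSum_injective le_rfl ?_
    beta_reduce
    rw [Finset.sum_image fun i _ j _ h => ha.injective h,
      Finset.sum_image fun i _ j _ h => hb.injective h, h]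
  have hcard := congrArg Finset.card himage
  rw [Finset.card_image_of_injective _ ha.injective, Finset.card_image_of_injective _ hb.injective,
    Finset.card_fin, Finset.card_fin] at hcard
  subst hcard
  have hrange : Set.range a = Set.range b := by
    simpa using congrArg (fun F : Finset ℕ => (F : Set ℕ)) himage
  have hab := (StrictMono.range_inj ha hb).1 hrange
  exact ⟨rfl, fun i i' hi => by rw [hab, Fin.ext hi]⟩

theorem isAdditivelySparse_range_two_pow :
    IsAdditivelySparse (Set.range fun n : ℕ => (2 : ℤ) ^ n) := by
  refine ⟨Set.infinite_range_of_injective (pow_right_injective₀ two_pos (by norm_num)),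
    fun t r s => ⟨2 ^ t.natAbs, fun j l hj hjm hl hlm hsum => ?_⟩⟩
  choose a ha using fun i => (hj i).1
  choose b hb using fun i => (hl i).1
  have habs : ∀ n : ℕ, |(2 : ℤ) ^ n| = 2 ^ n := fun n => abs_of_nonneg (by positivity)
  have hlt : ∀ m n : ℕ, (2 : ℤ) ^ m < 2 ^ n → m < n := fun m n h =>
    (pow_lt_pow_iff_right₀ (by norm_num)).1 h
  have ham : StrictMono a := fun i i' hi => hlt _ _ (by
    have := hjm hi
    simpa only [← ha, habs] using this)
  have hbm : StrictMono b := fun i i' hi => hlt _ _ (by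
    have := hlm hi
    simpa only [← hb, habs] using this)
  have hdj : (2 : ℤ) ^ t.natAbs ∣ ∑ i, j i := Finset.dvd_sum fun i _ => by
    have := (hj i).2
    rw [← ha, habs] at this
    push_cast at this
    rw [← ha]
    exact pow_dvd_pow _ (hlt _ _ this).le
  have hdl : (2 : ℤ) ^ t.natAbs ∣ ∑ i, l i := Finset.dvd_sum fun i _ => by
    have := (hl i).2
    rw [← hb, habs] at this
    push_cast at this
    rw [← hb]
    exact pow_dvd_pow _ (hlt _ _ this).le
  have ht : t = 0 := by
    have hdt : (2 : ℤ) ^ t.natAbs ∣ t := by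
      have := dvd_sub hdj hdl
      rwa [hsum, add_sub_cancel_left] at this
    refine Int.eq_zero_of_abs_lt_dvd hdt ?_
    rw [Int.abs_eq_natAbs]
    exact_mod_cast Nat.lt_two_pow_self
  subst ht
  rw [add_zero] at hsum
  have hnat : ∑ i, 2 ^ a i = ∑ i, 2 ^ b i := by
    have : ((∑ i, 2 ^ a i : ℕ) : ℤ) = ((∑ i, 2 ^ b i : ℕ) : ℤ) := by
      push_cast
      simpa only [← ha, ← hb] using hsum
    exact_mod_cast this
  obtain ⟨hrs, hab⟩ := sum_two_pow_injective ham hbm hnat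
  exact ⟨rfl, hrs, fun i i' hi => by rw [← ha, ← hb, hab i i' hi]⟩

end PowersOfTwo

/-! ### The projection of `ℓ¹((ℤ × ℤ⁺) ∪ {∞})` onto `ℓ¹(ℤ)` -/

section Projection

variable {J : Set ℤ}

/-- The images of the point masses under the projection determined by `a`:
`δ_{(n,k)} ↦ δ_n * a^k` and `δ_∞ ↦ 0`. -/
def projFamily (J : Set ℤ) (a : ℓ¹(ℤ, ℂ)) (s : SSpace J) : ℓ¹(ℤ, ℂ) :=
  s.elim 0 fun γ => conv (pointMass γ.1) (convPow a γ.2)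

@[simp] theorem projFamily_infty (a : ℓ¹(ℤ, ℂ)) : projFamily J a OnePoint.infty = 0 := rfl

theorem projFamily_coe (a : ℓ¹(ℤ, ℂ)) (γ : TSpace J) :
    projFamily J a γ = conv (pointMass γ.1) (convPow a γ.2) := rfl

theorem norm_projFamily_le {a : ℓ¹(ℤ, ℂ)} {C : ℝ} (hC : ∀ n, ‖convPow a n‖ ≤ C) (s : SSpace J) :
    ‖projFamily J a s‖ ≤ C := by
  induction s using OnePoint.rec with
  | infty => simpa using (norm_nonneg _).trans (hC 0)
  | coe γ =>
    rw [projFamily_coe, norm_conv_pointMass]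
    exact hC _

theorem projFamily_add (a : ℓ¹(ℤ, ℂ)) (s t : SSpace J) :
    projFamily J a (s + t) = conv (projFamily J a s) (projFamily J a t) := by
  induction s using OnePoint.rec with
  | infty =>
    rw [SSpace.infty_add, projFamily_infty, ← convL_apply]
    simp
  | coe x =>
    induction t using OnePoint.rec with
    | infty =>
      rw [add_comm, SSpace.infty_add, projFamily_infty, ← convL_apply]
      simp
    | coe y =>
      rw [SSpace.coe_add_coe, projFamily_coe, projFamily_coe, projFamily_coe, add_fst, add_snd,
        convPow_add, ← conv_pointMass, conv_assoc, conv_assoc,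
        ← conv_assoc (pointMass y.1), conv_comm (pointMass y.1) (convPow a x.2), conv_assoc]

theorem projFamily_ofInt (a : ℓ¹(ℤ, ℂ)) (n : ℤ) : projFamily J a (ofInt J n) = pointMass n :=
  conv_pointMass_zero _

theorem projFamily_gen (a : ℓ¹(ℤ, ℂ)) : projFamily J a (gen J) = a := by
  change conv (pointMass 0) (conv (pointMass 0) a) = a
  rw [pointMass_zero_conv, pointMass_zero_conv]

theorem apply_eq_of_forall_ofInt {Θ : ℓ¹(SSpace J, ℂ) →L[ℂ] ℓ¹(ℤ, ℂ)}
    (hΘ : ∀ n, Θ (pointMass (ofInt J n)) = pointMass n) (μ : ℓ¹(SSpace J, ℂ))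
    (hμ : ∀ s, s ∉ Set.range (ofInt J) → μ s = 0) (n : ℤ) : Θ μ n = μ (ofInt J n) := by
  classical
  let ev : ℓ¹(ℤ, ℂ) →L[ℂ] ℂ := lp.evalCLM ℂ (fun _ : ℤ => ℂ) 1 n
  have h := (hasSum_clm_apply (ev.comp Θ) μ).tsum_eq
  change ∑' s, μ s • (Θ (pointMass s)) n = Θ μ n at h
  rw [← h, tsum_eq_single (ofInt J n)]
  · simp [hΘ, pointMass_apply]
  · intro s hs
    by_cases hsr : s ∈ Set.range (ofInt J)
    · obtain ⟨m, rfl⟩ := hsr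
      have hnm : n ≠ m := fun h => hs (by rw [h])
      simp [hΘ, pointMass_apply, hnm]
    · simp [hμ s hsr]

theorem ofInt_injective : Function.Injective (ofInt J) := fun _ _ h =>
  congrArg Prod.fst (OnePoint.coe_injective h)

theorem IsHomProjection.apply_pointMass_embedding {S : Type*} [AddCommMonoid S] {φ : ℤ →+ S}
    (hφ : Function.Injective φ) {Θ : ℓ¹(S, ℂ) →L[ℂ] ℓ¹(ℤ, ℂ)} (hΘ : IsHomProjection φ Θ) (n : ℤ) :
    Θ (pointMass (φ n)) = pointMass n := by
  classical
  ext m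
  rw [hΘ.proj _ (fun s hs => ?_) m]
  · simp [pointMass_apply, hφ.eq_iff]
  · rw [pointMass_apply, if_neg]
    rintro rfl
    exact hs ⟨n, rfl⟩

/-- A homomorphic projection is determined by its value at the generator `e`: it kills `δ_∞`,
whose image is translation invariant. -/
theorem IsHomProjection.apply_pointMass {Θ : ℓ¹(SSpace J, ℂ) →L[ℂ] ℓ¹(ℤ, ℂ)}
    (hΘ : IsHomProjection (ofInt J) Θ) (s : SSpace J) :
    Θ (pointMass s) = projFamily J (Θ (pointMass (gen J))) s := by
  have hint := hΘ.apply_pointMass_embedding ofInt_injective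
  induction s using OnePoint.rec with
  | infty =>
    rw [projFamily_infty]
    set b := Θ (pointMass (OnePoint.infty : SSpace J)) with hb
    have hshift : ∀ k : ℤ, conv (pointMass k) b = b := by
      intro k
      rw [← hint k, hb, ← hΘ.map_conv, conv_pointMass, add_comm, SSpace.infty_add]
    have hconst : ∀ k : ℤ, b k = b 0 := by
      intro k
      have := congrArg (fun f : ℓ¹(ℤ, ℂ) => f k) (hshift k)
      simp only [conv_pointMass_apply, sub_self] at this
      exact this.symm
    have hsum : Summable fun _ : ℤ => ‖b 0‖ := by
      simpa only [hconst] using summable_norm_coe b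
    have h0 : ‖b 0‖ = 0 := (summable_const_iff _).1 hsum
    ext k
    rw [hconst k, norm_eq_zero.1 h0]
    rfl
  | coe γ =>
    obtain ⟨n, k⟩ := γ
    change Θ (pointMass ((pt J n k : TSpace J) : SSpace J)) =
      conv (pointMass n) (convPow (Θ (pointMass (gen J))) k)
    induction k with
    | zero =>
      rw [convPow, conv_pointMass_zero]
      exact hint n
    | succ k ih =>
      have h : ((pt J n (k + 1) : TSpace J) : SSpace J) = (pt J n k : TSpace J) + gen J := by
        change _ = ((pt J n k + pt J 0 1 : TSpace J) : SSpace J)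
        rw [pt_add_pt, add_zero]
      rw [h, ← conv_pointMass, hΘ.map_conv, ih, convPow, conv_assoc]

theorem existsUnique_isHomProjection {a : ℓ¹(ℤ, ℂ)} (ha : IsPowerBounded a) :
    ∃! Θ : ℓ¹(SSpace J, ℂ) →L[ℂ] ℓ¹(ℤ, ℂ),
      IsHomProjection (ofInt J) Θ ∧ Θ (pointMass (gen J)) = a := by
  obtain ⟨C, hC⟩ := ha
  refine ⟨ofFamily (projFamily J a) C (norm_projFamily_le hC), ⟨⟨?_, ?_⟩, ?_⟩, ?_⟩
  · refine map_conv_of_pointMass _ fun s t => ?_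
    simp only [ofFamily_pointMass, projFamily_add]
  · exact apply_eq_of_forall_ofInt fun n => by rw [ofFamily_pointMass, projFamily_ofInt]
  · rw [ofFamily_pointMass, projFamily_gen]
  · rintro Θ ⟨hΘ, hΘa⟩
    refine clm_ext_pointMass fun s => ?_
    rw [hΘ.apply_pointMass, hΘa, ofFamily_pointMass]

end Projection

/-! ### The folding operators -/

section Folding

variable {J : Set ℤ} {a : ℓ¹(ℤ, ℂ)}

theorem norm_apply_le_supNorm {S : Type*} (f : ℓ¹(S, ℂ)) (s : S) : ‖f s‖ ≤ supNorm f :=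
  le_ciSup (f := fun s => ‖f s‖) ⟨‖f‖, by
    rintro _ ⟨t, rfl⟩
    exact lp.norm_apply_le_norm (by simp) f t⟩ s

/-- `(m, p, w)` is a decomposition of `q`: `q = p + w` for a sum `p` of `m ≤ R` large elements of
`J` and a remainder `w` with `|w| ≤ W`. -/
def IsDecomposition (J : Set ℤ) (n R W : ℕ) (q : ℤ) (d : ℕ × ℤ × ℤ) : Prop :=
  d.1 ≤ R ∧ d.2.1 ∈ sumSet J d.1 n ∧ |d.2.2| ≤ W ∧ q = d.2.1 + d.2.2

open Classical in
/-- The images of the point masses under the folding operator: a point `p + w`, where `p` is a sum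
of `m ≤ R` large elements of `J` and `|w| ≤ W`, is sent to `δ_w * a^m`; all other points are sent
to `0`. -/
def foldFamily (J : Set ℤ) (a : ℓ¹(ℤ, ℂ)) (n R W : ℕ) (q : ℤ) : ℓ¹(ℤ, ℂ) :=
  if h : ∃ d, IsDecomposition J n R W q d then
    conv (pointMass h.choose.2.2) (convPow a h.choose.1) else 0

theorem norm_foldFamily_le {C : ℝ} (hC : ∀ k, ‖convPow a k‖ ≤ C) (n R W : ℕ) (q : ℤ) :
    ‖foldFamily J a n R W q‖ ≤ C := by
  unfold foldFamily
  split_ifs with h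
  · rw [norm_conv_pointMass]
    exact hC _
  · simpa using (norm_nonneg _).trans (hC 0)

/-- Any two sums of at most `R` elements of `J` of modulus greater than `n` that are at distance at
most `M` agree, and so do the numbers of their summands. -/
def IsSeparated (J : Set ℤ) (n R M : ℕ) : Prop :=
  ∀ r ≤ R, ∀ s ≤ R, ∀ p ∈ sumSet J r n, ∀ q ∈ sumSet J s n, |p - q| ≤ M → p = q ∧ r = s

theorem foldFamily_add {n R W M : ℕ} (hsep : IsSeparated J n R M) (hM : 2 * W ≤ M) {m : ℕ}
    (hm : m ≤ R) {p : ℤ} (hp : p ∈ sumSet J m n) {w : ℤ} (hw : |w| ≤ W) :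
    foldFamily J a n R W (p + w) = conv (pointMass w) (convPow a m) := by
  have h : ∃ d, IsDecomposition J n R W (p + w) d := ⟨(m, p, w), hm, hp, hw, rfl⟩
  obtain ⟨h1, h2, h3, h4⟩ := h.choose_spec
  have h5 := hsep _ h1 _ hm _ h2 _ hp (by
    rw [abs_le] at hw h3 ⊢
    constructor <;> omega)
  have h6 : h.choose.2.2 = w := by omega
  rw [foldFamily, dif_pos h, h6, h5.2]

theorem exists_isDecomposition_of_foldFamily_ne_zero {n R W : ℕ} {q : ℤ}
    (hq : foldFamily J a n R W q ≠ 0) : ∃ d, IsDecomposition J n R W q d := by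
  by_contra h
  exact hq (dif_neg h)

/-- The folding operator: it moves the windows around all sums of at most `R` large elements of
`J` back to the window around `0`, multiplying by the corresponding power of `a`. -/
def foldOp (J : Set ℤ) {C : ℝ} (hC : ∀ k, ‖convPow a k‖ ≤ C) (n R W : ℕ) :
    ℓ¹(ℤ, ℂ) →L[ℂ] ℓ¹(ℤ, ℂ) :=
  ofFamily (foldFamily J a n R W) C (norm_foldFamily_le hC n R W)

variable {C : ℝ} (hC : ∀ k, ‖convPow a k‖ ≤ C)

theorem norm_foldOp_le (n R W : ℕ) (f : ℓ¹(ℤ, ℂ)) : ‖foldOp J hC n R W f‖ ≤ C * ‖f‖ :=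
  norm_clm_apply_le _ f fun q => by
    rw [foldOp, ofFamily_pointMass]
    exact norm_foldFamily_le hC n R W q

/-- The folding operator undoes a translation by a sum of `m` large elements of `J` of an element
that is supported in the window, up to multiplication by `a^m`. -/
theorem foldOp_conv_pointMass {n R W M : ℕ} (hsep : IsSeparated J n R M) (hM : 2 * W ≤ M) {m : ℕ}
    (hm : m ≤ R) {p : ℤ} (hp : p ∈ sumSet J m n) {f : ℓ¹(ℤ, ℂ)}
    (hf : ∀ w, f w ≠ 0 → |w| ≤ W) :
    foldOp J hC n R W (conv (pointMass p) f) = conv f (convPow a m) := by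
  have h1 := hasSum_clm_apply ((foldOp J hC n R W).comp (convL (pointMass p))) f
  have h2 := hasSum_clm_apply (convL.flip (convPow a m)) f
  simp only [ContinuousLinearMap.comp_apply, ContinuousLinearMap.flip_apply, convL_apply,
    conv_pointMass] at h1 h2
  refine h1.unique ?_
  refine h2.congr_fun fun w => ?_
  by_cases hw : f w = 0
  · simp [hw]
  · rw [foldOp, ofFamily_pointMass, foldFamily_add hsep hM hm hp (hf w hw)]

/-- An element of small diameter meets only one of the windows, so that only its supremum norm
counts. -/
theorem norm_foldOp_le_of_diam_le {n R W D M : ℕ} (hsep : IsSeparated J n R M)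
    (hM : D + 2 * W ≤ M) {b : ℓ¹(ℤ, ℂ)} (hb : ∀ q q', b q ≠ 0 → b q' ≠ 0 → |q - q'| ≤ D) {η : ℝ}
    (hη : ∀ q, ‖b q‖ ≤ η) : ‖foldOp J hC n R W b‖ ≤ (2 * W + 1) * η * C := by
  have hη0 : 0 ≤ η := (norm_nonneg _).trans (hη 0)
  have hC0 : 0 ≤ C := (norm_nonneg _).trans (hC 0)
  rw [foldOp, ofFamily_apply]
  by_cases h : ∃ q, b q ≠ 0 ∧ foldFamily J a n R W q ≠ 0
  · obtain ⟨q, hbq, hq⟩ := h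
    obtain ⟨⟨m, p, w⟩, hm, hp, hw, hqp⟩ := exists_isDecomposition_of_foldFamily_ne_zero hq
    rw [tsum_eq_sum (s := Finset.Icc (p - W) (p + W))]
    · refine (norm_sum_le_of_le (f := fun q => b q • foldFamily J a n R W q)
        (n := fun _ => η * C) _ fun q' _ => ?_).trans_eq ?_
      · rw [norm_smul]
        exact mul_le_mul (hη _) (norm_foldFamily_le hC _ _ _ _) (norm_nonneg _) hη0
      · rw [Finset.sum_const, Int.card_Icc, nsmul_eq_mul,
          show p + W + 1 - (p - W) = ((2 * W + 1 : ℕ) : ℤ) by push_cast; ring, Int.toNat_natCast]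
        push_cast
        ring
    · intro q' hq'
      by_contra hne
      rw [smul_eq_zero, not_or] at hne
      obtain ⟨⟨m', p', w'⟩, hm', hp', hw', hqp'⟩ :=
        exists_isDecomposition_of_foldFamily_ne_zero hne.2
      have hd := hb q q' hbq hne.1
      simp only [abs_le] at hm hp hw hqp hm' hp' hw' hqp' hd
      have h5 := (hsep _ hm _ hm' _ hp _ hp' (by rw [abs_le]; constructor <;> omega)).1
      refine hq' (Finset.mem_Icc.2 ⟨?_, ?_⟩) <;> omega
  · push Not at h
    have hz : ∀ q, b q • foldFamily J a n R W q = 0 := fun q => by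
      by_cases hq : b q = 0
      · rw [hq, zero_smul]
      · rw [h q hq, smul_zero]
    rw [tsum_congr hz, tsum_zero, norm_zero]
    positivity

/-- Folding makes the images of all points outside a compact set small: points of low level miss
all windows, and for points of high level the supremum norm of the powers of `a` is small. -/
theorem exists_isCompact_norm_foldOp_projFamily_le
    (hfin : ∀ k, ∃ w : ℕ, ∀ q, convPow a k q ≠ 0 → |q| ≤ w)
    {R W K D M : ℕ} {η : ℝ} (hη : ∀ q, ‖convPow a K q‖ ≤ η)
    (hD : ∀ q, convPow a K q ≠ 0 → 2 * |q| ≤ D) (hM : D + 2 * W ≤ M) {n : ℕ}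
    (hsep : IsSeparated J n R M) :
    ∃ A : Set (TSpace J), IsCompact A ∧ IsOpen A ∧ ∀ γ ∉ A,
      ‖foldOp J hC n R W (projFamily J a γ)‖ ≤ (2 * W + 1) * η * C * C := by
  have hη0 : 0 ≤ η := (norm_nonneg _).trans (hη 0)
  have hC0 : 0 ≤ C := (norm_nonneg _).trans (hC 0)
  choose v hv using hfin
  obtain ⟨V, hV⟩ : ∃ V, ∀ k < K, v k ≤ V :=
    ⟨(Finset.range K).sup v, fun k hk => Finset.le_sup (Finset.mem_range.2 hk)⟩
  let I : Finset (ℤ × ℕ) := Finset.Icc (-((W : ℤ) + V)) (W + V) ×ˢ Finset.range (K + R)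
  refine ⟨⋃ x ∈ I, basicNhd J (pt J x.1 x.2) n, I.isCompact_biUnion fun _ _ =>
    isCompact_basicNhd _ _, isOpen_biUnion fun _ _ => isOpen_basicNhd _ _, fun γ hγ => ?_⟩
  rw [projFamily_coe]
  by_cases hγK : γ.2 < K
  · have hzero : foldOp J hC n R W (conv (pointMass γ.1) (convPow a γ.2)) = 0 := by
      have h1 := hasSum_clm_apply ((foldOp J hC n R W).comp (convL (pointMass γ.1)))
        (convPow a γ.2)
      simp only [ContinuousLinearMap.comp_apply, convL_apply, conv_pointMass] at h1
      refine h1.unique ?_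
      refine hasSum_zero.congr_fun fun q => ?_
      rw [smul_eq_zero]
      by_contra hne
      rw [not_or, foldOp, ofFamily_pointMass] at hne
      obtain ⟨⟨m, p, w⟩, hm, hp, hw, hqp⟩ := exists_isDecomposition_of_foldFamily_ne_zero hne.2
      have hq := hv _ q hne.1
      have hvV := hV _ hγK
      simp only [abs_le] at hm hp hw hqp hq
      refine hγ (Set.mem_iUnion₂.2 ⟨(w - q, γ.2 + m), ?_, ?_⟩)
      · refine Finset.mem_product.2 ⟨Finset.mem_Icc.2 ⟨?_, ?_⟩, Finset.mem_range.2 ?_⟩ <;>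
          simp only <;> omega
      · rw [mem_basicNhd, pt_fst, pt_snd, Nat.add_sub_cancel_left]
        refine ⟨Nat.le_add_right _ _, ?_⟩
        rwa [show γ.1 - (w - q) = p by omega]
    rw [hzero, norm_zero]
    positivity
  · obtain ⟨l, hl⟩ := Nat.exists_eq_add_of_le (not_lt.1 hγK)
    have h1 : conv (pointMass γ.1) (convPow a γ.2) =
        conv (convPow a K) (conv (pointMass γ.1) (convPow a l)) := by
      rw [hl, convPow_add, ← conv_assoc, conv_comm (pointMass γ.1), conv_assoc]
    have h2 : ∀ r, ‖((foldOp J hC n R W).comp (convL (convPow a K))) (pointMass r)‖ ≤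
        (2 * W + 1) * η * C := by
      intro r
      rw [ContinuousLinearMap.comp_apply, convL_apply, conv_comm]
      refine norm_foldOp_le_of_diam_le hC hsep hM (fun q q' hq hq' => ?_) fun q => ?_
      · rw [conv_pointMass_apply] at hq hq'
        have e1 := hD _ hq
        have e2 := hD _ hq'
        rw [Int.abs_eq_natAbs] at *
        omega
      · rw [conv_pointMass_apply]
        exact hη _
    have h3 := norm_clm_apply_le _ (conv (pointMass γ.1) (convPow a l)) h2
    rw [ContinuousLinearMap.comp_apply, convL_apply, ← h1, norm_conv_pointMass] at h3
    exact h3.trans (mul_le_mul_of_nonneg_left (hC l) (by positivity))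

/-- For finitely many points `γ` there is a uniformly bounded operator that takes the images of
all points of suitable disjoint neighbourhoods of the `γ` to the image of `γ`, and that makes the
images of all points outside a compact set small. -/
theorem exists_folding (hJ : IsAdditivelySparse J) (hC : ∀ k, ‖convPow a k‖ ≤ C)
    (hfin : ∀ k, ∃ w : ℕ, ∀ q, convPow a k q ≠ 0 → |q| ≤ w)
    (hsup : Tendsto (fun k => supNorm (convPow a k)) atTop (𝓝 0)) (G : Finset (TSpace J)) {ε : ℝ}
    (hε : 0 < ε) : ∃ (n : ℕ) (Φ : ℓ¹(ℤ, ℂ) →L[ℂ] ℓ¹(ℤ, ℂ)) (A : Set (TSpace J)),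
      (∀ γ ∈ G, ∀ γ' ∈ G, ∀ β ∈ basicNhd J γ n, β ∈ basicNhd J γ' n → γ = γ') ∧
      (∀ γ ∈ G, ∀ β ∈ basicNhd J γ n, Φ (projFamily J a β) = projFamily J a γ) ∧
      (∀ f, ‖Φ f‖ ≤ C * ‖f‖) ∧ IsCompact A ∧ IsOpen A ∧
      ∀ γ ∉ A, ‖Φ (projFamily J a γ)‖ ≤ ε := by
  choose v hv using hfin
  have hC0 : 0 ≤ C := (norm_nonneg _).trans (hC 0)
  obtain ⟨R, hR⟩ : ∃ R, ∀ γ ∈ G, γ.2 ≤ R :=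
    ⟨G.sup fun γ => γ.2, fun γ hγ => Finset.le_sup (f := fun γ : TSpace J => γ.2) hγ⟩
  obtain ⟨W₁, hW₁⟩ : ∃ W₁, ∀ γ ∈ G, γ.1.natAbs ≤ W₁ :=
    ⟨G.sup fun γ => γ.1.natAbs, fun γ hγ =>
      Finset.le_sup (f := fun γ : TSpace J => γ.1.natAbs) hγ⟩
  obtain ⟨W₂, hW₂⟩ : ∃ W₂, ∀ k < R + 1, v k ≤ W₂ :=
    ⟨(Finset.range (R + 1)).sup v, fun k hk => Finset.le_sup (Finset.mem_range.2 hk)⟩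
  set W := W₁ + W₂ with hW
  obtain ⟨K, hK⟩ : ∃ K, (2 * W + 1) * supNorm (convPow a K) * C * C < ε := by
    have h1 : Tendsto (fun k => (2 * W + 1) * supNorm (convPow a k) * C * C) atTop (𝓝 0) := by
      simpa using ((hsup.const_mul (2 * (W : ℝ) + 1)).mul_const C).mul_const C
    exact (h1.eventually_lt_const hε).exists
  obtain ⟨n, hsep⟩ := (eventually_sumSet_separated hJ (2 * v K + 2 * W) R).exists
  obtain ⟨A, hA, hAo, hAε⟩ := exists_isCompact_norm_foldOp_projFamily_le (J := J) hC
    (fun k => ⟨v k, hv k⟩) (R := R) (W := W) (K := K) (D := 2 * v K)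
    (norm_apply_le_supNorm (convPow a K)) (fun q hq => by have := hv K q hq; push_cast; omega)
    le_rfl hsep
  refine ⟨n, foldOp J hC n R W, A, ?_, ?_, norm_foldOp_le hC n R W, hA, hAo,
    fun γ hγ => (hAε γ hγ).trans hK.le⟩
  · intro γ hγ γ' hγ' β hβ hβ'
    rw [mem_basicNhd] at hβ hβ'
    have e1 := hR γ hγ
    have e2 := hR γ' hγ'
    have e3 := hW₁ γ hγ
    have e4 := hW₁ γ' hγ'
    have h := hsep _ (by omega) _ (by omega) _ hβ.2 _ hβ'.2 (by
      rw [Int.abs_eq_natAbs]; omega)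
    exact Prod.ext (by have := h.1; omega)
      (by have := h.2; have := hβ.1; have := hβ'.1; omega)
  · intro γ hγ β hβ
    rw [mem_basicNhd] at hβ
    have e1 := hR γ hγ
    have e3 := hW₁ γ hγ
    have e5 := hW₂ β.2 (by have := hβ.1; omega)
    have h1 : projFamily J a β =
        conv (pointMass (β.1 - γ.1)) (conv (pointMass γ.1) (convPow a β.2)) := by
      rw [projFamily_coe, ← conv_assoc, conv_pointMass, sub_add_cancel]
    rw [h1, foldOp_conv_pointMass hC hsep (by omega) (by omega) hβ.2, conv_assoc, ← convPow_add,
      Nat.add_sub_cancel' hβ.1, projFamily_coe]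
    intro w hw
    rw [conv_pointMass_apply] at hw
    have := hv _ _ hw
    rw [Int.abs_eq_natAbs] at this ⊢
    omega

end Folding

section NewmanSupport

theorem convPow_newmanElement_eq_zero (n : ℕ) {k : ℤ} (hk : k < 0 ∨ 2 * n < k) :
    convPow newmanElement n k = 0 := by
  induction n generalizing k with
  | zero =>
    have : k ≠ 0 := by
      push_cast at hk
      omega
    simp [convPow, pointMass_apply, this]
  | succ n ih =>
    push_cast at hk
    rw [convPow_newmanElement_succ, ih (by omega), ih (by omega), ih (by omega)]
    simp

theorem abs_le_of_convPow_newmanElement_ne_zero (n : ℕ) (k : ℤ)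
    (hk : convPow newmanElement n k ≠ 0) : |k| ≤ (2 * n : ℕ) := by
  by_contra h
  refine hk (convPow_newmanElement_eq_zero n ?_)
  rw [Int.abs_eq_natAbs] at h
  omega

end NewmanSupport

/-! ### Weak*-limits of bounded nets in the kernel of the projection -/

section TestFunctions

/-- The modulus of an element of `ℓ¹(I)`. -/
def modulus {I : Type*} (ν : ℓ¹(I, ℂ)) : ℓ¹(I, ℂ) :=
  ⟨fun i => (‖ν i‖ : ℂ), memℓp_gen (by simpa using summable_norm_coe ν)⟩

theorem modulus_apply {I : Type*} (ν : ℓ¹(I, ℂ)) (i : I) : modulus ν i = (‖ν i‖ : ℂ) := rfl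

theorem norm_modulus {I : Type*} (ν : ℓ¹(I, ℂ)) : ‖modulus ν‖ = ‖ν‖ := by
  simp [norm_eq_tsum_norm, modulus_apply]

variable {K : Type*} [TopologicalSpace K]

/-- The characteristic function of a clopen set. -/
def clopenIndicator {A : Set K} (hA : IsClopen A) : C(K, ℂ) :=
  ⟨A.indicator 1, by
    have := (LocallyConstant.charFn ℂ hA).continuous
    rwa [LocallyConstant.coe_charFn] at this⟩

theorem clopenIndicator_of_mem {A : Set K} (hA : IsClopen A) {s : K} (hs : s ∈ A) :
    clopenIndicator hA s = 1 := by
  simp [clopenIndicator, hs]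

theorem clopenIndicator_of_notMem {A : Set K} (hA : IsClopen A) {s : K} (hs : s ∉ A) :
    clopenIndicator hA s = 0 := by
  simp [clopenIndicator, hs]

variable [CompactSpace K]

theorem norm_toDual_le (ν : ℓ¹(K, ℂ)) : ‖toDual ν‖ ≤ ‖ν‖ := by
  refine ((toDual : ℓ¹(K, ℂ) →L[ℂ] _).le_opNorm ν).trans ?_
  exact mul_le_of_le_one_left (norm_nonneg _) (norm_ofFamily_le _ _ zero_le_one)

/-- On a countable compact space the moduli of a bounded family have a weak*-limit in `ℓ¹`. -/
theorem exists_tendsto_modulus [T2Space K] [Countable K] (F : Ultrafilter ℓ¹(K, ℂ)) {B : ℝ}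
    (hB : ∀ᶠ ν in (F : Filter ℓ¹(K, ℂ)), ‖ν‖ ≤ B) :
    ∃ l : ℓ¹(K, ℂ), ∀ f : C(K, ℂ), Tendsto (fun ν => toDual (modulus ν) f) F (𝓝 (toDual l f)) := by
  let F' : Ultrafilter (WeakDual ℂ C(K, ℂ)) :=
    F.map fun ν => StrongDual.toWeakDual (toDual (modulus ν))
  have hF' : WeakDual.toStrongDual ⁻¹' Metric.closedBall (0 : C(K, ℂ) →L[ℂ] ℂ) B ∈ F' := by
    rw [Ultrafilter.mem_map]
    filter_upwards [hB] with ν hν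
    change toDual (modulus ν) ∈ Metric.closedBall (0 : C(K, ℂ) →L[ℂ] ℂ) B
    rw [mem_closedBall_zero_iff]
    exact (norm_toDual_le _).trans ((norm_modulus ν).trans_le hν)
  obtain ⟨Λ, -, hΛ⟩ := isCompact_iff_ultrafilter_le_nhds'.1
    (WeakDual.isCompact_closedBall (𝕜 := ℂ) (0 : C(K, ℂ) →L[ℂ] ℂ) B) F' hF'
  obtain ⟨l, hl⟩ := toDual_surjective (WeakDual.toStrongDual Λ)
  refine ⟨l, fun f => ?_⟩
  rw [hl]
  exact ((WeakDual.eval_continuous f).tendsto Λ).comp hΛ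

end TestFunctions

section KernelBall

variable {J : Set ℤ} {a : ℓ¹(ℤ, ℂ)} {C : ℝ}

theorem isClopen_coe_image (hJ : IsAdditivelySparse J) {A : Set (TSpace J)} (hA : IsCompact A)
    (hAo : IsOpen A) : IsClopen ((↑) '' A : Set (SSpace J)) := by
  have := t2Space_tSpace hJ
  exact ⟨(hA.image OnePoint.continuous_coe).isClosed, OnePoint.isOpen_image_coe.2 hAo⟩

/-- The quantitative core: if `μ` and `l` have mass at most `ε` on `ℤ × ℤ⁺` outside a finite set,
then `Θ μ` is small. Here `l` is the limit of the moduli of the approximating elements of `ker Θ`;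
it controls the mass that is lost by cancellation. -/
theorem norm_apply_le_of_tendsto (hJ : IsAdditivelySparse J) (hC : ∀ k, ‖convPow a k‖ ≤ C)
    (hfin : ∀ k, ∃ w : ℕ, ∀ q, convPow a k q ≠ 0 → |q| ≤ w)
    (hsup : Tendsto (fun k => supNorm (convPow a k)) atTop (𝓝 0))
    {Θ : ℓ¹(SSpace J, ℂ) →L[ℂ] ℓ¹(ℤ, ℂ)} (hΘ : ∀ s, Θ (pointMass s) = projFamily J a s)
    (F : Filter ℓ¹(SSpace J, ℂ)) [F.NeBot] {B : ℝ} (hB : ∀ᶠ ν in F, ‖ν‖ ≤ B)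
    (hker : ∀ᶠ ν in F, Θ ν = 0)
    {μ l : ℓ¹(SSpace J, ℂ)}
    (hμ : ∀ f : C(SSpace J, ℂ), Tendsto (fun ν => toDual ν f) F (𝓝 (toDual μ f)))
    (hl : ∀ f : C(SSpace J, ℂ), Tendsto (fun ν => toDual (modulus ν) f) F (𝓝 (toDual l f)))
    (G : Finset (TSpace J)) {ε : ℝ} (hε : 0 < ε)
    (hG : ∑' γ : {γ // γ ∉ G}, (‖μ γ.1‖ + ‖l γ.1‖) ≤ ε) : ‖Θ μ‖ ≤ (2 * C + C * C + B) * ε := by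
  classical
  have hC0 : 0 ≤ C := (norm_nonneg _).trans (hC 0)
  obtain ⟨n, Φ, A, hdisj, hfold, hΦ, hA, hAo, hAε⟩ := exists_folding hJ hC hfin hsup G hε
  let V : TSpace J → Set (SSpace J) := fun γ => (↑) '' basicNhd J γ n
  have hV : ∀ γ, IsClopen (V γ) := fun γ =>
    isClopen_coe_image hJ (isCompact_basicNhd γ n) (isOpen_basicNhd γ n)
  have hself : ∀ γ, (γ : SSpace J) ∈ V γ := fun γ => Set.mem_image_of_mem _ (mem_basicNhd_self γ n)
  have hVdisj : ∀ γ ∈ G, ∀ γ' ∈ G, ∀ s ∈ V γ, s ∈ V γ' → γ = γ' := by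
    rintro γ hγ γ' hγ' _ ⟨β, hβ, rfl⟩ ⟨β', hβ', h⟩
    rw [OnePoint.coe_injective h] at hβ'
    exact hdisj γ hγ γ' hγ' β hβ hβ'
  -- `D` is the part of the compact set on which only the limit of the moduli is small.
  let D : Set (SSpace J) := (↑) '' A \ ⋃ γ ∈ G, V γ
  have hD : IsClopen D := (isClopen_coe_image hJ hA hAo).diff
    ⟨isClosed_biUnion_finset fun γ _ => (hV γ).1, isOpen_biUnion fun γ _ => (hV γ).2⟩
  -- `P ν` replaces the mass of `ν` in each neighbourhood by a point mass at its centre.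
  let P : ℓ¹(SSpace J, ℂ) →L[ℂ] ℓ¹(ℤ, ℂ) := ∑ γ ∈ G,
    (ContinuousLinearMap.toSpanSingleton ℂ (projFamily J a γ)).comp
      ((ContinuousLinearMap.apply ℂ ℂ (clopenIndicator (hV γ))).comp toDual)
  have hP : ∀ ν, P ν = ∑ γ ∈ G, toDual ν (clopenIndicator (hV γ)) • projFamily J a γ := by
    intro ν
    simp [P]
  have hPmem : ∀ γ ∈ G, ∀ s ∈ V γ, P (pointMass s) = projFamily J a γ := by
    intro γ hγ s hs
    rw [hP, Finset.sum_eq_single_of_mem γ hγ]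
    · rw [toDual_pointMass, clopenIndicator_of_mem _ hs, one_smul]
    · intro γ' hγ' hne
      rw [toDual_pointMass, clopenIndicator_of_notMem, zero_smul]
      exact fun hs' => hne (hVdisj γ' hγ' γ hγ s hs' hs)
  have hPnot : ∀ s, (∀ γ ∈ G, s ∉ V γ) → P (pointMass s) = 0 := by
    intro s hs
    rw [hP]
    refine Finset.sum_eq_zero fun γ hγ => ?_
    rw [toDual_pointMass, clopenIndicator_of_notMem _ (hs γ hγ), zero_smul]
  -- Comparison of `P` with the folding of `Θ`.
  have hcomp : ∀ s, ‖(P - Φ.comp Θ) (pointMass s)‖ ≤ C * C * ‖clopenIndicator hD s‖ + ε := by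
    intro s
    rw [_root_.sub_apply, ContinuousLinearMap.comp_apply, hΘ]
    by_cases hs : ∃ γ ∈ G, s ∈ V γ
    · obtain ⟨γ, hγ, hsγ⟩ := hs
      have h1 : Φ (projFamily J a s) = projFamily J a γ := by
        obtain ⟨β, hβ, rfl⟩ := hsγ
        exact hfold γ hγ β hβ
      rw [hPmem γ hγ s hsγ, h1, sub_self, norm_zero]
      positivity
    push Not at hs
    rw [hPnot s hs, zero_sub, norm_neg]
    by_cases hsA : s ∈ ((↑) '' A : Set (SSpace J))
    · have hsD : s ∈ D := ⟨hsA, by simpa using hs⟩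
      rw [clopenIndicator_of_mem hD hsD, norm_one, mul_one]
      have h1 := (hΦ (projFamily J a s)).trans
        (mul_le_mul_of_nonneg_left (norm_projFamily_le hC s) hC0)
      linarith
    · have h1 : ‖Φ (projFamily J a s)‖ ≤ ε := by
        induction s using OnePoint.rec with
        | infty => simpa using hε.le
        | coe γ => exact hAε γ fun hγ => hsA ⟨γ, hγ, rfl⟩
      have : 0 ≤ C * C * ‖clopenIndicator hD s‖ := by positivity
      linarith
  have hPν : ∀ᶠ ν in F, ‖P ν‖ ≤ C * C * (toDual (modulus ν) (clopenIndicator hD)).re + ε * B := by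
    filter_upwards [hB, hker] with ν hνB hν
    have hind : HasSum (fun s => ‖ν s‖ * ‖clopenIndicator hD s‖)
        (toDual (modulus ν) (clopenIndicator hD)).re := by
      have h1 := Complex.hasSum_re
        (summable_mul_continuousMap (modulus ν) (clopenIndicator hD)).hasSum
      rw [← toDual_apply] at h1
      refine h1.congr_fun fun s => ?_
      by_cases hs : s ∈ D
      · simp [clopenIndicator_of_mem hD hs, modulus_apply]
      · simp [clopenIndicator_of_notMem hD hs]
    have hnorm : HasSum (fun s => ‖ν s‖) ‖ν‖ := by
      rw [norm_eq_tsum_norm]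
      exact (summable_norm_coe ν).hasSum
    have hsum : HasSum (fun s => ‖ν s‖ * (C * C * ‖clopenIndicator hD s‖ + ε))
        (C * C * (toDual (modulus ν) (clopenIndicator hD)).re + ε * ‖ν‖) := by
      refine ((hind.mul_left (C * C)).add (hnorm.mul_left ε)).congr_fun fun s => ?_
      ring
    have h1 := norm_clm_apply_le_tsum (P - Φ.comp Θ) ν hcomp hsum.summable
    rw [hsum.tsum_eq, _root_.sub_apply, ContinuousLinearMap.comp_apply, hν, map_zero,
      sub_zero] at h1
    refine h1.trans ?_
    gcongr
  -- Passage to the limit.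
  have hPlim : Tendsto P F (𝓝 (P μ)) := by
    have h1 : ⇑P = fun ν => ∑ γ ∈ G, toDual ν (clopenIndicator (hV γ)) • projFamily J a γ :=
      funext hP
    rw [hP μ, h1]
    exact tendsto_finsetSum _ fun γ _ => (hμ _).smul_const _
  have hPμ : ‖P μ‖ ≤ C * C * (toDual l (clopenIndicator hD)).re + ε * B := by
    refine le_of_tendsto_of_tendsto hPlim.norm ?_ hPν
    exact (((Complex.continuous_re.tendsto _).comp (hl (clopenIndicator hD))).const_mul
      (C * C)).add_const (ε * B)
  -- Mass estimates outside the finite set `G`.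
  have hsummable : Summable fun s : SSpace J => ‖μ s‖ + ‖l s‖ :=
    (summable_norm_coe μ).add (summable_norm_coe l)
  let Z : Set (SSpace J) := (↑) '' {γ : TSpace J | γ ∉ G}
  have hZ : HasSum (Z.indicator fun s => ‖μ s‖ + ‖l s‖)
      (∑' γ : {γ // γ ∉ G}, (‖μ γ.1‖ + ‖l γ.1‖)) := by
    have h1 := (hsummable.indicator Z).hasSum
    have h2 : ∑' x : Z, (‖μ x‖ + ‖l x‖) = ∑' γ : {γ // γ ∉ G}, (‖μ γ.1‖ + ‖l γ.1‖) :=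
      tsum_image (fun s => ‖μ s‖ + ‖l s‖) OnePoint.coe_injective.injOn
    rwa [← tsum_subtype, h2] at h1
  have hGZ : ∀ γ ∈ G, (γ : SSpace J) ∉ Z := by
    rintro γ hγ ⟨γ', hγ', h⟩
    rw [OnePoint.coe_injective h] at hγ'
    exact hγ' hγ
  have hlD : (toDual l (clopenIndicator hD)).re ≤ ε := by
    refine (Complex.re_le_norm _).trans ?_
    rw [toDual_apply]
    refine (tsum_of_norm_bounded hZ fun s => ?_).trans hG
    by_cases hs : s ∈ D
    · obtain ⟨⟨γ, hγA, rfl⟩, hγ⟩ := hs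
      have hγG : γ ∉ G := fun h => hγ (Set.mem_biUnion h (hself γ))
      rw [Set.indicator_of_mem (Set.mem_image_of_mem _ hγG), norm_mul,
        clopenIndicator_of_mem hD ⟨⟨γ, hγA, rfl⟩, hγ⟩, norm_one, mul_one]
      exact le_add_of_nonneg_left (norm_nonneg _)
    · rw [clopenIndicator_of_notMem hD hs, mul_zero, norm_zero]
      exact Set.indicator_nonneg (fun _ _ => by positivity) _
  have hdiff : ‖(Θ - P) μ‖ ≤ 2 * C * ε := by
    have hle : ∀ s, ‖(Θ - P) (pointMass s)‖ ≤ Z.indicator (fun _ => 2 * C) s := by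
      intro s
      rw [_root_.sub_apply, hΘ]
      induction s using OnePoint.rec with
      | infty =>
        rw [projFamily_infty, hPnot _ fun γ _ => by simp [V], sub_zero, norm_zero]
        exact Set.indicator_nonneg (fun _ _ => by positivity) _
      | coe γ =>
        by_cases hγ : γ ∈ G
        · rw [hPmem γ hγ γ (hself γ), sub_self, norm_zero]
          exact Set.indicator_nonneg (fun _ _ => by positivity) _
        · rw [Set.indicator_of_mem (Set.mem_image_of_mem _ hγ)]
          have h1 : ‖P (pointMass (γ : SSpace J))‖ ≤ C := by
            by_cases hs : ∃ γ' ∈ G, (γ : SSpace J) ∈ V γ'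
            · obtain ⟨γ', hγ', hsγ⟩ := hs
              rw [hPmem γ' hγ' γ hsγ]
              exact norm_projFamily_le hC _
            · push Not at hs
              rw [hPnot _ hs, norm_zero]
              exact hC0
          have h2 : ‖projFamily J a γ‖ ≤ C := norm_projFamily_le hC _
          exact (norm_sub_le _ _).trans (by linarith)
    have hterm : ∀ s, ‖μ s‖ * Z.indicator (fun _ => 2 * C) s ≤
        2 * C * Z.indicator (fun s => ‖μ s‖ + ‖l s‖) s := by
      intro s
      by_cases hs : s ∈ Z
      · rw [Set.indicator_of_mem hs, Set.indicator_of_mem hs]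
        nlinarith [mul_nonneg hC0 (norm_nonneg (l s))]
      · rw [Set.indicator_of_notMem hs, Set.indicator_of_notMem hs, mul_zero, mul_zero]
    have hsum : Summable fun s => ‖μ s‖ * Z.indicator (fun _ => 2 * C) s :=
      Summable.of_nonneg_of_le (fun s => mul_nonneg (norm_nonneg _)
        (Set.indicator_nonneg (fun _ _ => by positivity) _)) hterm (hZ.mul_left _).summable
    refine (norm_clm_apply_le_tsum (Θ - P) μ hle hsum).trans ?_
    refine (hsum.tsum_le_tsum hterm (hZ.mul_left _).summable).trans ?_
    rw [(hZ.mul_left (2 * C)).tsum_eq]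
    gcongr
  have h1 : Θ μ = (Θ - P) μ + P μ := by
    rw [_root_.sub_apply, sub_add_cancel]
  rw [h1]
  refine (norm_add_le _ _).trans ?_
  have h2 := mul_le_mul_of_nonneg_left hlD (mul_nonneg hC0 hC0)
  linarith

/-- The intersections of `ker Θ` with balls are weak*-closed. -/
theorem apply_eq_zero_of_tendsto (hJ : IsAdditivelySparse J) (hC : ∀ k, ‖convPow a k‖ ≤ C)
    (hfin : ∀ k, ∃ w : ℕ, ∀ q, convPow a k q ≠ 0 → |q| ≤ w)
    (hsup : Tendsto (fun k => supNorm (convPow a k)) atTop (𝓝 0))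
    {Θ : ℓ¹(SSpace J, ℂ) →L[ℂ] ℓ¹(ℤ, ℂ)} (hΘ : ∀ s, Θ (pointMass s) = projFamily J a s)
    (F : Ultrafilter ℓ¹(SSpace J, ℂ)) {B : ℝ}
    (hB : ∀ᶠ ν in (F : Filter ℓ¹(SSpace J, ℂ)), ‖ν‖ ≤ B)
    (hker : ∀ᶠ ν in (F : Filter ℓ¹(SSpace J, ℂ)), Θ ν = 0) {μ : ℓ¹(SSpace J, ℂ)}
    (hμ : ∀ f : C(SSpace J, ℂ), Tendsto (fun ν => toDual ν f) F (𝓝 (toDual μ f))) : Θ μ = 0 := by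
  have := t2Space_tSpace hJ
  obtain ⟨l, hl⟩ := exists_tendsto_modulus F hB
  have hsum : Summable fun γ : TSpace J => ‖μ γ‖ + ‖l γ‖ :=
    ((summable_norm_coe μ).add (summable_norm_coe l)).comp_injective OnePoint.coe_injective
  have hev : ∀ ε : ℝ, 0 < ε → ‖Θ μ‖ ≤ (2 * C + C * C + B) * ε := by
    intro ε hε
    obtain ⟨G, hG⟩ := ((tendsto_tsum_compl_atTop_zero
      fun γ : TSpace J => ‖μ γ‖ + ‖l γ‖).eventually_lt_const hε).exists
    exact norm_apply_le_of_tendsto hJ hC hfin hsup hΘ F hB hker hμ hl G hε hG.le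
  have hlim : Tendsto (fun ε : ℝ => (2 * C + C * C + B) * ε) (𝓝[>] 0) (𝓝 0) := by
    have h : Tendsto (fun ε : ℝ => (2 * C + C * C + B) * ε) (𝓝 0) (𝓝 ((2 * C + C * C + B) * 0)) :=
      tendsto_id.const_mul _
    rw [mul_zero] at h
    exact h.mono_left nhdsWithin_le_nhds
  rw [← norm_le_zero_iff]
  exact ge_of_tendsto hlim (eventually_mem_nhdsWithin.mono fun ε hε => hev ε hε)

end KernelBall

/-! ### The predual induced by a weak*-closed kernel -/

section WeakStarClosed

variable {K : Type*} [TopologicalSpace K] [CompactSpace K] [T2Space K] [Countable K]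
  {Θ : ℓ¹(K, ℂ) →L[ℂ] ℓ¹(ℤ, ℂ)}

/-- The intersections of `ker Θ` with balls are weak*-closed, expressed by ultrafilters. -/
def HasWeakStarClosedBalls (Θ : ℓ¹(K, ℂ) →L[ℂ] ℓ¹(ℤ, ℂ)) : Prop :=
  ∀ (F : Ultrafilter ℓ¹(K, ℂ)) (B : ℝ) (μ : ℓ¹(K, ℂ)),
    (∀ᶠ ν in (F : Filter ℓ¹(K, ℂ)), ‖ν‖ ≤ B) → (∀ᶠ ν in (F : Filter ℓ¹(K, ℂ)), Θ ν = 0) →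
    (∀ f : C(K, ℂ), Tendsto (fun ν => toDual ν f) F (𝓝 (toDual μ f))) → Θ μ = 0

/-- By the Krein–Šmulian theorem, the preannihilator of `ker Θ` separates `ker Θ` from every other
point. -/
theorem exists_mem_preannihilator_of_apply_ne_zero (hball : HasWeakStarClosedBalls Θ)
    {μ : ℓ¹(K, ℂ)} (hμ : Θ μ ≠ 0) : ∃ f ∈ preannihilator Θ, toDual μ f ≠ 0 := by
  let M : Submodule ℂ (C(K, ℂ) →L[ℂ] ℂ) :=
    (Θ.comp (dualEquiv (K := K)).symm.toContinuousLinearMap).toLinearMap.ker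
  have hM : ∀ Λ, Λ ∈ M ↔ Θ (dualEquiv.symm Λ) = 0 := fun Λ => Iff.rfl
  have hclosed : ∀ r : ℝ, IsClosed {Λ : WeakDual ℂ C(K, ℂ) |
      WeakDual.toStrongDual Λ ∈ M ∧ ‖WeakDual.toStrongDual Λ‖ ≤ r} := by
    intro r
    rw [isClosed_iff_ultrafilter]
    intro Λ u hu hmem
    let F : Ultrafilter ℓ¹(K, ℂ) := u.map fun Λ => dualEquiv.symm (WeakDual.toStrongDual Λ)
    have heval : ∀ f : C(K, ℂ), Tendsto (fun ν => toDual ν f) F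
        (𝓝 (toDual (dualEquiv.symm (WeakDual.toStrongDual Λ)) f)) := by
      intro f
      rw [← dualEquiv_apply, ContinuousLinearEquiv.apply_symm_apply]
      change Tendsto (fun ν => toDual ν f) (Filter.map _ (u : Filter (WeakDual ℂ C(K, ℂ)))) _
      rw [tendsto_map'_iff]
      have h := ((WeakDual.eval_continuous f).tendsto Λ).mono_left hu
      refine h.congr fun Λ' => ?_
      change _ = dualEquiv (dualEquiv.symm (WeakDual.toStrongDual Λ')) f
      rw [ContinuousLinearEquiv.apply_symm_apply]
      rfl
    refine ⟨hball F (‖(dualEquiv (K := K)).symm.toContinuousLinearMap‖ * r) _ ?_ ?_ heval, ?_⟩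
    · change ∀ᶠ Λ' in (u : Filter (WeakDual ℂ C(K, ℂ))), _
      filter_upwards [hmem] with Λ' hΛ'
      exact ((dualEquiv (K := K)).symm.toContinuousLinearMap.le_opNorm _).trans
        (mul_le_mul_of_nonneg_left hΛ'.2 (norm_nonneg _))
    · change ∀ᶠ Λ' in (u : Filter (WeakDual ℂ C(K, ℂ))), _
      filter_upwards [hmem] with Λ' hΛ' using hΛ'.1
    · have h := (isClosed_iff_ultrafilter.1
        (WeakDual.isClosed_closedBall (𝕜 := ℂ) (0 : C(K, ℂ) →L[ℂ] ℂ) r)) Λ u hu ?_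
      · simpa using h
      · filter_upwards [hmem] with Λ' hΛ'
        simpa using hΛ'.2
  obtain ⟨f, hf, hfμ⟩ := exists_annihilating_of_isClosed_inter_ball M hclosed
    (Λ₀ := toDual μ) (by rwa [hM, ← dualEquiv_apply, ContinuousLinearEquiv.symm_apply_apply])
  refine ⟨f, fun ν hν => ?_, hfμ⟩
  rw [← toDual_apply]
  refine hf _ ?_
  rwa [hM, ← dualEquiv_apply, ContinuousLinearEquiv.symm_apply_apply]

theorem isClosed_weakStarTopology_ker (hball : HasWeakStarClosedBalls Θ) :
    IsClosed[weakStarTopology K] {μ | Θ μ = 0} := by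
  have h : {μ | Θ μ = 0} = (fun (μ : ℓ¹(K, ℂ)) (f : C(K, ℂ)) => ∑' s, μ s * f s) ⁻¹'
      {v | ∀ f ∈ preannihilator Θ, v f = 0} := by
    ext μ
    constructor
    · exact fun hμ f hf => hf μ hμ
    · intro hμ
      by_contra hne
      obtain ⟨f, hf, hfμ⟩ := exists_mem_preannihilator_of_apply_ne_zero hball hne
      rw [toDual_apply] at hfμ
      exact hfμ (hμ f hf)
  rw [isClosed_induced_iff, h]
  refine ⟨_, ?_, rfl⟩
  simp only [Set.ofPred_forall]
  exact isClosed_biInter fun f _ => isClosed_eq (continuous_apply f) continuous_const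

end WeakStarClosed

theorem isInvertible_of_bijective {E F : Type*} [NormedAddCommGroup E] [NormedSpace ℂ E]
    [CompleteSpace E] [NormedAddCommGroup F] [NormedSpace ℂ F] [CompleteSpace F] {L : E →L[ℂ] F}
    (hi : Function.Injective L) (hs : Function.Surjective L) : L.IsInvertible :=
  ⟨ContinuousLinearEquiv.ofBijective L (LinearMap.ker_eq_bot.2 hi)
    (LinearMap.range_eq_top.2 hs), rfl⟩

theorem isInvertible_iota_of_bijective (E : Submodule ℂ ℓ^∞(ℤ, ℂ))
    (hi : Function.Injective (iota E)) (hs : Function.Surjective (iota E)) :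
    (iota E).IsInvertible :=
  isInvertible_of_bijective (E := ℓ¹(ℤ, ℂ)) (F := E →L[ℂ] ℂ) hi hs

section Preannihilator

variable {K : Type*} [TopologicalSpace K] [CompactSpace K] {Θ : ℓ¹(K, ℂ) →L[ℂ] ℓ¹(ℤ, ℂ)}

theorem isClosed_preannihilator : IsClosed (preannihilator Θ : Set C(K, ℂ)) := by
  have h : (preannihilator Θ : Set C(K, ℂ)) = ⋂ (μ) (_ : Θ μ = 0), {f | toDual μ f = 0} := by
    ext f
    simp only [Set.mem_iInter, Set.mem_ofPred_eq, toDual_apply]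
    rfl
  rw [h]
  exact isClosed_biInter fun μ _ => isClosed_eq (toDual μ).continuous continuous_const

end Preannihilator

section Pairing

theorem dualityPairing_pointMass (n : ℤ) (x : ℓ^∞(ℤ, ℂ)) :
    dualityPairing (pointMass n) x = x n := by
  classical
  rw [dualityPairing_apply, tsum_eq_single n]
  · simp [pointMass_apply]
  · intro m hm
    simp [pointMass_apply, hm]

theorem norm_dualityPairing_le (b : ℓ¹(ℤ, ℂ)) (x : ℓ^∞(ℤ, ℂ)) :
    ‖dualityPairing b x‖ ≤ ‖x‖ * ‖b‖ :=
  norm_clm_apply_le (dualityPairing.flip x) b fun n => by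
    rw [ContinuousLinearMap.flip_apply, dualityPairing_pointMass]
    exact lp.norm_apply_le_norm (by simp) x n

end Pairing

section Pushforward

variable {S : Type*} [AddCommMonoid S] {φ : ℤ →+ S} {Θ : ℓ¹(S, ℂ) →L[ℂ] ℓ¹(ℤ, ℂ)}

/-- The inclusion of `ℓ¹(ℤ)` into `ℓ¹(S)`. -/
def pushforward (φ : ℤ →+ S) : ℓ¹(ℤ, ℂ) →L[ℂ] ℓ¹(S, ℂ) :=
  ofFamily (fun n => pointMass (φ n)) 1 fun _ => (norm_pointMass _).le

theorem apply_pushforward (hΘ : ∀ n, Θ (pointMass (φ n)) = pointMass n) (b : ℓ¹(ℤ, ℂ)) :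
    Θ (pushforward φ b) = b := by
  have h : Θ.comp (pushforward φ) = ContinuousLinearMap.id ℂ _ := by
    refine clm_ext_pointMass fun n => ?_
    rw [ContinuousLinearMap.comp_apply, pushforward, ofFamily_pointMass, hΘ]
    rfl
  exact congrArg (fun L => L b) h

end Pushforward

section InducedPredual

variable {K : Type*} [TopologicalSpace K] [CompactSpace K] [AddCommMonoid K] {φ : ℤ →+ K}
  {Θ : ℓ¹(K, ℂ) →L[ℂ] ℓ¹(ℤ, ℂ)}

theorem norm_restrictInt_le (f : C(K, ℂ)) : ‖restrictInt φ f‖ ≤ ‖f‖ :=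
  lp.norm_le_of_forall_le (norm_nonneg _) fun n => f.norm_coe_le_norm (φ n)

theorem toDual_pushforward (b : ℓ¹(ℤ, ℂ)) (f : C(K, ℂ)) :
    toDual (pushforward φ b) f = dualityPairing b (restrictInt φ f) := by
  have h : (toDual.flip f).comp (pushforward φ) = dualityPairing.flip (restrictInt φ f) := by
    refine clm_ext_pointMass fun n => ?_
    rw [ContinuousLinearMap.comp_apply, ContinuousLinearMap.flip_apply,
      ContinuousLinearMap.flip_apply, dualityPairing_pointMass, pushforward, ofFamily_pointMass,
      toDual, ofFamily_pointMass]
    rfl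
  exact congrArg (fun L => L b) h

/-- A function in the preannihilator of `ker Θ` does not distinguish `μ` from `Θ μ`. -/
theorem toDual_apply_of_mem_preannihilator (hΘ : ∀ n, Θ (pointMass (φ n)) = pointMass n)
    {f : C(K, ℂ)} (hf : f ∈ preannihilator Θ) (μ : ℓ¹(K, ℂ)) :
    toDual μ f = dualityPairing (Θ μ) (restrictInt φ f) := by
  have h := hf (μ - pushforward φ (Θ μ)) (by rw [map_sub, apply_pushforward hΘ, sub_self])
  rw [← toDual_apply, map_sub, _root_.sub_apply, toDual_pushforward] at h
  exact sub_eq_zero.1 h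

theorem norm_le_of_mem_preannihilator (hΘ : ∀ n, Θ (pointMass (φ n)) = pointMass n)
    {f : C(K, ℂ)} (hf : f ∈ preannihilator Θ) : ‖f‖ ≤ ‖Θ‖ * ‖restrictInt φ f‖ := by
  refine (ContinuousMap.norm_le _ (by positivity)).2 fun s => ?_
  rw [← toDual_pointMass, toDual_apply_of_mem_preannihilator hΘ hf, mul_comm]
  refine (norm_dualityPairing_le _ _).trans ?_
  gcongr
  exact norm_clm_pointMass_le Θ s

theorem isClosed_inducedPredual (hΘ : ∀ n, Θ (pointMass (φ n)) = pointMass n) :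
    IsClosed (inducedPredual φ Θ : Set ℓ^∞(ℤ, ℂ)) := by
  let R : preannihilator Θ →L[ℂ] ℓ^∞(ℤ, ℂ) :=
    LinearMap.mkContinuous ((restrictInt φ).domRestrict (preannihilator Θ)) 1 fun f => by
      rw [one_mul]
      exact norm_restrictInt_le f.1
  have hR : AntilipschitzWith ‖Θ‖₊ R := R.antilipschitz_of_bound fun f =>
    norm_le_of_mem_preannihilator hΘ f.2
  have hcomplete : CompleteSpace (preannihilator Θ) :=
    isClosed_preannihilator.completeSpace_coe
  have hrange : (inducedPredual φ Θ : Set ℓ^∞(ℤ, ℂ)) = Set.range R := by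
    ext x
    constructor
    · rintro ⟨f, hf, rfl⟩
      exact ⟨⟨f, hf⟩, rfl⟩
    · rintro ⟨f, rfl⟩
      exact ⟨f.1, f.2, rfl⟩
  rw [hrange]
  exact hR.isClosed_range R.uniformContinuous

theorem iota_injective_of_separating (hΘ : ∀ n, Θ (pointMass (φ n)) = pointMass n)
    (hsep : ∀ μ, Θ μ ≠ 0 → ∃ f ∈ preannihilator Θ, toDual μ f ≠ 0) :
    Function.Injective (iota (inducedPredual φ Θ)) := by
  refine (injective_iff_map_eq_zero _).2 fun b hb => ?_
  by_contra hne
  obtain ⟨f, hf, hfb⟩ := hsep (pushforward φ b) (by rwa [apply_pushforward hΘ])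
  refine hfb ?_
  rw [toDual_pushforward]
  exact congrArg (fun Λ => Λ ⟨restrictInt φ f, f, hf, rfl⟩) hb

/-- A functional on the induced predual extends to `C(K)` by the Hahn–Banach theorem; it is then
given by some `μ ∈ ℓ¹(K)`, and `Θ μ` represents it on the predual. -/
theorem iota_surjective [T2Space K] [Countable K]
    (hΘ : ∀ n, Θ (pointMass (φ n)) = pointMass n) :
    Function.Surjective (iota (inducedPredual φ Θ)) := by
  intro ψ
  let R : preannihilator Θ →L[ℂ] inducedPredual φ Θ :=
    LinearMap.mkContinuous (((restrictInt φ).domRestrict (preannihilator Θ)).codRestrict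
      (inducedPredual φ Θ) fun f => ⟨f.1, f.2, rfl⟩) 1 fun f => by
      rw [one_mul]
      exact norm_restrictInt_le f.1
  obtain ⟨Λ, hΛ, -⟩ := exists_extension_norm_eq (preannihilator Θ) (ψ.comp R)
  obtain ⟨μ, hμ⟩ := toDual_surjective Λ
  refine ⟨Θ μ, ?_⟩
  ext ⟨x, f, hf, rfl⟩
  have h := toDual_apply_of_mem_preannihilator hΘ hf μ
  rw [hμ] at h
  exact h.symm.trans (hΛ ⟨f, hf⟩)

theorem isInvertible_iota [T2Space K] [Countable K]
    (hΘ : ∀ n, Θ (pointMass (φ n)) = pointMass n)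
    (hsep : ∀ μ, Θ μ ≠ 0 → ∃ f ∈ preannihilator Θ, toDual μ f ≠ 0) :
    (iota (inducedPredual φ Θ)).IsInvertible :=
  isInvertible_iota_of_bijective _ (iota_injective_of_separating hΘ hsep) (iota_surjective hΘ)

/-- Translations by elements of `ℤ` preserve the preannihilator since `ker Θ` is an ideal. -/
theorem translate_mem_inducedPredual (hadd : ∀ s : K, Continuous fun t : K => s + t)
    (hΘ : IsHomProjection φ Θ) (k : ℤ) {x : ℓ^∞(ℤ, ℂ)} (hx : x ∈ inducedPredual φ Θ) :
    translate k x ∈ inducedPredual φ Θ := by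
  obtain ⟨f, hf, rfl⟩ := hx
  let τ : C(K, K) := ⟨fun t => φ k + t, hadd (φ k)⟩
  have hτ : ∀ μ : ℓ¹(K, ℂ), toDual μ (f.comp τ) = toDual (conv (pointMass (φ k)) μ) f := by
    intro μ
    have h : toDual.flip (f.comp τ) = (toDual.flip f).comp (convL (pointMass (φ k))) := by
      refine clm_ext_pointMass fun s => ?_
      rw [ContinuousLinearMap.comp_apply, ContinuousLinearMap.flip_apply,
        ContinuousLinearMap.flip_apply, convL_apply, conv_pointMass, toDual_pointMass,
        toDual_pointMass]
      rfl
    rw [← convL_apply]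
    exact congrArg (fun L => L μ) h
  refine ⟨f.comp τ, fun μ hμ => ?_, ?_⟩
  · rw [← toDual_apply, hτ, toDual_apply]
    refine hf _ ?_
    rw [hΘ.map_conv, hμ, ← convL_apply, map_zero]
  · ext n
    change f (φ k + φ n) = f (φ (n + k))
    rw [← map_add, add_comm]

end InducedPredual

/-! ### Convergence along the sparse set -/

section Convergence

variable {J : Set ℤ}

theorem tendsto_ofInt_gen (J : Set ℤ) :
    Tendsto (ofInt J) (cofinite ⊓ 𝓟 J) (𝓝 (gen J)) := by
  have h : Tendsto (fun n : ℤ => pt J n 0) (cofinite ⊓ 𝓟 J) (𝓝 (pt J 0 1)) := by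
    rw [(hasBasis_nhds _).tendsto_right_iff]
    intro N _
    rw [eventually_inf_principal]
    filter_upwards [(Set.finite_Icc (-(N : ℤ)) N).compl_mem_cofinite] with j hj hjJ
    rw [mem_basicNhd]
    refine ⟨Nat.zero_le _, ?_⟩
    rw [pt_fst, pt_fst, pt_snd, pt_snd, sub_zero, Nat.sub_zero, ← zero_add 1, mem_sumSet_succ]
    refine ⟨j, hjJ, ?_, by rw [sub_self, mem_sumSet_zero]⟩
    rw [Set.mem_compl_iff, Set.mem_Icc] at hj
    omega
  exact (OnePoint.continuous_coe.tendsto _).comp h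

/-- In the weak*-topology of the induced predual, `δ_n → Θ(δ_e)` as `|n| → ∞` through `J`. -/
theorem tendsto_iota_pointMass {Θ : ℓ¹(SSpace J, ℂ) →L[ℂ] ℓ¹(ℤ, ℂ)}
    (hΘ : ∀ n, Θ (pointMass (ofInt J n)) = pointMass n) (x : inducedPredual (ofInt J) Θ) :
    Tendsto (fun n : ℤ => iota (inducedPredual (ofInt J) Θ) (pointMass n) x) (cofinite ⊓ 𝓟 J)
      (𝓝 (iota (inducedPredual (ofInt J) Θ) (Θ (pointMass (gen J))) x)) := by
  obtain ⟨_, f, hf, rfl⟩ := x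
  have h1 : iota (inducedPredual (ofInt J) Θ) (Θ (pointMass (gen J)))
      ⟨restrictInt (ofInt J) f, f, hf, rfl⟩ = f (gen J) := by
    rw [← toDual_pointMass, toDual_apply_of_mem_preannihilator hΘ hf]
    rfl
  rw [h1]
  refine ((f.continuous.tendsto _).comp (tendsto_ofInt_gen J)).congr fun n => ?_
  exact (dualityPairing_pointMass n (restrictInt (ofInt J) f)).symm

/-- As a weak*-limit of point masses, `Θ(δ_e)` has norm at most `1` in the dual of the predual. -/
theorem norm_iota_apply_gen_le (hJ : J.Infinite) {Θ : ℓ¹(SSpace J, ℂ) →L[ℂ] ℓ¹(ℤ, ℂ)}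
    (hΘ : ∀ n, Θ (pointMass (ofInt J n)) = pointMass n) :
    ‖iota (inducedPredual (ofInt J) Θ) (Θ (pointMass (gen J)))‖ ≤ 1 := by
  have hne : (cofinite ⊓ 𝓟 J).NeBot := hJ.cofinite_inf_principal_neBot
  refine ContinuousLinearMap.opNorm_le_bound _ zero_le_one fun x => ?_
  refine le_of_tendsto (tendsto_iota_pointMass hΘ x).norm (Eventually.of_forall fun n => ?_)
  have h := norm_dualityPairing_le (pointMass n) x
  rw [norm_pointMass, mul_one] at h
  rw [one_mul]
  exact h

end Convergence

theorem one_lt_three_div_sqrt_five : 1 < 3 / √5 := by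
  rw [one_lt_div (by positivity), Real.sqrt_lt' (by norm_num)]
  norm_num

theorem norm_iota_of_isometry {E : Submodule ℂ ℓ^∞(ℤ, ℂ)} (h : Isometry (iota E))
    (b : ℓ¹(ℤ, ℂ)) : ‖iota E b‖ = ‖b‖ :=
  Isometry.norm_map_of_map_zero (E := ℓ¹(ℤ, ℂ)) (F := E →L[ℂ] ℂ) (f := iota E) h
    (map_zero (iota E)) b

theorem hasWeakStarClosedBalls_of_isHomProjection {J : Set ℤ} (hJ : IsAdditivelySparse J)
    [T2Space (SSpace J)] {Θ : ℓ¹(SSpace J, ℂ) →L[ℂ] ℓ¹(ℤ, ℂ)} (hΘ : IsHomProjection (ofInt J) Θ)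
    (ha : Θ (pointMass (gen J)) = newmanElement) : HasWeakStarClosedBalls Θ := by
  obtain ⟨C, hC⟩ := isPowerBounded_newmanElement
  refine fun F B μ hB hker hμ => apply_eq_zero_of_tendsto hJ hC
    (fun k => ⟨2 * k, abs_le_of_convPow_newmanElement_ne_zero k⟩)
    tendsto_supNorm_convPow_newmanElement (fun s => ?_) F hB hker hμ
  rw [hΘ.apply_pointMass, ha]

end ShiftPredual

end

open ShiftPredual
theorem mainTheorem7 :
    (‖newmanElement‖ = 3 / √5 ∧ 1 < ‖newmanElement‖) ∧
    IsPowerBounded newmanElement ∧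
    Tendsto (fun n : ℕ => supNorm (convPow newmanElement n)) atTop (𝓝 0) ∧
    IsAdditivelySparse (Set.range fun n : ℕ => (2 : ℤ) ^ n) ∧
    ∀ J : Set ℤ, IsAdditivelySparse J →
      IsSemitopologicalCompactification (ofInt J) ∧
      (∃! Θ : ℓ¹(SSpace J, ℂ) →L[ℂ] ℓ¹(ℤ, ℂ),
        IsHomProjection (ofInt J) Θ ∧ Θ (pointMass (gen J)) = newmanElement) ∧
      ∀ Θ : ℓ¹(SSpace J, ℂ) →L[ℂ] ℓ¹(ℤ, ℂ),
        IsHomProjection (ofInt J) Θ → Θ (pointMass (gen J)) = newmanElement →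
        IsClosed[weakStarTopology (SSpace J)] {μ | Θ μ = 0} ∧
        IsShiftInvariantPredual (inducedPredual (ofInt J) Θ) ∧
        (∀ x : inducedPredual (ofInt J) Θ,
          Tendsto (fun n : ℤ => iota (inducedPredual (ofInt J) Θ) (pointMass n) x)
            (cofinite ⊓ 𝓟 J) (𝓝 (iota (inducedPredual (ofInt J) Θ) newmanElement x))) ∧
        (iota (inducedPredual (ofInt J) Θ)).IsInvertible ∧
        ¬ Isometry (iota (inducedPredual (ofInt J) Θ)) := by
  have hnorm : 1 < ‖newmanElement‖ := norm_newmanElement ▸ one_lt_three_div_sqrt_five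
  refine ⟨⟨norm_newmanElement, hnorm⟩, isPowerBounded_newmanElement,
    tendsto_supNorm_convPow_newmanElement, isAdditivelySparse_range_two_pow, fun J hJ =>
    ⟨isSemitopologicalCompactification_ofInt hJ,
      existsUnique_isHomProjection isPowerBounded_newmanElement, fun Θ hΘ ha => ?_⟩⟩
  have hT2 : T2Space (SSpace J) := (isSemitopologicalCompactification_ofInt hJ).t2Space
  have hint : ∀ n, Θ (pointMass (ofInt J n)) = pointMass n :=
    hΘ.apply_pointMass_embedding ofInt_injective
  have hball := hasWeakStarClosedBalls_of_isHomProjection hJ hΘ ha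
  have hinv : (iota (inducedPredual (ofInt J) Θ)).IsInvertible :=
    isInvertible_iota hint fun μ => exists_mem_preannihilator_of_apply_ne_zero hball
  refine ⟨isClosed_weakStarTopology_ker hball,
    ⟨⟨isClosed_inducedPredual hint, hinv⟩, fun k x hx =>
      translate_mem_inducedPredual (continuous_add_left_sSpace hJ) hΘ k hx⟩,
    fun x => ha ▸ tendsto_iota_pointMass hint x, hinv, fun hiso => ?_⟩
  have h1 := norm_iota_apply_gen_le hJ.1 hint
  rw [ha, norm_iota_of_isometry hiso] at h1
  exact hnorm.not_ge h1
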